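/- \textbf{Conventions.} Constants are finite binary strings. An instance is a finite set of facts $R(t_1,\dots,t_n)$ over constants and labelled nulls; a database is an instance without nulls; $\mathrm{adom}(J)$ is the set of terms occurring in $J$; $|I|$ is the number of facts of $I$; $J[\mathsf T]$ is the set of facts of $J$ over the schema $\mathsf T$. A setting $\mathcal S=\langle\mathsf S,\mathsf T,\Sigma_{st},\Sigma_t\rangle$ consists of disjoint finite schemas $\mathsf S,\mathsf T$, a finite set $\Sigma_{st}$ of tuple-generating dependencies (TGDs) from $\mathsf S$ to $\mathsf T$, and a finite set $\Sigma_t$ of TGDs and equality-generating dependencies (EGDs) over $\mathsf T$; dependencies may mention constants. It is weakly acyclic if no cycle of the dependency graph of the TGDs of $\Sigma_t$ contains a special edge. (Its nodes are the positions of $\mathsf T$; for each TGD, each variable $x$ shared by body and head, and each body position $\pi$ of $x$, there is a normal edge from $\pi$ to every head position of $x$ and a special edge from $\pi$ to every head position of an existential variable.) A source instance is a database over $\mathsf S$. An ex-choice $\gamma$ assigns, to each TGD $\rho$ and each tuple of constants for the variables shared by its body and head, one constant to each existential variable of $\rho$. $\Sigma^\gamma$ is obtained from $\Sigma$ by replacing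 each TGD by all its ground versions (variables replaced by constants) whose existential variables are assigned as $\gamma$ prescribes. An instance $J$ over $\mathsf T$ is a supported solution of a source instance $I$ if, for some ex-choice $\gamma$, $I\cup J\models\Sigma_{st}^\gamma$ and $J\models\Sigma_t^\gamma$, while no $J'\subsetneq J$ has both properties. $\mathrm{ssol}(I,\mathcal S)$ is the set of these, and $\mathrm{ssol}(I,\mathcal S)|_S$ the set of those with $\mathrm{adom}(J)\subseteq S$. Queries are first-order formulas with equality and constants under the active domain semantics, and $Q(J)\subseteq\mathrm{adom}(J)^{\mathrm{ar}(Q)}$. The supported certain answers are $\mathrm{scert}_{\mathcal S}(I,Q)=\bigcap_{J\in\mathrm{ssol}(I,\mathcal S)}Q(J)$. A program is a finite set of safe Datalog rules with negation and equality (constraints included, facts excluded) and of safe choice rules. A choice rule $r$, that is, $H\text{ :- }B,\mathit{choice}((X),(Y))$, with $\mathbf x,\mathbf y$ listing $X,Y$, abbreviates the rules $\mathrm{Range}_r(\mathbf y)\text{ :- }B$; $\ H\text{ :- }B,\mathrm{Chosen}_r(\mathbf x,\mathbf y)$; $\ \mathrm{Chosen}_r(\mathbf x,\mathbf y)\text{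 :- }B,\neg\mathrm{DiffChoice}_r(\mathbf x,\mathbf y)$; and, for each $i$, $\mathrm{DiffChoice}_r(\mathbf x,\mathbf y)\text{ :- }\mathrm{Chosen}_r(\mathbf x,\mathbf w),\mathrm{Range}_r(\mathbf y),y_i\neq w_i$, with fresh relations $\mathrm{Range}_r,\mathrm{Chosen}_r,\mathrm{DiffChoice}_r$ and fresh variables $\mathbf w$. $\mathrm{SM}(\mathcal P\cup D)$ is the set of stable models of $\mathcal P$ together with a database $D$. A query $Q$ over $\mathsf T$ sees only the relations of $\mathsf T$: the cautious answers are $\mathrm{cans}_{\mathcal P}(D,Q)=\bigcap_{M\in\mathrm{SM}(\mathcal P\cup D)}Q(M[\mathsf T])$, so quantifiers range over $\mathrm{adom}(M[\mathsf T])$. $\mathrm{SCERT}(\mathcal S,Q)$ is the problem whether $\mathbf t\in\mathrm{scert}_{\mathcal S}(I,Q)$ for a given source instance $I$ and tuple $\mathbf t$ of constants; $\mathrm{CANS}(\mathcal P,Q)$ is the problem whether $\mathbf t\in\mathrm{cans}_{\mathcal P}(D,Q)$ for a given database $D$ and tuple $\mathbf t$ of constants. Databases are presented to Turing machines as lists of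 their facts without repetitions. \textbf{Theorem.} For every weakly acyclic setting $\mathcal S=\langle\mathsf S,\mathsf T,\Sigma_{st},\Sigma_t\rangle$ there are a program $\mathcal P$ with choice rules and a polynomial $\mathsf{pol}$, both depending only on $\mathcal S$, such that for every first-order query $Q$ over $\mathsf T$ the following hold. \begin{enumerate} \item For every source instance $I$ and every set $C$ of exactly $\mathsf{pol}(|I|)$ constants not occurring in $\mathcal S$, $I$ or $Q$, $$\mathrm{scert}_{\mathcal S}(I,Q)=\bigcap_{J\in\mathrm{ssol}(I,\mathcal S)|_S}Q(J),$$ where $S$ consists of $C$ and all constants occurring in $\mathcal S$, $I$ or $Q$. \item There are a map $I\mapsto C_I$ to finite sets of constants and a map $I\mapsto D_I$ to databases such that $(I,\mathbf t)\mapsto(D_I,\mathbf t)$ is a polynomial-time many-one reduction of $\mathrm{SCERT}(\mathcal S,Q)$ to $\mathrm{CANS}(\mathcal P,Q)$ and, for every source instance $I$: $C_I$ consists of exactly $\mathsf{pol}(|I|)$ constants not occurring in $\mathcal S$, $I$ or $Q$; $$\{M[\mathsf T]\mid M\in\mathrm{SM}(\mathcal P\cup D_I)\}=\mathrm{ssol}(I,\mathcal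 S)|_{S_I},$$ where $S_I$ consists of $C_I$ and all constants occurring in $\mathcal S$, $I$ or $Q$; and $\mathrm{cans}_{\mathcal P}(D_I,Q)=\mathrm{scert}_{\mathcal S}(I,Q)$. \end{enumerate} -/

import Mathlib

namespace DataExchange

/-! ### Relations, values, atoms, instances -/

/-- Constants, realised as the binary strings, a countably infinite set. -/
abbrev Const := List Bool

/-- Variables. -/
abbrev Var := ℕ

/-- A relation name together with its arity, written `R/n`. -/
structure Rel where
  name : List Bool
  arity : ℕ
  deriving DecidableEq

/-- The terms that may occur in instances: constants and labelled nulls. -/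
inductive Val where
  | const (c : Const)
  | null (k : ℕ)
  deriving DecidableEq

/-- The terms that may occur in dependencies, queries and rules: constants and variables. -/
inductive Term where
  | const (c : Const)
  | var (v : Var)
  deriving DecidableEq

/-- A type of relation symbols with arities. -/
class Vocabulary (R : Type) where
  ar : R → ℕ

instance : Vocabulary Rel := ⟨Rel.arity⟩

/-- Atoms over the relation symbols `R` whose arguments are drawn from `τ`. -/
structure Atom (R : Type) [Vocabulary R] (τ : Type) where
  rel : R
  args : Fin (Vocabulary.ar rel) → τ
  deriving DecidableEq

namespace Atom

variable {R : Type} [Vocabulary R]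

def map {τ σ : Type} (f : τ → σ) (a : Atom R τ) : Atom R σ := ⟨a.rel, fun i => f (a.args i)⟩

def HasVar (a : Atom R Term) (v : Var) : Prop := ∃ i, a.args i = .var v

def HasConst (a : Atom R Term) (c : Const) : Prop := ∃ i, a.args i = .const c

end Atom

/-- The value of a term under an assignment of the variables. -/
def Term.eval (s : Var → Val) : Term → Val
  | .const c => .const c
  | .var v => s v

/-- The result of replacing variables by constants in a term. -/
def Term.ground (h : Var → Const) : Term → Const
  | .const c => c
  | .var v => h v

/-- An instance is a finite set of facts. -/
abbrev Instance := Finset (Atom Rel Val)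

/-- A database is an instance without nulls. -/
abbrev Database := Finset (Atom Rel Const)

/-- A database regarded as an instance. -/
def Database.toInstance (I : Database) : Instance := I.image (Atom.map Val.const)

/-- The constants occurring in a database. -/
def Database.consts (I : Database) : Set Const := {c | ∃ a ∈ I, ∃ i, a.args i = c}

/-- The active domain: all terms occurring in an instance. -/
def Instance.adom (J : Instance) : Set Val := {x | ∃ a ∈ J, ∃ i, a.args i = x}

/-- The instance `J` is over the schema `T`. -/
def Instance.IsOver (J : Instance) (T : Finset Rel) : Prop := ∀ a ∈ J, a.rel ∈ T

/-- `J[T]`: the facts of `J` whose relation is in `T`. -/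
def Instance.restrict (J : Instance) (T : Finset Rel) : Instance := J.filter (fun a => a.rel ∈ T)

/-! ### Dependencies -/

/-- A tuple-generating dependency `body → ∃ z, head`; the existential variables `z` are the
variables of the head that do not occur in the body. -/
structure TGD where
  body : List (Atom Rel Term)
  head : List (Atom Rel Term)
  deriving DecidableEq

namespace TGD

/-- The frontier: the variables shared by body and head. -/
def frontier (ρ : TGD) : Set Var :=
  {v | (∃ a ∈ ρ.body, a.HasVar v) ∧ ∃ a ∈ ρ.head, a.HasVar v}

/-- The existential variables. -/
def exvar (ρ : TGD) : Set Var :=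
  {v | (¬ ∃ a ∈ ρ.body, a.HasVar v) ∧ ∃ a ∈ ρ.head, a.HasVar v}

def consts (ρ : TGD) : Set Const :=
  {c | (∃ a ∈ ρ.body, a.HasConst c) ∨ ∃ a ∈ ρ.head, a.HasConst c}

end TGD

/-- An equality-generating dependency `body → x = y`. -/
structure EGD where
  body : List (Atom Rel Term)
  x : Var
  y : Var
  x_mem : ∃ a ∈ body, a.HasVar x
  y_mem : ∃ a ∈ body, a.HasVar y
  deriving DecidableEq

def EGD.consts (η : EGD) : Set Const := {c | ∃ a ∈ η.body, a.HasConst c}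

/-- `J` satisfies the EGD `η`: every homomorphism from its body to `J` equates `x` and `y`. -/
def EGD.Sat (η : EGD) (J : Instance) : Prop :=
  ∀ s : Var → Val, (∀ a ∈ η.body, a.map (Term.eval s) ∈ J) → s η.x = s η.y

/-- An ex-choice: for each TGD and each tuple of constants for its frontier, one constant for each
existential variable. -/
abbrev ExChoice := (ρ : TGD) → (ρ.frontier → Const) → ρ.exvar → Const

/-- The ground version of `ρ` via `h` is coherent with `γ`. -/
def TGD.Coherent (ρ : TGD) (γ : ExChoice) (h : Var → Const) : Prop :=
  ∀ z : ρ.exvar, h z = γ ρ (fun y => h y) z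

/-- `J` satisfies the ground version of `ρ` via `h`. -/
def TGD.GroundSat (ρ : TGD) (h : Var → Const) (J : Instance) : Prop :=
  (∀ a ∈ ρ.body, a.map (fun u => Val.const (u.ground h)) ∈ J) →
    ∀ a ∈ ρ.head, a.map (fun u => Val.const (u.ground h)) ∈ J

/-- `J` satisfies all ground versions of `ρ` that are coherent with `γ`. -/
def TGD.SatUnder (ρ : TGD) (γ : ExChoice) (J : Instance) : Prop :=
  ∀ h : Var → Const, ρ.Coherent γ h → ρ.GroundSat h J

/-! ### Data exchange settings and supported solutions -/

/-- A data exchange setting: disjoint (finite) source and target schemas, source-to-target TGDs,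
and target dependencies, the latter split into TGDs and EGDs. -/
structure Setting where
  source : Finset Rel
  target : Finset Rel
  disjoint : Disjoint source target
  stTGDs : Finset TGD
  tTGDs : Finset TGD
  tEGDs : Finset EGD
  st_body : ∀ ρ ∈ stTGDs, ∀ a ∈ ρ.body, a.rel ∈ source
  st_head : ∀ ρ ∈ stTGDs, ∀ a ∈ ρ.head, a.rel ∈ target
  t_body : ∀ ρ ∈ tTGDs, ∀ a ∈ ρ.body, a.rel ∈ target
  t_head : ∀ ρ ∈ tTGDs, ∀ a ∈ ρ.head, a.rel ∈ target
  t_egd : ∀ η ∈ tEGDs, ∀ a ∈ η.body, a.rel ∈ target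

namespace Setting

/-- Source instances are databases over the source schema. -/
def IsSource (𝒮 : Setting) (I : Database) : Prop := ∀ a ∈ I, a.rel ∈ 𝒮.source

/-- The constants occurring in the dependencies of a setting. -/
def consts (𝒮 : Setting) : Set Const :=
  {c | (∃ ρ ∈ 𝒮.stTGDs, c ∈ ρ.consts) ∨ (∃ ρ ∈ 𝒮.tTGDs, c ∈ ρ.consts) ∨
    ∃ η ∈ 𝒮.tEGDs, c ∈ η.consts}

/-- `I ∪ J` satisfies `Σ_st^γ` and `J` satisfies `Σ_t^γ`. -/
def SatUnder (𝒮 : Setting) (γ : ExChoice) (I : Database) (J : Instance) : Prop :=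
  (∀ ρ ∈ 𝒮.stTGDs, ρ.SatUnder γ (I.toInstance ∪ J)) ∧
  (∀ ρ ∈ 𝒮.tTGDs, ρ.SatUnder γ J) ∧
  (∀ η ∈ 𝒮.tEGDs, η.Sat J)

/-- The set of supported solutions of `I` with respect to `𝒮`. -/
def ssol (𝒮 : Setting) (I : Database) : Set Instance :=
  {J | J.IsOver 𝒮.target ∧ ∃ γ : ExChoice, 𝒮.SatUnder γ I J ∧
    ∀ J' : Instance, J'.IsOver 𝒮.target → J' ⊂ J → ¬ 𝒮.SatUnder γ I J'}

end Setting

/-! ### Weak acyclicity -/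

/-- A position `R[i]`. -/
abbrev Position := (R : Rel) × Fin (Vocabulary.ar R)

/-- The variable `v` occurs at position `p` in the conjunction `A`. -/
def OccursAt (A : List (Atom Rel Term)) (v : Var) (p : Position) : Prop :=
  ∃ a ∈ A, ∃ i, a.args i = .var v ∧ p = ⟨a.rel, i⟩

/-- Normal edges of the dependency graph. -/
def NormalEdge (D : Finset TGD) (p q : Position) : Prop :=
  ∃ ρ ∈ D, ∃ x ∈ ρ.frontier, OccursAt ρ.body x p ∧ OccursAt ρ.head x q

/-- Special edges of the dependency graph. -/
def SpecialEdge (D : Finset TGD) (p q : Position) : Prop :=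
  ∃ ρ ∈ D, ∃ x ∈ ρ.frontier, OccursAt ρ.body x p ∧ ∃ z ∈ ρ.exvar, OccursAt ρ.head z q

/-- No cycle of the dependency graph of the target TGDs goes through a special edge. -/
def Setting.WeaklyAcyclic (𝒮 : Setting) : Prop :=
  ∀ p q : Position, SpecialEdge 𝒮.tTGDs p q →
    ¬ Relation.ReflTransGen (fun a b => NormalEdge 𝒮.tTGDs a b ∨ SpecialEdge 𝒮.tTGDs a b) q p

/-! ### First-order queries under the active domain semantics -/

/-- First-order formulas with equality and constants. -/
inductive Formula where
  | atom (a : Atom Rel Term)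
  | eq (t u : Term)
  | neg (φ : Formula)
  | and (φ ψ : Formula)
  | or (φ ψ : Formula)
  | ex (v : Var) (φ : Formula)
  | all (v : Var) (φ : Formula)

namespace Formula

/-- Truth of a formula, with quantifiers ranging over the active domain of the instance. -/
def Holds (J : Instance) : Formula → (Var → Val) → Prop
  | atom a, s => a.map (Term.eval s) ∈ J
  | eq t u, s => t.eval s = u.eval s
  | neg φ, s => ¬ φ.Holds J s
  | and φ ψ, s => φ.Holds J s ∧ ψ.Holds J s
  | or φ ψ, s => φ.Holds J s ∨ ψ.Holds J s
  | ex v φ, s => ∃ d ∈ J.adom, φ.Holds J (Function.update s v d)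
  | all v φ, s => ∀ d ∈ J.adom, φ.Holds J (Function.update s v d)

def free : Formula → Set Var
  | atom a => {v | a.HasVar v}
  | eq t u => {v | t = .var v ∨ u = .var v}
  | neg φ => φ.free
  | and φ ψ => φ.free ∪ ψ.free
  | or φ ψ => φ.free ∪ ψ.free
  | ex v φ => φ.free \ {v}
  | all v φ => φ.free \ {v}

def consts : Formula → Set Const
  | atom a => {c | a.HasConst c}
  | eq t u => {c | t = .const c ∨ u = .const c}
  | neg φ => φ.consts
  | and φ ψ => φ.consts ∪ ψ.consts
  | or φ ψ => φ.consts ∪ ψ.consts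
  | ex _ φ => φ.consts
  | all _ φ => φ.consts

/-- The formula is over the schema `T`. -/
def IsOver (T : Finset Rel) : Formula → Prop
  | atom a => a.rel ∈ T
  | eq _ _ => True
  | neg φ => φ.IsOver T
  | and φ ψ => φ.IsOver T ∧ ψ.IsOver T
  | or φ ψ => φ.IsOver T ∧ ψ.IsOver T
  | ex _ φ => φ.IsOver T
  | all _ φ => φ.IsOver T

end Formula

/-- A query `Q(x₁,…,xₙ)`: a formula with a repetition-free tuple listing its free variables. -/
structure Query where
  arity : ℕ
  vars : Fin arity → Var
  vars_injective : Function.Injective vars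
  formula : Formula
  free_eq : formula.free = Set.range vars

/-- The output `Q(J)`: the tuples over the active domain of `J` that satisfy the formula. -/
def Query.output (Q : Query) (J : Instance) : Set (Fin Q.arity → Val) :=
  {t | (∀ i, t i ∈ J.adom) ∧ ∃ s : Var → Val, (∀ i, s (Q.vars i) = t i) ∧ Q.formula.Holds J s}

/-- The supported certain answers. -/
def Setting.scert (𝒮 : Setting) (Q : Query) (I : Database) : Set (Fin Q.arity → Val) :=
  ⋂ J ∈ 𝒮.ssol I, Q.output J

/-! ### Logic programs and stable models -/

/-- Positive literals: atoms and equalities. -/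
inductive Lit (R : Type) [Vocabulary R] (τ : Type) where
  | atom (a : Atom R τ)
  | eq (t u : τ)
  deriving DecidableEq

/-- A rule `head :- pos, ¬ neg`; the head `none` stands for `⊥`. -/
structure Rule (R : Type) [Vocabulary R] (τ : Type) where
  head : Option (Lit R τ)
  pos : List (Lit R τ)
  neg : List (Lit R τ)
  deriving DecidableEq

section

variable {R : Type} [Vocabulary R]

def Lit.map {τ σ : Type} (f : τ → σ) : Lit R τ → Lit R σ
  | .atom a => .atom (a.map f)
  | .eq t u => .eq (f t) (f u)

/-- The arguments `t` that occur in a literal. -/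
def Lit.Has {τ : Type} (t : τ) : Lit R τ → Prop
  | .atom a => ∃ i, a.args i = t
  | .eq u w => u = t ∨ w = t

/-- The relation `r` occurs in a literal. -/
def Lit.HasRel {τ : Type} (r : R) : Lit R τ → Prop
  | .atom a => a.rel = r
  | .eq _ _ => False

namespace Rule

def map {τ σ : Type} (f : τ → σ) (r : Rule R τ) : Rule R σ :=
  ⟨r.head.map (Lit.map f), r.pos.map (Lit.map f), r.neg.map (Lit.map f)⟩

/-- `L` occurs in the rule, positively or under negation. -/
def HasLit {τ : Type} (r : Rule R τ) (L : Lit R τ) : Prop :=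
  r.head = some L ∨ L ∈ r.pos ∨ L ∈ r.neg

def Has {τ : Type} (r : Rule R τ) (t : τ) : Prop := ∃ L, r.HasLit L ∧ L.Has t

/-- The variable occurs in the body. -/
def BodyHasVar (r : Rule R Term) (v : Var) : Prop :=
  ∃ L, (L ∈ r.pos ∨ L ∈ r.neg) ∧ L.Has (.var v)

/-- Every variable of the rule occurs in a positive body literal. -/
def Safe (r : Rule R Term) : Prop := ∀ v : Var, r.Has (.var v) → ∃ L ∈ r.pos, L.Has (.var v)

/-- The rule has the form `H :- .` with `H ≠ ⊥`. -/
def IsFactRule {τ : Type} (r : Rule R τ) : Prop := r.head ≠ none ∧ r.pos = [] ∧ r.neg = []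

end Rule

/-- The rule `a :- .` -/
def factRule {τ : Type} (a : Atom R τ) : Rule R τ := ⟨some (.atom a), [], []⟩

/-- The Herbrand universe: the constants occurring in the rules. -/
def herbrandUniverse (G : Set (Rule R Term)) : Set Const := {c | ∃ r ∈ G, r.Has (.const c)}

/-- The grounding: all ground versions over the Herbrand universe. -/
def grounding (G : Set (Rule R Term)) : Set (Rule R Const) :=
  {g | ∃ r ∈ G, ∃ h : Var → Const,
    (∀ v, r.Has (.var v) → h v ∈ herbrandUniverse G) ∧ g = r.map (Term.ground h)}

/-- The Herbrand base of a set of ground rules. -/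
def herbrandBase (G : Set (Rule R Const)) : Set (Atom R Const) :=
  {a | (∃ r ∈ G, ∃ L, r.HasLit L ∧ L.HasRel a.rel) ∧ ∀ i, ∃ r ∈ G, r.Has (a.args i)}

/-- Satisfaction of a ground positive literal. -/
def Lit.Sat (M : Finset (Atom R Val)) : Lit R Const → Prop
  | .atom a => a.map Val.const ∈ M
  | .eq c d => c = d

/-- Satisfaction of a ground rule. -/
def Rule.Sat (M : Finset (Atom R Val)) (r : Rule R Const) : Prop :=
  (∀ L ∈ r.pos, L.Sat M) → (∀ L ∈ r.neg, ¬ L.Sat M) → ∃ H, r.head = some H ∧ H.Sat M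

/-- Models of a set of ground rules. -/
def IsModel (G : Set (Rule R Const)) (M : Finset (Atom R Val)) : Prop :=
  (∀ f ∈ M, ∃ a ∈ herbrandBase G, f = a.map Val.const) ∧ ∀ r ∈ G, r.Sat M

def IsMinimalModel (G : Set (Rule R Const)) (M : Finset (Atom R Val)) : Prop :=
  IsModel G M ∧ ∀ M' : Finset (Atom R Val), M' ⊂ M → ¬ IsModel G M'

/-- The reduct of a set of ground rules. -/
def reduct (G : Set (Rule R Const)) (M : Finset (Atom R Val)) : Set (Rule R Const) :=
  {r' | ∃ r ∈ G, (∀ L ∈ r.neg, ¬ L.Sat M) ∧ r' = ⟨r.head, r.pos, []⟩}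

/-- `M` is a stable model of the set of rules `G`. -/
def IsStable (G : Set (Rule R Term)) (M : Finset (Atom R Val)) : Prop :=
  IsMinimalModel (reduct (grounding G) M) M

end

/-! ### Choice rules -/

/-- A choice rule `head :- pos, ¬ neg, choice((X),(Y))`, with `X` and `Y` disjoint sets of body
variables, each given in some order. -/
structure ChoiceRule where
  rule : Rule Rel Term
  X : List Var
  Y : List Var
  X_nodup : X.Nodup
  Y_nodup : Y.Nodup
  disjoint : X.Disjoint Y
  X_body : ∀ v ∈ X, rule.BodyHasVar v
  Y_body : ∀ v ∈ Y, rule.BodyHasVar v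
  deriving DecidableEq

/-- The relations extended by the fresh relations `Range_r`, `Chosen_r`, `DiffChoice_r` for each
choice rule `r`. -/
inductive XRel where
  | base (R : Rel)
  | range (r : ChoiceRule)
  | chosen (r : ChoiceRule)
  | diffChoice (r : ChoiceRule)
  deriving DecidableEq

instance : Vocabulary XRel where
  ar
    | .base R => R.arity
    | .range r => r.Y.length
    | .chosen r => r.X.length + r.Y.length
    | .diffChoice r => r.X.length + r.Y.length

/-- An atom over `Rel` as an atom over the extended relations. -/
def Atom.lift {τ : Type} (a : Atom Rel τ) : Atom XRel τ := ⟨.base a.rel, a.args⟩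

def Lit.lift {τ : Type} : Lit Rel τ → Lit XRel τ
  | .atom a => .atom a.lift
  | .eq t u => .eq t u

def Rule.lift {τ : Type} (r : Rule Rel τ) : Rule XRel τ :=
  ⟨r.head.map Lit.lift, r.pos.map Lit.lift, r.neg.map Lit.lift⟩

namespace ChoiceRule

/-- The tuple `x` of the variables in `X`. -/
def x (r : ChoiceRule) (i : Fin r.X.length) : Term := .var (r.X.get i)

/-- The tuple `y` of the variables in `Y`. -/
def y (r : ChoiceRule) (i : Fin r.Y.length) : Term := .var (r.Y.get i)

/-- A tuple `w` of pairwise distinct variables, of the length of `y` and disjoint from `x`, `y`. -/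
def w (r : ChoiceRule) (i : Fin r.Y.length) : Term := .var (r.Y.get i + ((r.X ++ r.Y).sum + 1))

def rangeAtom (r : ChoiceRule) (u : Fin r.Y.length → Term) : Atom XRel Term := ⟨.range r, u⟩

def chosenAtom (r : ChoiceRule) (u : Fin r.Y.length → Term) : Atom XRel Term :=
  ⟨.chosen r, Fin.append r.x u⟩

def diffAtom (r : ChoiceRule) (u : Fin r.Y.length → Term) : Atom XRel Term :=
  ⟨.diffChoice r, Fin.append r.x u⟩

/-- The standard rules for which a choice rule is a shorthand:
* `Range(y) :- body.`
* `H :- body, Chosen(x,y).`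
* `Chosen(x,y) :- body, ¬ DiffChoice(x,y).`
* `DiffChoice(x,y) :- Chosen(x,w), Range(y), y[i] ≠ w[i].` for each `i`. -/
def expand (r : ChoiceRule) : Set (Rule XRel Term) :=
  let b := r.rule.lift
  {⟨some (.atom (r.rangeAtom r.y)), b.pos, b.neg⟩,
   ⟨b.head, b.pos ++ [.atom (r.chosenAtom r.y)], b.neg⟩,
   ⟨some (.atom (r.chosenAtom r.y)), b.pos, b.neg ++ [.atom (r.diffAtom r.y)]⟩} ∪
  {d | ∃ i, d = ⟨some (.atom (r.diffAtom r.y)),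
    [.atom (r.chosenAtom r.w), .atom (r.rangeAtom r.y)], [.eq (r.y i) (r.w i)]⟩}

end ChoiceRule

/-- A program: a finite set of safe rules, none of the form `H :- .` with `H ≠ ⊥`, and safe choice
rules. -/
structure Program where
  rules : Finset (Rule Rel Term)
  choiceRules : Finset ChoiceRule
  rules_safe : ∀ r ∈ rules, r.Safe
  rules_not_fact : ∀ r ∈ rules, ¬ r.IsFactRule
  choice_safe : ∀ r ∈ choiceRules, r.rule.Safe

/-- The standard rules that `P` together with the extensional database `ED` stands for; the
database stands for the rules `a :- .` with `a ∈ ED`. -/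
def Program.withED (P : Program) (ED : Database) : Set (Rule XRel Term) :=
  {r | ∃ r₀ ∈ P.rules, r = r₀.lift} ∪ {r | ∃ r₀ ∈ P.choiceRules, r ∈ r₀.expand} ∪
    {r | ∃ a ∈ ED, r = factRule (a.map Term.const).lift}

/-- The stable models of `P` together with `ED`. -/
def Program.stableModels (P : Program) (ED : Database) : Set (Finset (Atom XRel Val)) :=
  {M | IsStable (P.withED ED) M}

/-- The fact over `Rel` that a fact over the extended relations is, if any. -/
def Atom.unlift : Atom XRel Val → Option (Atom Rel Val)
  | ⟨.base R, u⟩ => some ⟨R, u⟩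
  | ⟨.range _, _⟩ => none
  | ⟨.chosen _, _⟩ => none
  | ⟨.diffChoice _, _⟩ => none

/-- `M[T]`: the facts of `M` whose relation is in the schema `T`. -/
def part (M : Finset (Atom XRel Val)) (T : Finset Rel) : Instance :=
  Instance.restrict (M.biUnion (fun f => f.unlift.toFinset)) T

/-- The cautious answers to the query `Q` over the schema `T`. A query over `T` speaks about the
relations in `T` only, so that its output over `M` is its output over `M[T]`. -/
def Program.cautious (P : Program) (T : Finset Rel) (Q : Query) (ED : Database) :
    Set (Fin Q.arity → Val) :=
  ⋂ M ∈ P.stableModels ED, Q.output (part M T)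

/-! ### Decision problems and polynomial-time reductions -/

/-- The problem `SCERT(𝒮, Q)`: given a source instance and a tuple of constants, is the tuple a
supported certain answer? -/
def SCERT (𝒮 : Setting) (Q : Query) (x : Database × (Fin Q.arity → Const)) : Prop :=
  (fun i => Val.const (x.2 i)) ∈ 𝒮.scert Q x.1

/-- The problem `CANS(P, Q)`: given an extensional database and a tuple of constants, is the tuple
a cautious answer? -/
def CANS (P : Program) (T : Finset Rel) (Q : Query) (x : Database × (Fin Q.arity → Const)) : Prop :=
  (fun i => Val.const (x.2 i)) ∈ P.cautious T Q x.1

/-- A database, listed without repetitions, and an `n`-tuple of constants: what a machine reads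
and writes. -/
structure Listing (n : ℕ) where
  facts : List (Atom Rel Const)
  nodup : facts.Nodup
  tuple : Fin n → Const

/-- The database and the tuple that a listing represents. -/
def Listing.toPair {n : ℕ} (x : Listing n) : Database × (Fin n → Const) :=
  (x.facts.toFinset, x.tuple)

open Computability in
/-- A constant is written as its bits, followed by a comma. -/
def encodeConst (c : Const) : List Γ' := c.map Γ'.bit ++ [Γ'.comma]

open Computability in
/-- A fact is written as the bits of its relation name and its arguments in brackets. -/
def encodeFact (a : Atom Rel Const) : List Γ' :=
  a.rel.name.map Γ'.bit ++ [Γ'.bra] ++ (List.ofFn a.args).flatMap encodeConst ++ [Γ'.ket]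

open Computability in
/-- The facts one after the other, a blank, and the tuple. -/
def Listing.encode {n : ℕ} (x : Listing n) : List Γ' :=
  x.facts.flatMap encodeFact ++ [Γ'.blank] ++ (List.ofFn x.tuple).flatMap encodeConst

/-- `F` is computable in polynomial time on the databases (with tuples) that satisfy `D`: some
Turing machine maps, in polynomially many steps, every listing of an argument to a listing of the
value. -/
def PolyTimeOn {n m : ℕ} (D : Database → Prop)
    (F : Database × (Fin n → Const) → Database × (Fin m → Const)) : Prop :=
  ∃ f : {x : Listing n // D x.toPair.1} → Listing m,
    Nonempty (Turing.TM2ComputableInPolyTime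
      (fun x : {x : Listing n // D x.toPair.1} => x.1.encode) Listing.encode f) ∧
    ∀ x, (f x).toPair = F x.1.toPair

/-- `F` is a polynomial-time many-one reduction of the problem `A`, with inputs in `D`, to `B`. -/
def PolyTimeReduction {n m : ℕ} (D : Database → Prop)
    (A : Database × (Fin n → Const) → Prop) (B : Database × (Fin m → Const) → Prop)
    (F : Database × (Fin n → Const) → Database × (Fin m → Const)) : Prop :=
  PolyTimeOn D F ∧ ∀ x, D x.1 → (A x ↔ B (F x))

/-! ### The bounded domain of constants -/

/-- The constants occurring in `𝒮`, `I` or `Q`. -/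
def occurringConsts (𝒮 : Setting) (Q : Query) (I : Database) : Set Const :=
  𝒮.consts ∪ I.consts ∪ Q.formula.consts

/-- `C` consists of exactly `k` constants not occurring in `𝒮`, `I` or `Q`. -/
def IsFreshSet (𝒮 : Setting) (Q : Query) (I : Database) (k : ℕ) (C : Finset Const) : Prop :=
  C.card = k ∧ ∀ c ∈ C, c ∉ occurringConsts 𝒮 Q I

/-- The supported solutions all of whose terms are constants in `S`. -/
def Setting.ssolOver (𝒮 : Setting) (I : Database) (S : Set Const) : Set Instance :=
  {J ∈ 𝒮.ssol I | J.adom ⊆ Val.const '' S}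

end DataExchange

open DataExchange

/-! Part 1 combines a size bound with a symmetry argument. For the bound, a position is ranked by
the number of end points of special edges from which it can be reached. Weak acyclicity makes this
rank strictly increasing along special edges and monotone along normal ones. By minimality, every
fact of a supported solution is forced by the ground dependencies (`Setting.forall_mem_of_closed`).
Hence a value at a position of rank `i` is obtained from the constants of the setting and the source
instance by at most `i + 1` rounds of applying the ex-choice. Each round enlarges a set of constants
polynomially, and the ranks are bounded by a number that depends only on the setting
(`Setting.WeaklyAcyclic.exists_bound`).

The symmetry is that permutations fixing all occurring constants preserve supported solutions and
query answers (`Setting.ssol_rename`, `Query.output_rename`). A solution has strictly fewer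
constants than `C`, so it can be renamed into the occurring constants and `C`, even with one element
of `C` left out. The spare element is essential: a tuple that is an answer over all bounded
solutions cannot contain a fresh constant, since some renamed copy avoids that constant. The tuple
is therefore fixed by the renaming and can be carried back to the original solution
(`Setting.scert_eq_of_bound`).

For part 2, the program has for each TGD a choice rule that selects, for each frontier tuple, values
of the existential variables from a unary relation `Dom`. Rules for the heads use the recorded
choice, and an EGD becomes a rule with an equality as head, that is, a constraint. In a stable model
`Chosen` is the graph of a function, namely the part of an ex-choice that concerns satisfied bodies,
and the two notions of minimality translate into each other. Both directions work with one-step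
derivations instead of grounding and reduct (`isStable_iff`, `Setting.closedUnder_iff`); they are
`Setting.part_mem_ssolOver` and `Setting.exists_stableModel`.

The database of the reduction lists in `Dom` the constants of the setting and the query and, as
fresh constants, words `1…1` too long to occur anywhere else. A structured stack program appends
these facts in polynomial time and is compiled to a Turing machine (`polyTimeOn_extendDatabase`). -/

namespace DataExchange

/-! ### Ground instances of atoms and minimality -/

/-- The fact obtained from an atom by replacing its variables by constants. -/
def Atom.inst {R : Type} [Vocabulary R] (h : Var → Const) (a : Atom R Term) : Atom R Val :=
  a.map (fun u => Val.const (u.ground h))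

theorem Atom.map_map {R : Type} [Vocabulary R] {τ σ υ : Type} (f : τ → σ) (g : σ → υ)
    (a : Atom R τ) : (a.map f).map g = a.map (g ∘ f) := rfl

theorem Atom.map_congr {R : Type} [Vocabulary R] {τ σ : Type} {f g : τ → σ} {a : Atom R τ}
    (h : ∀ i, f (a.args i) = g (a.args i)) : a.map f = a.map g := by
  unfold Atom.map
  congr 1
  exact funext h

theorem Atom.inst_congr {R : Type} [Vocabulary R] {h h' : Var → Const} {a : Atom R Term}
    (H : ∀ v, a.HasVar v → h v = h' v) : a.inst h = a.inst h' := by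
  refine Atom.map_congr fun i => ?_
  cases e : a.args i with
  | const c => rfl
  | var v => simp [Term.ground, H v ⟨i, e⟩]

/-- All dependencies with existential quantification of a setting. -/
def Setting.tgds (𝒮 : Setting) : Finset TGD := 𝒮.stTGDs ∪ 𝒮.tTGDs

theorem EGD.Sat.mono {η : EGD} {J J' : Instance} (h : η.Sat J) (hJ : J' ⊆ J) : η.Sat J' :=
  fun s hs => h s fun a ha => hJ (hs a ha)

theorem Setting.head_target {𝒮 : Setting} {ρ : TGD} (hρ : ρ ∈ 𝒮.tgds) :
    ∀ a ∈ ρ.head, a.rel ∈ 𝒮.target := by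
  rcases Finset.mem_union.1 hρ with h | h
  · exact 𝒮.st_head ρ h
  · exact 𝒮.t_head ρ h

theorem IsSource.not_target {𝒮 : Setting} {I : Database} (hI : 𝒮.IsSource I) {a : Atom Rel Val}
    (ha : a ∈ I.toInstance) : a.rel ∉ 𝒮.target := by
  obtain ⟨b, hb, rfl⟩ := Finset.mem_image.1 ha
  exact Finset.disjoint_left.1 𝒮.disjoint (hI b hb)

/-- For instances over the target schema, both kinds of TGDs can be evaluated over `I ∪ J`. -/
theorem Setting.satUnder_iff {𝒮 : Setting} {I : Database} (hI : 𝒮.IsSource I) {J : Instance}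
    {γ : ExChoice} : 𝒮.SatUnder γ I J ↔
      (∀ ρ ∈ 𝒮.tgds, ∀ h, ρ.Coherent γ h → (∀ a ∈ ρ.body, a.inst h ∈ I.toInstance ∪ J) →
        ∀ a ∈ ρ.head, a.inst h ∈ J) ∧ ∀ η ∈ 𝒮.tEGDs, η.Sat J := by
  constructor
  · rintro ⟨h1, h2, h3⟩
    refine ⟨fun ρ hρ h hc hb a ha => ?_, h3⟩
    rcases Finset.mem_union.1 hρ with hr | hr
    · rcases Finset.mem_union.1 (h1 ρ hr h hc hb a ha) with h' | h'
      · exact absurd (𝒮.st_head ρ hr a ha) (IsSource.not_target hI h')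
      · exact h'
    · refine h2 ρ hr h hc (fun b hb' => ?_) a ha
      rcases Finset.mem_union.1 (hb b hb') with h' | h'
      · exact absurd (𝒮.t_body ρ hr b hb') (IsSource.not_target hI h')
      · exact h'
  · rintro ⟨h1, h3⟩
    refine ⟨fun ρ hρ h hc hb a ha => Finset.mem_union_right _ (h1 ρ (Finset.mem_union_left _ hρ) h hc hb a ha),
      fun ρ hρ h hc hb a ha => h1 ρ (Finset.mem_union_right _ hρ) h hc
        (fun b hb' => Finset.mem_union_right _ (hb b hb')) a ha, h3⟩

/-- Induction along the chase: a property of facts closed under the ground TGDs holds for all facts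
of a supported solution. -/
theorem Setting.forall_mem_of_closed {𝒮 : Setting} {I : Database} (hI : 𝒮.IsSource I)
    {J : Instance} {γ : ExChoice} (hover : J.IsOver 𝒮.target) (hsat : 𝒮.SatUnder γ I J)
    (hmin : ∀ J' : Instance, J'.IsOver 𝒮.target → J' ⊂ J → ¬ 𝒮.SatUnder γ I J')
    (p : Atom Rel Val → Prop)
    (hp : ∀ ρ ∈ 𝒮.tgds, ∀ h, ρ.Coherent γ h →
      (∀ a ∈ ρ.body, a.inst h ∈ I.toInstance ∨ a.inst h ∈ J ∧ p (a.inst h)) →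
      ∀ a ∈ ρ.head, p (a.inst h)) : ∀ a ∈ J, p a := by
  classical
  have hsub : J.filter p ⊆ J := Finset.filter_subset _ _
  by_contra hne
  have hss : J.filter p ⊂ J := by
    refine Finset.ssubset_iff_subset_ne.2 ⟨hsub, fun e => hne fun a ha => ?_⟩
    rw [← e] at ha
    exact (Finset.mem_filter.1 ha).2
  -- The facts with `p` would be a smaller solution under the same `γ`: heads stay in `J` because
  -- `J` is a solution, they satisfy `p` by `hp`, and EGDs pass to subsets.
  refine hmin _ (fun a ha => hover a (hsub ha)) hss ?_
  rw [satUnder_iff hI] at hsat ⊢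
  refine ⟨fun ρ hρ h hc hb a ha => ?_, fun η hη => (hsat.2 η hη).mono hsub⟩
  refine Finset.mem_filter.2 ⟨hsat.1 ρ hρ h hc (fun b hb' => ?_) a ha,
    hp ρ hρ h hc (fun b hb' => ?_) a ha⟩
  · exact Finset.union_subset_union_right hsub (hb b hb')
  · simpa using hb b hb'

/-! ### Renaming constants -/

/-- The action of a map on constants on the terms of instances. -/
def Val.rename (σ : Const → Const) : Val → Val
  | .const c => .const (σ c)
  | .null k => .null k

theorem Val.rename_symm (σ : Equiv.Perm Const) (x : Val) :
    Val.rename σ.symm (Val.rename σ x) = x := by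
  cases x <;> simp [rename]

theorem Val.rename_injective (σ : Equiv.Perm Const) : Function.Injective (Val.rename σ) :=
  Function.LeftInverse.injective (Val.rename_symm σ)

/-- The action of a map on constants on instances. -/
def Instance.rename (σ : Const → Const) (J : Instance) : Instance :=
  J.image (Atom.map (Val.rename σ))

theorem Atom.map_rename_symm (σ : Equiv.Perm Const) (a : Atom Rel Val) :
    (a.map (Val.rename σ)).map (Val.rename σ.symm) = a := by
  rw [Atom.map_map]
  exact Atom.map_congr (g := id) fun i => Val.rename_symm σ _

theorem Instance.mem_rename (σ : Equiv.Perm Const) {J : Instance} {a : Atom Rel Val} :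
    a.map (Val.rename σ) ∈ J.rename σ ↔ a ∈ J := by
  refine ⟨fun h => ?_, fun h => Finset.mem_image_of_mem _ h⟩
  obtain ⟨b, hb, e⟩ := Finset.mem_image.1 h
  rw [← Atom.map_rename_symm σ a, ← e, Atom.map_rename_symm]
  exact hb

theorem Instance.rename_symm (σ : Equiv.Perm Const) (J : Instance) :
    (J.rename σ).rename σ.symm = J := by
  unfold Instance.rename
  rw [Finset.image_image]
  conv_rhs => rw [← Finset.image_id (s := J)]
  exact Finset.image_congr fun a _ => Atom.map_rename_symm σ a

theorem Instance.adom_rename (σ : Const → Const) (J : Instance) :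
    (J.rename σ).adom = Val.rename σ '' J.adom := by
  ext x
  constructor
  · rintro ⟨a, ha, i, rfl⟩
    obtain ⟨b, hb, rfl⟩ := Finset.mem_image.1 ha
    exact ⟨_, ⟨b, hb, i, rfl⟩, rfl⟩
  · rintro ⟨_, ⟨b, hb, i, rfl⟩, rfl⟩
    exact ⟨_, Finset.mem_image_of_mem _ hb, i, rfl⟩

theorem Instance.IsOver.rename {J : Instance} {T : Finset Rel} (h : J.IsOver T)
    (σ : Const → Const) : (J.rename σ).IsOver T := by
  intro a ha
  obtain ⟨b, hb, rfl⟩ := Finset.mem_image.1 ha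
  exact h b hb

/-- The action of a permutation of the constants on ex-choices. -/
def ExChoice.rename (σ : Equiv.Perm Const) (γ : ExChoice) : ExChoice :=
  fun ρ u z => σ (γ ρ (fun y => σ.symm (u y)) z)

theorem ExChoice.rename_symm (σ : Equiv.Perm Const) (γ : ExChoice) :
    (γ.rename σ).rename σ.symm = γ := by
  funext ρ u z
  simp [ExChoice.rename]

theorem Atom.inst_rename {σ : Equiv.Perm Const} {h : Var → Const} {a : Atom Rel Term}
    (ha : ∀ c, a.HasConst c → σ c = c) :
    (a.inst (fun v => σ.symm (h v))).map (Val.rename σ) = a.inst h := by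
  refine Atom.map_congr (a := a)
    (f := Val.rename σ ∘ fun u => Val.const (u.ground fun v => σ.symm (h v))) fun i => ?_
  cases e : a.args i with
  | const c => simp [Term.ground, Val.rename, ha c ⟨i, e⟩]
  | var v => simp [Term.ground, Val.rename]

theorem mem_toInstance_rename {σ : Equiv.Perm Const} {I : Database} (hσ : ∀ c ∈ I.consts, σ c = c)
    {a : Atom Rel Val} (ha : a.map (Val.rename σ) ∈ I.toInstance) : a ∈ I.toInstance := by
  obtain ⟨b, hb, e⟩ := Finset.mem_image.1 ha
  have : b.map Val.const = a := by
    rw [← Atom.map_rename_symm σ a, ← e, Atom.map_map]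
    refine Atom.map_congr (a := b) fun i => ?_
    have := hσ (b.args i) ⟨b, hb, i, rfl⟩
    have h2 : σ.symm (b.args i) = b.args i := by rw [Equiv.symm_apply_eq, this]
    simp [Val.rename, h2]
  exact this ▸ Finset.mem_image_of_mem _ hb

theorem TGD.mem_consts_tgds {𝒮 : Setting} {ρ : TGD} (hρ : ρ ∈ 𝒮.tgds) {c : Const}
    (hc : c ∈ ρ.consts) : c ∈ 𝒮.consts := by
  rcases Finset.mem_union.1 hρ with h | h
  · exact Or.inl ⟨ρ, h, hc⟩
  · exact Or.inr (Or.inl ⟨ρ, h, hc⟩)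

theorem Term.eval_rename {σ : Const → Const} {s : Var → Val} {u : Term}
    (h : ∀ c, u = .const c → σ c = c) :
    u.eval (fun v => (s v).rename σ) = (u.eval s).rename σ := by
  cases u with
  | const c => simp [Term.eval, Val.rename, h c rfl]
  | var v => rfl

theorem Atom.eval_rename {σ : Const → Const} {s : Var → Val} {a : Atom Rel Term}
    (h : ∀ c, a.HasConst c → σ c = c) :
    a.map (Term.eval fun v => (s v).rename σ) = (a.map (Term.eval s)).map (Val.rename σ) := by
  refine Atom.map_congr (a := a) (g := Val.rename σ ∘ Term.eval s) fun i => ?_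
  exact Term.eval_rename fun c e => h c ⟨i, e⟩

/-- Conjugating `γ` by `σ` matches the coherent ground versions on the two sides: if `h` is coherent
with the renamed choice, then `σ⁻¹ ∘ h` is coherent with `γ`. Constants inside the dependencies do
not move. -/
theorem Setting.SatUnder.rename {𝒮 : Setting} {I : Database} (hI : 𝒮.IsSource I) {J : Instance}
    {γ : ExChoice} {σ : Equiv.Perm Const} (hσ : ∀ c ∈ 𝒮.consts ∪ I.consts, σ c = c)
    (h : 𝒮.SatUnder γ I J) : 𝒮.SatUnder (γ.rename σ) I (J.rename σ) := by
  rw [satUnder_iff hI] at h ⊢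
  refine ⟨fun ρ hρ h' hc hb a ha => ?_, fun η hη s hs => ?_⟩
  · have hfix : ∀ b, b ∈ ρ.body ∨ b ∈ ρ.head → ∀ c, b.HasConst c → σ c = c := fun b hb c hc =>
      hσ c (Or.inl (TGD.mem_consts_tgds hρ
        (hb.imp (fun h => ⟨b, h, hc⟩) fun h => ⟨b, h, hc⟩)))
    rw [← Atom.inst_rename (hfix a (Or.inr ha)), Instance.mem_rename]
    refine h.1 ρ hρ _ (fun z => ?_) (fun b hb' => ?_) a ha
    · rw [hc z]
      simp [ExChoice.rename]
    · have := hb b hb'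
      rw [← Atom.inst_rename (hfix b (Or.inl hb'))] at this
      rcases Finset.mem_union.1 this with h1 | h1
      · exact Finset.mem_union_left _ (mem_toInstance_rename (fun c hc => hσ c (Or.inr hc)) h1)
      · exact Finset.mem_union_right _ ((Instance.mem_rename σ).1 h1)
  · have key := h.2 η hη (fun v => (s v).rename σ.symm) fun a ha => by
      have hfix : ∀ c, a.HasConst c → σ c = c := fun c hc =>
        hσ c (Or.inl (Or.inr (Or.inr ⟨η, hη, a, ha, hc⟩)))
      rw [← Instance.mem_rename σ, ← Atom.eval_rename hfix]
      convert hs a ha using 4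
      exact Val.rename_symm σ.symm _
    exact Val.rename_injective σ.symm key

/-- Satisfaction is carried over by `σ`; a smaller solution of the renamed problem would be carried
back by `σ⁻¹`, which gives minimality. -/
theorem Setting.ssol_rename {𝒮 : Setting} {I : Database} (hI : 𝒮.IsSource I) {J : Instance}
    {σ : Equiv.Perm Const} (hσ : ∀ c ∈ 𝒮.consts ∪ I.consts, σ c = c) (hJ : J ∈ 𝒮.ssol I) :
    J.rename σ ∈ 𝒮.ssol I := by
  obtain ⟨ho, γ, hs, hm⟩ := hJ
  refine ⟨ho.rename σ, γ.rename σ, hs.rename hI hσ, fun J' ho' hss hs' => ?_⟩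
  refine hm (J'.rename σ.symm) (ho'.rename _) ?_ ?_
  · conv_rhs => rw [← Instance.rename_symm σ J]
    refine Finset.ssubset_iff_subset_ne.2 ⟨Finset.image_subset_image hss.1, fun e => ?_⟩
    have := congrArg (Instance.rename σ) e
    have h2 : ∀ K : Instance, (K.rename σ.symm).rename σ = K := Instance.rename_symm σ.symm
    rw [h2, h2] at this
    exact hss.ne this
  · have := hs'.rename hI (σ := σ.symm) fun c hc => by
      rw [Equiv.symm_apply_eq, hσ c hc]
    rwa [ExChoice.rename_symm] at this

/-- Genericity of first-order logic: quantifiers range over the active domain, which is renamed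
along with the instance, and only the constants of the formula have to be fixed. -/
theorem Formula.holds_rename {σ : Equiv.Perm Const} {J : Instance} (φ : Formula) :
    (∀ c ∈ φ.consts, σ c = c) → ∀ s : Var → Val,
      φ.Holds (J.rename σ) (fun v => (s v).rename σ) ↔ φ.Holds J s := by
  have hup : ∀ (s : Var → Val) (v : Var) (d : Val),
      Function.update (fun v => (s v).rename σ) v (d.rename σ) =
        fun w => (Function.update s v d w).rename σ := by
    intro s v d
    funext w
    by_cases h : w = v
    · subst h; simp
    · simp [h]
  induction φ with
  | atom a =>
    intro h s
    simp only [Holds]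
    rw [Atom.eval_rename h, Instance.mem_rename]
  | eq t u =>
    intro h s
    simp only [Holds]
    rw [Term.eval_rename fun c e => h c (Or.inl e), Term.eval_rename fun c e => h c (Or.inr e)]
    exact (Val.rename_injective σ).eq_iff
  | neg φ ih => intro h s; simp only [Holds, ih h s]
  | and φ ψ ih1 ih2 =>
    intro h s
    simp only [Holds, ih1 (fun c hc => h c (Or.inl hc)) s, ih2 (fun c hc => h c (Or.inr hc)) s]
  | or φ ψ ih1 ih2 =>
    intro h s
    simp only [Holds, ih1 (fun c hc => h c (Or.inl hc)) s, ih2 (fun c hc => h c (Or.inr hc)) s]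
  | ex v φ ih =>
    intro h s
    simp only [Holds, Instance.adom_rename, Set.exists_mem_image, hup, ih h]
  | all v φ ih =>
    intro h s
    simp only [Holds, Instance.adom_rename, Set.forall_mem_image, hup, ih h]

theorem Query.output_rename {Q : Query} {σ : Equiv.Perm Const}
    (hσ : ∀ c ∈ Q.formula.consts, σ c = c) {J : Instance} {t : Fin Q.arity → Val}
    (ht : t ∈ Q.output J) : (fun i => (t i).rename σ) ∈ Q.output (J.rename σ) := by
  obtain ⟨h1, s, hs, hh⟩ := ht
  refine ⟨fun i => ?_, fun v => (s v).rename σ, fun i => congrArg _ (hs i), ?_⟩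
  · rw [Instance.adom_rename]
    exact ⟨_, h1 i, rfl⟩
  · exact (Formula.holds_rename Q.formula hσ s).2 hh

/-! ### Certain answers from boundedly many constants -/

/-- A permutation fixing `O` that moves a small finite set into `O ∪ C`. -/
theorem exists_perm_into {α : Type*} (O : Set α) (A C : Finset α)
    (hC : ∀ c ∈ C, c ∉ O) (hcard : A.card ≤ C.card) :
    ∃ σ : Equiv.Perm α, (∀ c ∈ O, σ c = c) ∧ ∀ a ∈ A, σ a ∈ O ∪ (C : Set α) := by
  classical
  set B := A.filter (· ∉ O) with hB
  set X := B ∪ C with hX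
  have hXO : ∀ x ∈ X, x ∉ O := fun x hx =>
    (Finset.mem_union.1 hx).elim (fun h => (Finset.mem_filter.1 h).2) (hC x)
  have hBC : B.card ≤ C.card := (Finset.card_le_card (Finset.filter_subset _ _)).trans hcard
  -- The part `B` of `A` outside `O` is matched with an equally large `C' ⊆ C`. Since `B` and `C`
  -- may overlap, the matching is treated as a partial injection of the finite set `X = B ∪ C`; it
  -- extends to a permutation of `X`, and then by the identity.
  obtain ⟨C', hC'C, hC'⟩ := Finset.exists_subset_card_eq hBC
  let e0 : B ≃ C' := Finset.equivOfCardEq hC'.symm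
  let p : X → Prop := fun x => x.1 ∈ B
  let q : X → Prop := fun x => x.1 ∈ C'
  let e : {x : X // p x} ≃ {x : X // q x} :=
    { toFun := fun x => ⟨⟨(e0 ⟨x.1.1, x.2⟩).1, Finset.mem_union_right _ (hC'C (e0 ⟨x.1.1, x.2⟩).2)⟩,
        (e0 ⟨x.1.1, x.2⟩).2⟩
      invFun := fun y => ⟨⟨(e0.symm ⟨y.1.1, y.2⟩).1, Finset.mem_union_left _ (e0.symm ⟨y.1.1, y.2⟩).2⟩,
        (e0.symm ⟨y.1.1, y.2⟩).2⟩
      left_inv := fun x => by ext; simp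
      right_inv := fun x => by ext; simp }
  let τ : Equiv.Perm X := e.extendSubtype
  refine ⟨Equiv.Perm.ofSubtype (p := (· ∈ X)) τ, fun c hc => ?_, fun a ha => ?_⟩
  · exact Equiv.Perm.ofSubtype_apply_of_not_mem τ fun h => hXO c h hc
  · by_cases hO : a ∈ O
    · left
      rw [Equiv.Perm.ofSubtype_apply_of_not_mem τ fun h => hXO a h hO]
      exact hO
    · right
      have haB : a ∈ B := Finset.mem_filter.2 ⟨ha, hO⟩
      have haX : a ∈ X := Finset.mem_union_left _ haB
      rw [Equiv.Perm.ofSubtype_apply_of_mem τ haX]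
      exact hC'C (Equiv.extendSubtype_mem e ⟨a, haX⟩ haB)

/-- The supported certain answers are determined by the supported solutions over the occurring
constants and sufficiently many fresh ones. -/
theorem Setting.scert_eq_of_bound {𝒮 : Setting} {Q : Query} {I : Database} (hI : 𝒮.IsSource I)
    {k : ℕ} (hk : ∀ J ∈ 𝒮.ssol I, ∃ A : Finset Const, J.adom ⊆ Val.const '' (A : Set Const) ∧ A.card < k)
    {C : Finset Const} (hC : IsFreshSet 𝒮 Q I k C) :
    𝒮.scert Q I = ⋂ J ∈ 𝒮.ssolOver I (occurringConsts 𝒮 Q I ∪ (C : Set Const)), Q.output J := by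
  set O := occurringConsts 𝒮 Q I with hO
  refine Set.Subset.antisymm (fun t ht => ?_) (fun t ht => ?_)
  · simp only [scert, Set.mem_iInter] at ht ⊢
    exact fun J hJ => ht J hJ.1
  simp only [scert, Set.mem_iInter] at ht ⊢
  intro J hJ
  obtain ⟨A, hA, hAk⟩ := hk J hJ
  -- The bound on `A` is strict, so `C` still has room after any one constant `e` has been removed.
  have key : ∀ e : Const, ∃ σ : Equiv.Perm Const, (∀ c ∈ O, σ c = c) ∧
      (J.rename σ).adom ⊆ Val.const '' (O ∪ ((C.erase e : Finset Const) : Set Const)) ∧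
      t ∈ Q.output (J.rename σ) := by
    intro e
    obtain ⟨σ, h1, h2⟩ := exists_perm_into O A (C.erase e)
      (fun c hc => hC.2 c (Finset.mem_of_mem_erase hc)) (by
        have := Finset.pred_card_le_card_erase (s := C) (a := e)
        have := hC.1
        omega)
    have h3 : (J.rename σ).adom ⊆ Val.const '' (O ∪ ((C.erase e : Finset Const) : Set Const)) := by
      rw [Instance.adom_rename]
      rintro _ ⟨x, hx, rfl⟩
      obtain ⟨a, ha, rfl⟩ := hA hx
      exact ⟨σ a, h2 a ha, rfl⟩
    refine ⟨σ, h1, h3, ht _ ⟨ssol_rename hI (fun c hc => h1 c (Or.inl hc)) hJ, h3.trans ?_⟩⟩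
    refine Set.image_mono (Set.union_subset_union_right _ ?_)
    exact_mod_cast Finset.erase_subset e C
  have htO : ∀ i, ∃ c ∈ O, t i = Val.const c := by
    intro i
    by_contra hcon
    -- The constant to avoid is the entry `t i` itself; if that entry is a null, any `e` will do.
    obtain ⟨e, he⟩ : ∃ e, ∀ c, c ≠ e → c ∈ C → t i ≠ Val.const c := by
      rcases hti : t i with c | k
      · exact ⟨c, fun d hd _ h => hd (Val.const.inj h).symm⟩
      · exact ⟨[], fun d _ _ h => by cases h⟩
    obtain ⟨σ, -, h3, h4⟩ := key e
    obtain ⟨c, hc, hct⟩ := h3 (h4.1 i)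
    rcases hc with hc | hc
    · exact hcon ⟨c, hc, hct.symm⟩
    · have := Finset.mem_erase.1 (Finset.mem_coe.1 hc)
      exact he c this.1 this.2 hct.symm
  obtain ⟨σ, h1, -, h4⟩ := key []
  have h1' : ∀ c ∈ O, σ.symm c = c := fun c hc => by rw [Equiv.symm_apply_eq, h1 c hc]
  -- The inverse permutation fixes `O`, which contains the constants of `Q` and, by `htO`, all
  -- entries of `t`.
  have h5 := Query.output_rename (σ := σ.symm) (fun c hc => h1' c (Or.inr hc)) h4
  rw [Instance.rename_symm] at h5
  convert h5 using 1
  funext i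
  obtain ⟨c, hc, e⟩ := htO i
  rw [e]
  simp [Val.rename, h1' c hc]


/-! ### Finiteness of the syntactic data -/

theorem Atom.finite_hasVar (a : Atom Rel Term) : {v | a.HasVar v}.Finite := by
  refine (Set.finite_range fun i => match a.args i with | .var v => v | .const _ => 0).subset ?_
  rintro v ⟨i, hi⟩
  exact ⟨i, by simp [hi]⟩

theorem Atom.finite_hasConst (a : Atom Rel Term) : {c | a.HasConst c}.Finite := by
  refine (Set.finite_range fun i => match a.args i with | .var _ => [] | .const c => c).subset ?_
  rintro v ⟨i, hi⟩
  exact ⟨i, by simp [hi]⟩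

theorem finite_exists_mem_list {α β : Type*} (l : List α) {p : α → β → Prop}
    (h : ∀ a ∈ l, {b | p a b}.Finite) : {b | ∃ a ∈ l, p a b}.Finite := by
  have : {b | ∃ a ∈ l, p a b} = ⋃ a ∈ {a | a ∈ l}, {b | p a b} := by ext; simp
  rw [this]
  exact Set.Finite.biUnion l.finite_toSet h

theorem TGD.finite_frontier (ρ : TGD) : ρ.frontier.Finite :=
  (finite_exists_mem_list ρ.body fun a _ => a.finite_hasVar).subset fun _ h => h.1

theorem TGD.finite_exvar (ρ : TGD) : ρ.exvar.Finite :=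
  (finite_exists_mem_list ρ.head fun a _ => a.finite_hasVar).subset fun _ h => h.2

theorem TGD.finite_consts (ρ : TGD) : ρ.consts.Finite :=
  (finite_exists_mem_list ρ.body fun a _ => a.finite_hasConst).union
    (finite_exists_mem_list ρ.head fun a _ => a.finite_hasConst)

theorem EGD.finite_consts (η : EGD) : η.consts.Finite :=
  finite_exists_mem_list η.body fun a _ => a.finite_hasConst

theorem Setting.finite_consts (𝒮 : Setting) : 𝒮.consts.Finite := by
  have h1 : {c | ∃ ρ ∈ 𝒮.stTGDs, c ∈ ρ.consts}.Finite := by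
    simpa using finite_exists_mem_list 𝒮.stTGDs.toList (p := fun ρ c => c ∈ ρ.consts)
      fun ρ _ => ρ.finite_consts
  have h2 : {c | ∃ ρ ∈ 𝒮.tTGDs, c ∈ ρ.consts}.Finite := by
    simpa using finite_exists_mem_list 𝒮.tTGDs.toList (p := fun ρ c => c ∈ ρ.consts)
      fun ρ _ => ρ.finite_consts
  have h3 : {c | ∃ η ∈ 𝒮.tEGDs, c ∈ η.consts}.Finite := by
    simpa using finite_exists_mem_list 𝒮.tEGDs.toList (p := fun ρ c => c ∈ ρ.consts)
      fun ρ _ => ρ.finite_consts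
  exact h1.union (h2.union h3)

theorem Formula.finite_consts (φ : Formula) : φ.consts.Finite := by
  induction φ with
  | atom a => exact a.finite_hasConst
  | eq t u =>
    have : ∀ t : Term, {c | t = .const c}.Finite := fun t =>
      Set.Subsingleton.finite fun a ha b hb => Term.const.inj (ha.symm.trans hb)
    exact (this t).union (this u)
  | neg φ ih => exact ih
  | and φ ψ h1 h2 => exact h1.union h2
  | or φ ψ h1 h2 => exact h1.union h2
  | ex v φ ih => exact ih
  | all v φ ih => exact ih

/-! ### Ranks of positions -/

/-- Weakly acyclic settings have a bounded ranking of the positions that is monotone along normal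
edges and strictly monotone along special edges. -/
theorem Setting.WeaklyAcyclic.exists_rank {𝒮 : Setting} (h : 𝒮.WeaklyAcyclic) :
    ∃ (r : Position → ℕ) (m : ℕ), (∀ p, r p ≤ m) ∧
      (∀ p q, NormalEdge 𝒮.tTGDs p q → r p ≤ r q) ∧
      ∀ p q, SpecialEdge 𝒮.tTGDs p q → r p < r q := by
  classical
  set E := fun a b => NormalEdge 𝒮.tTGDs a b ∨ SpecialEdge 𝒮.tTGDs a b with hE
  set T : Set Position := {b | ∃ a, SpecialEdge 𝒮.tTGDs a b} with hT
  have hTfin : T.Finite := by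
    have h0 : {b : Position | b.1 ∈ 𝒮.target}.Finite := by
      have : {b : Position | b.1 ∈ 𝒮.target} =
          ((𝒮.target.sigma fun _ => Finset.univ : Finset Position) : Set Position) := by
        ext; simp
      rw [this]
      exact Finset.finite_toSet _
    refine h0.subset ?_
    rintro b ⟨a, ρ, hρ, x, -, -, z, -, c, hc, i, -, rfl⟩
    exact 𝒮.t_head ρ hρ c hc
  -- The rank of `p` is the size of `S p`. Only end points of special edges are counted, so that the
  -- set is finite although there are infinitely many positions.
  let S : Position → Set Position := fun p => {b ∈ T | Relation.ReflTransGen E b p}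
  have hS : ∀ p, (S p).Finite := fun p => hTfin.subset fun _ hb => hb.1
  have hmono : ∀ p q, E p q → S p ⊆ S q := fun p q e b hb => ⟨hb.1, hb.2.tail e⟩
  refine ⟨fun p => (S p).ncard, T.ncard, fun p => Set.ncard_le_ncard (fun _ hb => hb.1) hTfin,
    fun p q e => Set.ncard_le_ncard (hmono p q (Or.inl e)) (hS q), fun p q e => ?_⟩
  -- Along a special edge from `p` to `q` the new element is `q`: if it already belonged to `S p`, a
  -- path from `q` back to `p` would close a cycle through the edge.
  refine Set.ncard_lt_ncard ⟨hmono p q (Or.inr e), fun hsub => ?_⟩ (hS q)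
  exact h p q e (hsub (show q ∈ S q from ⟨⟨p, e⟩, Relation.ReflTransGen.refl⟩)).2

/-! ### Polynomial bound on the active domain -/

/-- Closing a finite set once under an ex-choice enlarges it at most polynomially. -/
theorem exists_closure_step (𝒯 : Finset TGD) : ∃ f : ℕ, ∀ (γ : ExChoice) (A : Finset Const),
    ∃ A' : Finset Const, A ⊆ A' ∧
      (∀ ρ ∈ 𝒯, ∀ u : ρ.frontier → Const, (∀ y, u y ∈ A) → ∀ z, γ ρ u z ∈ A') ∧
      A'.card + 2 ≤ (A.card + 2) ^ f := by
  classical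
  have hF : ∀ ρ : TGD, Nonempty (Fintype ρ.frontier) := fun ρ =>
    ⟨ρ.finite_frontier.fintype⟩
  have hX : ∀ ρ : TGD, Nonempty (Fintype ρ.exvar) := fun ρ => ⟨ρ.finite_exvar.fintype⟩
  let _ : ∀ ρ : TGD, Fintype ρ.frontier := fun ρ => (hF ρ).some
  let _ : ∀ ρ : TGD, Fintype ρ.exvar := fun ρ => (hX ρ).some
  set E := ∑ ρ ∈ 𝒯, Fintype.card ρ.exvar with hE
  set F := ∑ ρ ∈ 𝒯, Fintype.card ρ.frontier with hFd
  -- For each TGD the new values are indexed by a frontier tuple over `A` and an existential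
  -- variable, so at most `E * m ^ F` values are added, where `m = A.card + 2`.
  refine ⟨E + F + 1, fun γ A => ?_⟩
  let B : TGD → Finset Const := fun ρ =>
    ((Fintype.piFinset fun _ : ρ.frontier => A) ×ˢ (Finset.univ : Finset ρ.exvar)).image
      fun uz => γ ρ uz.1 uz.2
  refine ⟨A ∪ 𝒯.biUnion B, Finset.subset_union_left, fun ρ hρ u hu z => ?_, ?_⟩
  · refine Finset.mem_union_right _ (Finset.mem_biUnion.2 ⟨ρ, hρ, Finset.mem_image.2 ⟨(u, z), ?_, rfl⟩⟩)
    simpa using hu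
  · set m := A.card + 2 with hm
    have hB : ∀ ρ ∈ 𝒯, (B ρ).card ≤ Fintype.card ρ.exvar * m ^ F := fun ρ hρ => by
      refine Finset.card_image_le.trans ?_
      rw [Finset.card_product, Fintype.card_piFinset, Finset.prod_const, Finset.card_univ, Finset.card_univ,
        mul_comm]
      refine Nat.mul_le_mul_left _ ?_
      calc A.card ^ Fintype.card ρ.frontier ≤ m ^ Fintype.card ρ.frontier :=
            Nat.pow_le_pow_left (by omega) _
        _ ≤ m ^ F := Nat.pow_le_pow_right (by omega)
            (Finset.single_le_sum (f := fun ρ : TGD => Fintype.card ρ.frontier)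
              (fun _ _ => Nat.zero_le _) hρ)
    have h1 : (A ∪ 𝒯.biUnion B).card ≤ A.card + E * m ^ F := by
      refine (Finset.card_union_le _ _).trans (Nat.add_le_add_left ?_ _)
      refine Finset.card_biUnion_le.trans ((Finset.sum_le_sum hB).trans ?_)
      rw [Finset.sum_mul]
    -- The summand 2 in `m` makes the base at least 2, so that a constant factor can be absorbed
    -- into the exponent.
    have h2 : E + 1 ≤ m ^ E := by
      have : E < 2 ^ E := Nat.lt_two_pow_self
      exact this.trans_le (Nat.pow_le_pow_left (by omega) _)
    have h3 : m ≤ m ^ (F + 1) := Nat.le_self_pow (by omega) _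
    have h4 : m ^ F ≤ m ^ (F + 1) := Nat.pow_le_pow_right (by omega) (by omega)
    calc (A ∪ 𝒯.biUnion B).card + 2 ≤ m + E * m ^ F := by omega
      _ ≤ m ^ (F + 1) + E * m ^ (F + 1) := by gcongr
      _ = (E + 1) * m ^ (F + 1) := by ring
      _ ≤ m ^ E * m ^ (F + 1) := by gcongr
      _ = m ^ (E + F + 1) := by rw [← pow_add, add_assoc]

/-- The constants of a source instance and of a setting, with a linear bound on their number. -/
theorem Setting.exists_initial (𝒮 : Setting) : ∃ d : ℕ, ∀ I : Database, 𝒮.IsSource I →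
    ∃ A : Finset Const, 𝒮.consts ∪ I.consts ⊆ (A : Set Const) ∧ A.card + 2 ≤ (I.card + 2) ^ d := by
  classical
  set s := 𝒮.finite_consts.toFinset.card
  set a := ∑ R ∈ 𝒮.source, R.arity
  -- There are `s` constants in the setting, and each fact contributes at most `a`, the sum of the
  -- arities of the source relations.
  refine ⟨s + a + 1, fun I hI => ?_⟩
  refine ⟨𝒮.finite_consts.toFinset ∪ I.biUnion fun f => Finset.univ.image f.args, ?_, ?_⟩
  · rintro c (hc | ⟨f, hf, i, rfl⟩)
    · simp [hc]
    · simp only [Finset.coe_union, Set.mem_union]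
      right
      simp only [Finset.coe_biUnion, Set.mem_iUnion]
      exact ⟨f, hf, by simp⟩
  · have h1 : (I.biUnion fun f => Finset.univ.image f.args).card ≤ I.card * a := by
      refine Finset.card_biUnion_le_card_mul _ _ _ fun f hf => Finset.card_image_le.trans ?_
      rw [Finset.card_univ, Fintype.card_fin]
      exact Finset.single_le_sum (f := Rel.arity) (fun _ _ => Nat.zero_le _) (hI f hf)
    have h2 : s + a + 1 ≤ (I.card + 2) ^ (s + a) := by
      have : s + a < 2 ^ (s + a) := Nat.lt_two_pow_self
      exact this.trans_le (Nat.pow_le_pow_left (by omega) _)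
    calc _ ≤ s + I.card * a + 2 := by
          have := Finset.card_union_le 𝒮.finite_consts.toFinset
            (I.biUnion fun f => Finset.univ.image f.args)
          omega
      _ ≤ (s + a + 1) * (I.card + 2) := by nlinarith
      _ ≤ (I.card + 2) ^ (s + a) * (I.card + 2) := by gcongr
      _ = _ := by rw [pow_succ]

/-- Starting from the initial constants, the set is closed under the ex-choice once for each rank.
The exponent does not depend on `γ`, since one closure step is polynomial uniformly in the
ex-choice. -/
theorem Setting.WeaklyAcyclic.exists_bound {𝒮 : Setting} (h : 𝒮.WeaklyAcyclic) :
    ∃ d : ℕ, ∀ I : Database, 𝒮.IsSource I → ∀ J ∈ 𝒮.ssol I, ∃ A : Finset Const,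
      J.adom ⊆ Val.const '' (A : Set Const) ∧ A.card < (I.card + 2) ^ d := by
  obtain ⟨r, m, hrm, hn, hs⟩ := h.exists_rank
  obtain ⟨f, hf⟩ := exists_closure_step 𝒮.tgds
  choose step hsub hcl hcard using hf
  obtain ⟨d, hd⟩ := 𝒮.exists_initial
  -- The initial set has exponent `d`, and each of the `m + 1` rounds multiplies the exponent by
  -- `f`.
  refine ⟨d * f ^ (m + 1), fun I hI J hJ => ?_⟩
  obtain ⟨A₀, hA₀, hA₀c⟩ := hd I hI
  obtain ⟨ho, γ, hsat, hmin⟩ := hJ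
  let A : ℕ → Finset Const := fun i => (step γ)^[i] A₀
  have hAs : ∀ i, A (i + 1) = step γ (A i) := fun i => Function.iterate_succ_apply' _ _ _
  have hmono : Monotone A := monotone_nat_of_le_succ fun i => by rw [hAs]; exact hsub γ _
  have hA0 : ∀ i, ∀ c ∈ 𝒮.consts ∪ I.consts, c ∈ A i := fun i c hc =>
    hmono (Nat.zero_le i) (hA₀ hc)
  have hAc : ∀ i, (A i).card + 2 ≤ (I.card + 2) ^ (d * f ^ i) := by
    intro i
    induction i with
    | zero => simpa [A] using hA₀c
    | succ i ih =>
      rw [hAs]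
      refine (hcard γ _).trans ((Nat.pow_le_pow_left ih f).trans ?_)
      rw [← pow_mul, mul_assoc, ← pow_succ]
  refine ⟨A (m + 1), ?_, by have := hAc (m + 1); omega⟩
  have key : ∀ a ∈ J, ∀ i, ∃ c ∈ A (r ⟨a.rel, i⟩ + 1), a.args i = Val.const c := by
    refine forall_mem_of_closed hI ho hsat hmin _ fun ρ hρ g hg hb a ha i => ?_
    -- Bodies of source-to-target TGDs hold in `I`, so their values are available at every stage;
    -- for target TGDs only the stage given by the rank is known.
    have hbody : ∀ y q, OccursAt ρ.body y q →
        (ρ ∈ 𝒮.stTGDs → ∀ j, g y ∈ A j) ∧ (g y ∈ A (r q + 1)) := by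
      rintro y q ⟨b, hbb, j, hj, rfl⟩
      have hval : (b.inst g).args j = Val.const (g y) := by
        change Val.const ((b.args j).ground g) = _
        rw [hj]; rfl
      have hin : b.inst g ∈ I.toInstance → g y ∈ I.consts := fun hIb => by
        obtain ⟨b', hb', e⟩ := Finset.mem_image.1 hIb
        have : ∃ j', (b'.map Val.const).args j' = Val.const (g y) := by rw [e]; exact ⟨j, hval⟩
        obtain ⟨j', hj'⟩ := this
        exact ⟨b', hb', j', Val.const.inj hj'⟩
      constructor
      · intro hst k
        rcases hb b hbb with h1 | h1
        · exact hA0 _ _ (Or.inr (hin h1))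
        · exact absurd (ho _ h1.1) (Finset.disjoint_left.1 𝒮.disjoint (𝒮.st_body ρ hst b hbb))
      · rcases hb b hbb with h1 | h1
        · exact hA0 _ _ (Or.inr (hin h1))
        · obtain ⟨c, hc, e⟩ := h1.2 j
          have e' : g y = c := Val.const.inj (hval.symm.trans e)
          exact e' ▸ hc
    change ∃ c ∈ A (r ⟨a.rel, i⟩ + 1), Val.const ((a.args i).ground g) = _
    refine ⟨_, ?_, rfl⟩
    cases hai : a.args i with
    | const c =>
      exact hA0 _ _ (Or.inl (TGD.mem_consts_tgds hρ (Or.inr ⟨a, ha, i, hai⟩)))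
    | var v =>
      change g v ∈ _
      have hocc : OccursAt ρ.head v ⟨a.rel, i⟩ := ⟨a, ha, i, hai, rfl⟩
      -- A frontier variable is copied along a normal edge, so the stage suffices. For an
      -- existential variable the special edges make the ranks of all frontier positions strictly
      -- smaller, so the frontier tuple is available one stage earlier and its chosen value belongs
      -- to the present stage.
      by_cases hv : ∃ b ∈ ρ.body, b.HasVar v
      · have hfr : v ∈ ρ.frontier := ⟨hv, a, ha, i, hai⟩
        obtain ⟨b, hbb, j, hj⟩ := hv
        have hbo : OccursAt ρ.body v ⟨b.rel, j⟩ := ⟨b, hbb, j, hj, rfl⟩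
        rcases Finset.mem_union.1 hρ with hst | ht
        · exact (hbody v _ hbo).1 hst _
        · exact hmono (Nat.add_le_add_right (hn _ _ ⟨ρ, ht, v, hfr, hbo, hocc⟩) 1)
            (hbody v _ hbo).2
      · have hex : v ∈ ρ.exvar := ⟨hv, a, ha, i, hai⟩
        rw [hg ⟨v, hex⟩, hAs]
        refine hcl γ _ ρ hρ _ (fun y => ?_) _
        obtain ⟨b, hbb, j, hj⟩ := y.2.1
        have hbo : OccursAt ρ.body y ⟨b.rel, j⟩ := ⟨b, hbb, j, hj, rfl⟩
        rcases Finset.mem_union.1 hρ with hst | ht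
        · exact (hbody y _ hbo).1 hst _
        · exact hmono (hs _ _ ⟨ρ, ht, y, y.2, hbo, v, hex, hocc⟩) (hbody y _ hbo).2
  rintro x ⟨a, ha, i, rfl⟩
  obtain ⟨c, hc, e⟩ := key a ha i
  exact ⟨c, hmono (Nat.add_le_add_right (hrm _) 1) hc, e.symm⟩


open Turing

/-! ### Structured programs over finitely many stacks -/

/-- Structured programs over the stacks `K` with symbols in `Γ` and one register, which holds at
most one symbol. -/
inductive Cmd (K Γ : Type)
  /-- do nothing -/
  | skip
  /-- push a symbol that depends on the register -/
  | push (k : K) (f : Option Γ → Γ)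
  /-- sequential composition -/
  | seq (c₁ c₂ : Cmd K Γ)
  /-- run `c` if the register satisfies `p` -/
  | ifReg (p : Option Γ → Bool) (c : Cmd K Γ)
  /-- pop the stack `k` into the register; if it then holds a symbol satisfying `p`, run `c` and
  repeat -/
  | loop (k : K) (p : Γ → Bool) (c : Cmd K Γ)

namespace Cmd

variable {K Γ : Type}

/-- The program points of a structured program. -/
def Label : Cmd K Γ → Type
  | skip => Unit
  | push _ _ => Unit
  | seq c₁ c₂ => c₁.Label ⊕ c₂.Label
  | ifReg _ c => Option c.Label
  | loop _ _ c => Option c.Label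

instance instFintypeLabel : (c : Cmd K Γ) → Fintype c.Label
  | skip => inferInstanceAs (Fintype Unit)
  | push _ _ => inferInstanceAs (Fintype Unit)
  | seq c₁ c₂ =>
    letI := instFintypeLabel c₁
    letI := instFintypeLabel c₂
    inferInstanceAs (Fintype (c₁.Label ⊕ c₂.Label))
  | ifReg _ c =>
    letI := instFintypeLabel c
    inferInstanceAs (Fintype (Option c.Label))
  | loop _ _ c =>
    letI := instFintypeLabel c
    inferInstanceAs (Fintype (Option c.Label))

/-- The program point at which the execution starts. -/
def entry : (c : Cmd K Γ) → c.Label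
  | skip => ()
  | push _ _ => ()
  | seq c₁ _ => Sum.inl c₁.entry
  | ifReg _ _ => none
  | loop _ _ _ => none

/-- Compilation to a stack machine with labels `L`; `exit` is run at the end. -/
def code {L : Type} : (c : Cmd K Γ) → (c.Label → L) → TM2.Stmt (fun _ : K => Γ) L (Option Γ) →
    c.Label → TM2.Stmt (fun _ : K => Γ) L (Option Γ)
  | skip, _, exit, _ => exit
  | push k f, _, exit, _ => .push k f exit
  | seq c₁ c₂, emb, _, Sum.inl l =>
    c₁.code (fun l => emb (Sum.inl l)) (.goto fun _ => emb (Sum.inr c₂.entry)) l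
  | seq _ c₂, emb, exit, Sum.inr l => c₂.code (fun l => emb (Sum.inr l)) exit l
  | ifReg p c, emb, exit, none => .branch p (.goto fun _ => emb (some c.entry)) exit
  | ifReg _ c, emb, exit, some l => c.code (fun l => emb (some l)) exit l
  | loop k p c, emb, exit, none =>
    .pop k (fun _ a => a) (.branch (fun v => v.any p) (.goto fun _ => emb (some c.entry)) exit)
  | loop _ _ c, emb, _, some l => c.code (fun l => emb (some l)) (.goto fun _ => emb none) l

variable [DecidableEq K]

/-- `Exec c v S v' S' t`: started with register `v` and stacks `S`, the program `c` stops after `t`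
steps with register `v'` and stacks `S'`. -/
inductive Exec : Cmd K Γ → Option Γ → (K → List Γ) → Option Γ → (K → List Γ) → ℕ → Prop
  | skip {v S} : Exec skip v S v S 1
  | push {k f v S} : Exec (push k f) v S v (Function.update S k (f v :: S k)) 1
  | seq {c₁ c₂ v S v₁ S₁ v₂ S₂ t₁ t₂} : Exec c₁ v S v₁ S₁ t₁ → Exec c₂ v₁ S₁ v₂ S₂ t₂ →
      Exec (seq c₁ c₂) v S v₂ S₂ (t₁ + t₂)
  | ifTrue {p c v S v₁ S₁ t} : p v = true → Exec c v S v₁ S₁ t → Exec (ifReg p c) v S v₁ S₁ (1 + t)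
  | ifFalse {p c v S} : p v = false → Exec (ifReg p c) v S v S 1
  | loopTrue {k p c v S v₁ S₁ v₂ S₂ t₁ t₂} : (S k).head?.any p = true →
      Exec c (S k).head? (Function.update S k (S k).tail) v₁ S₁ t₁ →
      Exec (loop k p c) v₁ S₁ v₂ S₂ t₂ → Exec (loop k p c) v S v₂ S₂ (1 + (t₁ + t₂))
  | loopFalse {k p c v S} : (S k).head?.any p = false →
      Exec (loop k p c) v S (S k).head? (Function.update S k (S k).tail) 1

/-- The compiled program executes the structured program. -/
theorem Exec.steps {c : Cmd K Γ} {v v' : Option Γ} {S S' : K → List Γ} {t : ℕ}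
    (h : Exec c v S v' S' t) : ∀ {L : Type} (M : L → TM2.Stmt (fun _ : K => Γ) L (Option Γ))
      (emb : c.Label → L) (exit : TM2.Stmt (fun _ : K => Γ) L (Option Γ)),
      (∀ l, M (emb l) = c.code emb exit l) →
      (flip bind (TM2.step M))^[t] (some ⟨some (emb c.entry), v, S⟩) =
        some (TM2.stepAux exit v' S') := by
  have one : ∀ {L : Type} (M : L → TM2.Stmt (fun _ : K => Γ) L (Option Γ)) (l : L) (v : Option Γ)
      (S : K → List Γ), flip bind (TM2.step M) (some ⟨some l, v, S⟩) =
        some (TM2.stepAux (M l) v S) := fun _ _ _ _ => rfl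
  induction h with
  | skip =>
    intro L M emb exit hM
    rw [Function.iterate_one, one, hM]
    rfl
  | push =>
    intro L M emb exit hM
    rw [Function.iterate_one, one, hM]
    rfl
  | @seq c₁ c₂ v S v₁ S₁ v₂ S₂ t₁ t₂ h₁ h₂ ih₁ ih₂ =>
    intro L M emb exit hM
    have e1 := ih₁ M (fun l => emb (Sum.inl l)) (.goto fun _ => emb (Sum.inr c₂.entry))
      fun l => hM (Sum.inl l)
    have e2 := ih₂ M (fun l => emb (Sum.inr l)) exit fun l => hM (Sum.inr l)
    -- The inner iterate runs first, so the summands are swapped to put `t₁` there.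
    rw [add_comm, Function.iterate_add_apply]
    exact (congrArg _ e1).trans e2
  | @ifTrue p c v S v₁ S₁ t hp h ih =>
    intro L M emb exit hM
    have e := ih M (fun l => emb (some l)) exit fun l => hM (some l)
    rw [add_comm, Function.iterate_add_apply, Function.iterate_one, one, hM]
    refine Eq.trans ?_ e
    simp [entry, code, hp]
  | ifFalse hp =>
    intro L M emb exit hM
    rw [Function.iterate_one, one, hM]
    simp [entry, code, hp]
  | @loopTrue k p c v S v₁ S₁ v₂ S₂ t₁ t₂ hp h₁ h₂ ih₁ ih₂ =>
    intro L M emb exit hM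
    have e1 := ih₁ M (fun l => emb (some l)) (.goto fun _ => emb none) fun l => hM (some l)
    have e2 := ih₂ M emb exit hM
    rw [add_comm, Function.iterate_add_apply, Function.iterate_one, one, hM, add_comm,
      Function.iterate_add_apply]
    refine Eq.trans (congrArg _ (Eq.trans ?_ e1)) e2
    simp [entry, code, hp]
  | loopFalse hp =>
    intro L M emb exit hM
    rw [Function.iterate_one, one, hM]
    simp [entry, code, hp]

/-! ### Time bounds for structured programs -/

/-- Execution within a time bound. -/
def Runs (c : Cmd K Γ) (v : Option Γ) (S : K → List Γ) (v' : Option Γ) (S' : K → List Γ)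
    (T : ℕ) : Prop := ∃ t ≤ T, Exec c v S v' S' t

theorem Runs.mono {c : Cmd K Γ} {v v' : Option Γ} {S S' : K → List Γ} {T T' : ℕ}
    (h : Runs c v S v' S' T) (hT : T ≤ T') : Runs c v S v' S' T' :=
  let ⟨t, ht, e⟩ := h
  ⟨t, ht.trans hT, e⟩

theorem Runs.skip {v : Option Γ} {S : K → List Γ} : Runs (Cmd.skip : Cmd K Γ) v S v S 1 :=
  ⟨1, le_rfl, .skip⟩

theorem Runs.push {k : K} {f : Option Γ → Γ} {v : Option Γ} {S S' : K → List Γ}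
    (h : Function.update S k (f v :: S k) = S') : Runs (Cmd.push k f) v S v S' 1 :=
  ⟨1, le_rfl, h ▸ .push⟩

theorem Runs.seq {c₁ c₂ : Cmd K Γ} {v v₁ v₂ : Option Γ} {S S₁ S₂ : K → List Γ} {T₁ T₂ : ℕ}
    (h₁ : Runs c₁ v S v₁ S₁ T₁) (h₂ : Runs c₂ v₁ S₁ v₂ S₂ T₂) :
    Runs (Cmd.seq c₁ c₂) v S v₂ S₂ (T₁ + T₂) :=
  let ⟨_, ht₁, e₁⟩ := h₁
  let ⟨_, ht₂, e₂⟩ := h₂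
  ⟨_, Nat.add_le_add ht₁ ht₂, .seq e₁ e₂⟩

theorem Runs.ifTrue {p : Option Γ → Bool} {c : Cmd K Γ} {v v₁ : Option Γ} {S S₁ : K → List Γ}
    {T : ℕ} (hp : p v = true) (h : Runs c v S v₁ S₁ T) : Runs (Cmd.ifReg p c) v S v₁ S₁ (1 + T) :=
  let ⟨_, ht, e⟩ := h
  ⟨_, Nat.add_le_add_left ht 1, .ifTrue hp e⟩

theorem Runs.ifFalse {p : Option Γ → Bool} {c : Cmd K Γ} {v : Option Γ} {S : K → List Γ}
    (hp : p v = false) : Runs (Cmd.ifReg p c) v S v S 1 := ⟨1, le_rfl, .ifFalse hp⟩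

/-- The run of a loop, given the stacks `S i` after `i` iterations. -/
theorem Runs.loop {k : K} {p : Γ → Bool} {c : Cmd K Γ} {T n : ℕ} (S : ℕ → K → List Γ)
    (hstep : ∀ i < n, (S i k).head?.any p = true ∧
      ∃ v', Runs c (S i k).head? (Function.update (S i) k (S i k).tail) v' (S (i + 1)) T)
    (hend : (S n k).head?.any p = false) (v : Option Γ) :
    Runs (Cmd.loop k p c) v (S 0) (S n k).head? (Function.update (S n) k (S n k).tail)
      (n * (T + 1) + 1) := by
  induction n generalizing S v with
  | zero => exact ⟨1, by omega, .loopFalse hend⟩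
  | succ n ih =>
    obtain ⟨h1, v', t, ht, e⟩ := hstep 0 (Nat.succ_pos n)
    obtain ⟨t', ht', e'⟩ := ih (fun i => S (i + 1)) (fun i hi => hstep (i + 1) (by omega)) hend v'
    exact ⟨_, by rw [Nat.succ_mul]; omega, .loopTrue h1 e e'⟩

/-- The run of a loop that empties its stack. -/
theorem Runs.loop_all {k : K} {c : Cmd K Γ} {T n : ℕ} (S : ℕ → K → List Γ)
    (hlen : ∀ i ≤ n, (S i k).length = n - i)
    (hstep : ∀ i < n, ∀ a l, S i k = a :: l →
      ∃ v', Runs c (some a) (Function.update (S i) k l) v' (S (i + 1)) T) (v : Option Γ) :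
    Runs (Cmd.loop k (fun _ => true) c) v (S 0) none (S n) (n * (T + 1) + 1) := by
  have hn : S n k = [] := List.length_eq_zero_iff.1 (by simpa using hlen n le_rfl)
  have := Runs.loop (p := fun _ => true) (c := c) (T := T) S (fun i hi => ?_)
    (show (S n k).head?.any _ = false by rw [hn]; rfl) v
  · rw [hn] at this
    -- The last test pops the empty stack, which leaves it unchanged and the register empty.
    have h2 : Function.update (S n) k ([] : List Γ).tail = S n := by
      rw [List.tail_nil, ← hn, Function.update_eq_self]
    rwa [h2] at this
  · have hl := hlen i hi.le
    cases e : S i k with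
    | nil => rw [e, List.length_nil] at hl; omega
    | cons a l => exact ⟨rfl, hstep i hi a l e⟩

/-- Push a list of symbols. -/
def pushList (k : K) : List Γ → Cmd K Γ
  | [] => skip
  | a :: l => seq (pushList k l) (push k fun _ => a)

/-- The tail is pushed before the head, so the list can be read from the top of the stack; the extra
step is the final `skip`. -/
theorem Runs.pushList {k : K} {l : List Γ} {v : Option Γ} {S S' : K → List Γ}
    (h : Function.update S k (l ++ S k) = S') : Runs (Cmd.pushList k l) v S v S' (l.length + 1) := by
  induction l generalizing S' with
  | nil =>
    subst h
    simpa [Cmd.pushList] using Runs.skip (v := v) (S := S)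
  | cons a l ih =>
    refine (ih rfl).seq (Runs.push ?_)
    rw [← h]
    simp

/-- The stack machine that runs a structured program over finitely many symbols. -/
def machine [Fintype K] [Fintype Γ] (c : Cmd K Γ) (k : K) : FinTM2 where
  K := K
  k₀ := k
  k₁ := k
  Γ _ := Γ
  Λ := c.Label
  main := c.entry
  σ := Option Γ
  initialState := none
  Γk₀Fin := inferInstanceAs (Fintype Γ)
  m := c.code id .halt

/-- The machine model asks for the initial register and for empty stacks other than the output stack
on halting. This is why runs have to end with register `none` and cleared stacks. -/
theorem Runs.outputs [Fintype K] [Fintype Γ] {c : Cmd K Γ} {k : K} {l l' : List Γ} {T : ℕ}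
    (h : Runs c none (Function.update (fun _ => []) k l) none (Function.update (fun _ => []) k l') T) :
    Nonempty (TM2OutputsInTime (c.machine k) l (some l') T) := by
  obtain ⟨t, ht, e⟩ := h
  have hst : ∀ l : List Γ, Function.update (fun _ : K => []) k l =
      fun k' => if h : k' = k then l else [] := by
    intro l
    funext k'
    by_cases h : k' = k
    · subst h; simp
    · simp [h]
  refine ⟨⟨⟨t, ?_⟩, ht⟩⟩
  have := e.steps (c.code id .halt) id .halt fun _ => rfl
  rw [hst, hst] at this
  exact this

end Cmd


open Turing Computability

/-! ### A stack program that appends facts about fresh constants -/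

/-- The stacks: input and output, the reversed facts, the current fresh constant, a buffer, the
number of facts, the number of fresh constants still to be written, and an auxiliary counter. -/
inductive Stk
  | io
  | rev
  | len
  | tmp
  | num
  | cnt
  | aux
  deriving DecidableEq

instance : Fintype Stk :=
  ⟨{.io, .rev, .len, .tmp, .num, .cnt, .aux}, fun k => by cases k <;> decide⟩

/-- The stack contents with the given components. -/
def Stk.mk (a b c d e f g : List Γ') : Stk → List Γ'
  | io => a
  | rev => b
  | len => c
  | tmp => d
  | num => e
  | cnt => f
  | aux => g

namespace Stk

variable {a b c d e f g x : List Γ'}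

theorem update_io : Function.update (mk a b c d e f g) io x = mk x b c d e f g := by
  funext k; cases k <;> rfl

theorem update_rev : Function.update (mk a b c d e f g) rev x = mk a x c d e f g := by
  funext k; cases k <;> rfl

theorem update_len : Function.update (mk a b c d e f g) len x = mk a b x d e f g := by
  funext k; cases k <;> rfl

theorem update_tmp : Function.update (mk a b c d e f g) tmp x = mk a b c x e f g := by
  funext k; cases k <;> rfl

theorem update_num : Function.update (mk a b c d e f g) num x = mk a b c d x f g := by
  funext k; cases k <;> rfl

theorem update_cnt : Function.update (mk a b c d e f g) cnt x = mk a b c d e x g := by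
  funext k; cases k <;> rfl

theorem update_aux : Function.update (mk a b c d e f g) aux x = mk a b c d e f x := by
  funext k; cases k <;> rfl

end Stk

/-- Unary numbers. -/
abbrev ones (n : ℕ) : List Γ' := List.replicate n (Γ'.bit true)

theorem ones_add (m n : ℕ) : ones (m + n) = ones m ++ ones n :=
  List.replicate_add _ _ _

theorem ones_sub_eq_cons {n i : ℕ} (hi : i < n) {a : Γ'} {l : List Γ'}
    (h : ones (n - i) = a :: l) : l = ones (n - (i + 1)) := by
  obtain ⟨k, hk⟩ : ∃ k, n - i = k + 1 := ⟨n - i - 1, by omega⟩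
  rw [hk] at h
  have : n - (i + 1) = k := by omega
  rw [this]
  exact (List.cons.inj h).2.symm

namespace FreshFacts

open Cmd

/-- Push a unary digit. -/
def inc (k : Stk) : Cmd Stk Γ' := push k fun _ => Γ'.bit true

/-- Reverse the facts, computing their number and the length of their encoding. -/
def readFacts : Cmd Stk Γ' :=
  loop .io (fun a => a != Γ'.blank)
    (seq (push .rev fun v => v.getD Γ'.blank) (seq (inc .len)
      (ifReg (fun v => v == some Γ'.ket) (inc .num))))

/-- The loop ends by popping the blank between facts and tuple, so the tuple stays on `io` while the
blank has to be restored later. Each fact contains exactly one `ket`, so counting these symbols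
counts facts. Inside the loop the register is never empty, and the default in `getD` plays no role.
-/
theorem runs_readFacts {w r : List Γ'} (hw : Γ'.blank ∉ w) (v : Option Γ') :
    Runs readFacts v (Stk.mk (w ++ Γ'.blank :: r) [] [] [] [] [] []) (some Γ'.blank)
      (Stk.mk r w.reverse (ones w.length) [] (ones (w.count Γ'.ket)) [] []) (w.length * 5 + 1) := by
  have h := Runs.loop (k := .io) (p := fun a => a != Γ'.blank)
    (c := seq (push .rev fun v => v.getD Γ'.blank) (seq (inc .len)
      (ifReg (fun v => v == some Γ'.ket) (inc .num)))) (T := 4) (n := w.length)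
    (fun i => Stk.mk (w.drop i ++ Γ'.blank :: r) (w.take i).reverse (ones i) []
      (ones ((w.take i).count Γ'.ket)) [] []) (fun i hi => ?_) ?_ v
  · simpa [readFacts, Stk.update_io, Stk.mk] using h
  · have hne : w[i] ≠ Γ'.blank := fun e => hw (e ▸ List.getElem_mem hi)
    have hd : w.drop i = w[i] :: w.drop (i + 1) := List.drop_eq_getElem_cons hi
    have ht : w.take (i + 1) = w.take i ++ [w[i]] := List.take_succ_eq_append_getElem hi
    simp only [hd, Stk.mk, List.cons_append, List.head?_cons, List.tail_cons, Option.any_some]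
    refine ⟨by simpa using hne, some w[i], ?_⟩
    refine ((Runs.push (S' := Stk.mk (w.drop (i + 1) ++ Γ'.blank :: r) (w.take (i + 1)).reverse
      (ones i) [] (ones ((w.take i).count Γ'.ket)) [] []) ?_).seq ((Runs.push
      (S' := Stk.mk (w.drop (i + 1) ++ Γ'.blank :: r) (w.take (i + 1)).reverse
      (ones (i + 1)) [] (ones ((w.take i).count Γ'.ket)) [] []) ?_).seq (T₂ := 2) ?_))
    · change Function.update (Function.update (Stk.mk _ _ _ _ _ _ _) _ _) _ _ = _
      rw [Stk.update_io, Stk.update_rev, ht, List.reverse_append]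
      rfl
    · rw [Stk.update_len]
      rfl
    · by_cases hk : w[i] = Γ'.ket
      · refine Runs.ifTrue (by simp [hk]) (Runs.push ?_)
        rw [Stk.update_num, ht, List.count_append, hk]
        rfl
      · have hc : (w.take (i + 1)).count Γ'.ket = (w.take i).count Γ'.ket := by
          rw [ht, List.count_append, List.count_singleton]
          simp [hk]
        rw [hc]
        exact (Runs.ifFalse (by simp [hk])).mono (by omega)
  · simp [Stk.mk]

/-- Multiply the counter by the number on `num`. -/
def mul : Cmd Stk Γ' :=
  seq (loop .cnt (fun _ => true) (inc .aux))
    (loop .aux (fun _ => true) (seq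
      (loop .num (fun _ => true) (seq (inc .cnt) (inc .tmp)))
      (loop .tmp (fun _ => true) (inc .num))))

/-- The old counter moves to `aux`; for each of its digits the number on `num` is added to `cnt`,
with a copy kept on `tmp` from which `num` is restored. -/
theorem runs_mul {a b l : List Γ'} {m c : ℕ} (v : Option Γ') :
    Runs mul v (Stk.mk a b l [] (ones m) (ones c) []) none
      (Stk.mk a b l [] (ones m) (ones (c * m)) []) (c * (5 * m + 5) + 2) := by
  have h1 := Runs.loop_all (k := .cnt) (c := inc .aux) (T := 1) (n := c)
    (fun i => Stk.mk a b l [] (ones m) (ones (c - i)) (ones i)) (fun i _ => by simp [Stk.mk])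
    (fun i hi s t e => ⟨some s, Runs.push (by
      rw [ones_sub_eq_cons hi e, Stk.update_cnt, Stk.update_aux]; rfl)⟩) v
  have h2 : ∀ (c' i : ℕ) (v : Option Γ'),
      Runs (loop .num (fun _ => true) (seq (inc .cnt) (inc .tmp))) v
      (Stk.mk a b l [] (ones m) (ones c') (ones i)) none
      (Stk.mk a b l (ones m) [] (ones (c' + m)) (ones i)) (m * 3 + 1) := by
    intro c' i v
    have := Runs.loop_all (k := .num) (c := seq (inc .cnt) (inc .tmp)) (T := 2) (n := m)
      (fun j => Stk.mk a b l (ones j) (ones (m - j)) (ones (c' + j)) (ones i))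
      (fun i _ => by simp [Stk.mk])
      (fun j hj s t e => by
        obtain rfl := ones_sub_eq_cons hj e
        refine ⟨some s, (Runs.push (S' := Stk.mk a b l (ones j) (ones (m - (j + 1)))
          (ones (c' + (j + 1))) (ones i)) ?_).seq (Runs.push ?_)⟩
        · exact (congrArg (fun S => Function.update S _ _) Stk.update_num).trans Stk.update_cnt
        · exact Stk.update_tmp) v
    simpa using this
  have h3 : ∀ (c' i : ℕ) (v : Option Γ'),
      Runs (loop .tmp (fun _ => true) (inc .num)) v
      (Stk.mk a b l (ones m) [] (ones c') (ones i)) none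
      (Stk.mk a b l [] (ones m) (ones c') (ones i)) (m * 2 + 1) := by
    intro c' i v
    have := Runs.loop_all (k := .tmp) (c := inc .num) (T := 1) (n := m)
      (fun j => Stk.mk a b l (ones (m - j)) (ones j) (ones c') (ones i))
      (fun i _ => by simp [Stk.mk])
      (fun j hj s t e => ⟨some s, Runs.push (by
        rw [ones_sub_eq_cons hj e, Stk.update_tmp, Stk.update_num]; rfl)⟩) v
    simpa using this
  have h4 := Runs.loop_all (k := .aux) (n := c) (T := m * 3 + 1 + (m * 2 + 1))
    (c := seq (loop .num (fun _ => true) (seq (inc .cnt) (inc .tmp)))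
      (loop .tmp (fun _ => true) (inc .num)))
    (fun i => Stk.mk a b l [] (ones m) (ones (i * m)) (ones (c - i)))
    (fun i _ => by simp [Stk.mk])
    (fun i hi s t e => ⟨none, by
      rw [ones_sub_eq_cons hi e, Stk.update_aux, Nat.succ_mul]
      exact (h2 _ _ _).seq (h3 _ _ _)⟩) none
  simp only [Nat.sub_zero, Nat.sub_self, Nat.zero_mul] at h1 h4
  refine (h1.seq h4).mono ?_
  ring_nf
  omega

/-- Multiply the counter by the `d`-th power of the number on `num`. -/
def power : ℕ → Cmd Stk Γ'
  | 0 => skip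
  | d + 1 => seq (power d) mul

/-- Positivity of `m` makes the powers increasing, so each multiplication costs no more than the
last one. The final register depends on whether `d` is zero and is therefore left open. -/
theorem runs_power {a b l : List Γ'} {m d : ℕ} (hm : 0 < m) (v : Option Γ') : ∃ v',
    Runs (power d) v (Stk.mk a b l [] (ones m) (ones 1) []) v'
      (Stk.mk a b l [] (ones m) (ones (m ^ d)) []) (d * (m ^ d * (5 * m + 5) + 2) + 1) := by
  induction d with
  | zero => exact ⟨v, by simpa [power] using Runs.skip⟩
  | succ d ih =>
    obtain ⟨v', h⟩ := ih
    refine ⟨none, ?_⟩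
    rw [pow_succ]
    refine (h.seq (runs_mul v')).mono ?_
    have h1 : m ^ d ≤ m ^ d * m := Nat.le_mul_of_pos_right _ hm
    have h2 : m ^ d * (5 * m + 5) ≤ m ^ d * m * (5 * m + 5) := Nat.mul_le_mul_right _ h1
    have h3 : d * (m ^ d * (5 * m + 5) + 2) ≤ d * (m ^ d * m * (5 * m + 5) + 2) := by gcongr
    rw [Nat.succ_mul d]
    omega

/-- Write one fact, whose encoding starts with `nm`, and increment the fresh constant. -/
def emit (nm : List Γ') : Cmd Stk Γ' :=
  seq (pushList .io [Γ'.comma, Γ'.ket])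
    (seq (loop .len (fun _ => true) (seq (inc .tmp) (inc .io)))
      (seq (loop .tmp (fun _ => true) (inc .len))
        (seq (inc .len) (pushList .io nm))))

/-- A stack is written from right to left: first the closing symbols, then the digits, then `nm`.
The length `j` is copied from `len` through `tmp` and restored with one more digit, so the next
constant is different. -/
theorem runs_emit {nm a b : List Γ'} {j m c : ℕ} (v : Option Γ') :
    Runs (emit nm) v (Stk.mk a b (ones j) [] (ones m) (ones c) []) none
      (Stk.mk (nm ++ (ones j ++ [Γ'.comma, Γ'.ket]) ++ a) b (ones (j + 1)) [] (ones m) (ones c) [])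
      (5 * j + nm.length + 7) := by
  have h1 : Runs (pushList .io [Γ'.comma, Γ'.ket]) v
      (Stk.mk a b (ones j) [] (ones m) (ones c) []) v
      (Stk.mk (ones 0 ++ ([Γ'.comma, Γ'.ket] ++ a)) b (ones j) (ones 0) (ones m) (ones c) []) 3 :=
    Runs.pushList Stk.update_io
  have h2 := Runs.loop_all (k := .len) (c := seq (inc .tmp) (inc .io)) (T := 2) (n := j)
    (fun i => Stk.mk (ones i ++ ([Γ'.comma, Γ'.ket] ++ a)) b (ones (j - i)) (ones i)
      (ones m) (ones c) []) (fun i _ => by simp [Stk.mk])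
    (fun i hi s t e => by
      obtain rfl := ones_sub_eq_cons hi e
      refine ⟨some s, (Runs.push (S' := Stk.mk (ones i ++ ([Γ'.comma, Γ'.ket] ++ a)) b
        (ones (j - (i + 1))) (ones (i + 1)) (ones m) (ones c) []) ?_).seq (Runs.push ?_)⟩
      · exact (congrArg (fun S => Function.update S _ _) Stk.update_len).trans Stk.update_tmp
      · exact Stk.update_io) v
  have h3 := Runs.loop_all (k := .tmp) (c := inc .len) (T := 1) (n := j)
    (fun i => Stk.mk (ones j ++ ([Γ'.comma, Γ'.ket] ++ a)) b (ones i) (ones (j - i))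
      (ones m) (ones c) []) (fun i _ => by simp [Stk.mk])
    (fun i hi s t e => ⟨some s, Runs.push (by
      rw [ones_sub_eq_cons hi e, Stk.update_tmp, Stk.update_len]; rfl)⟩) none
  have h4 : Runs (inc .len) none
      (Stk.mk (ones j ++ ([Γ'.comma, Γ'.ket] ++ a)) b (ones j) [] (ones m) (ones c) []) none
      (Stk.mk (ones j ++ ([Γ'.comma, Γ'.ket] ++ a)) b (ones (j + 1)) [] (ones m) (ones c) []) 1 :=
    Runs.push Stk.update_len
  have h5 : Runs (pushList .io nm) none
      (Stk.mk (ones j ++ ([Γ'.comma, Γ'.ket] ++ a)) b (ones (j + 1)) [] (ones m) (ones c) []) none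
      (Stk.mk (nm ++ (ones j ++ [Γ'.comma, Γ'.ket]) ++ a) b (ones (j + 1)) [] (ones m) (ones c) [])
      (nm.length + 1) :=
    Runs.pushList (by rw [Stk.update_io]; simp [Stk.mk])
  simp only [Nat.sub_zero, Nat.sub_self] at h2 h3
  refine (h1.seq (h2.seq (h3.seq (h4.seq h5)))).mono ?_
  omega

/-- The facts about `N` fresh constants of lengths at least `j`, the last one first. -/
def factsFrom (nm : List Γ') (j N : ℕ) : List Γ' :=
  (List.range N).reverse.flatMap fun i => nm ++ (ones (j + i) ++ [Γ'.comma, Γ'.ket])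

theorem runs_emits {nm a b : List Γ'} {j m N : ℕ} (v : Option Γ') :
    Runs (loop .cnt (fun _ => true) (emit nm)) v
      (Stk.mk a b (ones j) [] (ones m) (ones N) []) none
      (Stk.mk (factsFrom nm j N ++ a) b (ones (j + N)) [] (ones m) [] [])
      (N * (5 * (j + N) + nm.length + 8) + 1) := by
  have h := Runs.loop_all (k := .cnt) (c := emit nm) (T := 5 * (j + N) + nm.length + 7) (n := N)
    (fun i => Stk.mk (factsFrom nm j i ++ a) b (ones (j + i)) [] (ones m) (ones (N - i)) [])
    (fun i _ => by simp [Stk.mk])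
    (fun i hi s t e => ⟨none, by
      rw [ones_sub_eq_cons hi e, Stk.update_cnt]
      have := (runs_emit (nm := nm) (a := factsFrom nm j i ++ a) (b := b) (j := j + i) (m := m)
        (c := N - (i + 1)) (some s)).mono (T' := 5 * (j + N) + nm.length + 7) (by omega)
      have e2 : factsFrom nm j (i + 1) ++ a =
          nm ++ (ones (j + i) ++ [Γ'.comma, Γ'.ket]) ++ (factsFrom nm j i ++ a) := by
        simp [factsFrom, List.range_succ]
      change Runs _ _ _ _ (Stk.mk (factsFrom nm j (i + 1) ++ a) b (ones (j + i + 1)) [] (ones m)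
        (ones (N - (i + 1))) []) _
      rw [e2]
      exact this⟩) v
  simpa [factsFrom] using h

/-- The whole program. -/
def program (nm fixed : List Γ') (k d : ℕ) : Cmd Stk Γ' :=
  seq readFacts (seq (pushList .io [Γ'.blank]) (seq (pushList .len (ones k))
    (seq (pushList .num (ones 2)) (seq (pushList .cnt (ones 1)) (seq (power d)
    (seq (loop .cnt (fun _ => true) (emit nm)) (seq (pushList .io fixed)
    (seq (loop .rev (fun _ => true) (push .io fun v => v.getD Γ'.blank))
    (seq (loop .len (fun _ => true) skip) (loop .num (fun _ => true) skip))))))))))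

theorem runs_restore {w a l n : List Γ'} (v : Option Γ') :
    Runs (loop .rev (fun _ => true) (push .io fun v => v.getD Γ'.blank)) v
      (Stk.mk a w.reverse l [] n [] []) none (Stk.mk (w ++ a) [] l [] n [] [])
      (w.length * 2 + 1) := by
  have h := Runs.loop_all (k := .rev) (c := push .io fun v => v.getD Γ'.blank) (T := 1)
    (n := w.length)
    (fun i => Stk.mk (w.drop (w.length - i) ++ a) (w.take (w.length - i)).reverse l [] n [] [])
    (fun i _ => by simp [Stk.mk])
    (fun i hi s t e => ⟨some s, Runs.push (by
      have hj : w.length - (i + 1) < w.length := by omega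
      have hji : w.length - i = w.length - (i + 1) + 1 := by omega
      set j := w.length - (i + 1)
      change (w.take (w.length - i)).reverse = _ at e
      rw [hji, List.take_succ_eq_append_getElem hj, List.reverse_append] at e
      have e' := List.cons.inj e
      rw [← e'.1, ← e'.2, hji, Stk.update_rev, Stk.update_io, List.drop_eq_getElem_cons hj]
      rfl)⟩) v
  simpa using h

/-- Clears the counters left over at the end, as halting requires. -/
theorem runs_clear {k : Stk} {S S' : Stk → List Γ'} {n : ℕ}
    (h : S k = ones n) (h' : Function.update S k [] = S') (v : Option Γ') :
    Runs (loop k (fun _ => true) skip) v S none S' (n * 2 + 1) := by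
  have := Runs.loop_all (k := k) (c := skip) (T := 1) (n := n)
    (fun i => Function.update S k (ones (n - i))) (fun i _ => by simp)
    (fun i hi s t e => ⟨some s, by
      rw [Function.update_self] at e
      rw [ones_sub_eq_cons hi e, Function.update_idem]
      exact Runs.skip⟩) v
  simp only [Nat.sub_zero, Nat.sub_self, ← h, Function.update_eq_self] at this
  rw [← h']
  exact this

/-- A bound on the running time in terms of the length of the encoded facts and their number. -/
def time (nm fixed k d l n : ℕ) : ℕ :=
  (l * 5 + 1) + 2 + (k + 1) + 3 + 2 + (d * ((n + 2) ^ d * (5 * (n + 2) + 5) + 2) + 1) +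
    ((n + 2) ^ d * (5 * (k + l + (n + 2) ^ d) + nm + 8) + 1) + (fixed + 1) + (l * 2 + 1) +
    ((k + l + (n + 2) ^ d) * 2 + 1) + ((n + 2) * 2 + 1)

/-- The new word is built from its end: the blank in front of the tuple, the facts on fresh
constants, the fixed facts, and last the original facts, which come off `rev` in their original
order. The counter `len` starts at `k` plus the length of the encoded facts, which guarantees
freshness. -/
theorem runs_program {nm fixed w r : List Γ'} {k d : ℕ} (hw : Γ'.blank ∉ w) :
    Runs (program nm fixed k d) none (Stk.mk (w ++ Γ'.blank :: r) [] [] [] [] [] []) none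
      (Stk.mk (w ++ (fixed ++ (factsFrom nm (k + w.length) ((w.count Γ'.ket + 2) ^ d) ++
        Γ'.blank :: r))) [] [] [] [] [] [])
      (time nm.length fixed.length k d w.length (w.count Γ'.ket)) := by
  set n := w.count Γ'.ket
  have h1 := runs_readFacts (r := r) hw none
  have h2 : Runs (pushList .io [Γ'.blank]) (some Γ'.blank)
      (Stk.mk r w.reverse (ones w.length) [] (ones n) [] []) (some Γ'.blank)
      (Stk.mk (Γ'.blank :: r) w.reverse (ones w.length) [] (ones n) [] []) 2 :=
    Runs.pushList Stk.update_io
  have h3 : Runs (pushList .len (ones k)) (some Γ'.blank)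
      (Stk.mk (Γ'.blank :: r) w.reverse (ones w.length) [] (ones n) [] []) (some Γ'.blank)
      (Stk.mk (Γ'.blank :: r) w.reverse (ones (k + w.length)) [] (ones n) [] [])
      ((ones k).length + 1) :=
    Runs.pushList (by rw [Stk.update_len, ones_add]; rfl)
  have h4 : Runs (pushList .num (ones 2)) (some Γ'.blank)
      (Stk.mk (Γ'.blank :: r) w.reverse (ones (k + w.length)) [] (ones n) [] []) (some Γ'.blank)
      (Stk.mk (Γ'.blank :: r) w.reverse (ones (k + w.length)) [] (ones (n + 2)) [] []) 3 :=
    Runs.pushList Stk.update_num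
  have h5 : Runs (pushList .cnt (ones 1)) (some Γ'.blank)
      (Stk.mk (Γ'.blank :: r) w.reverse (ones (k + w.length)) [] (ones (n + 2)) [] [])
      (some Γ'.blank)
      (Stk.mk (Γ'.blank :: r) w.reverse (ones (k + w.length)) [] (ones (n + 2)) (ones 1) []) 2 :=
    Runs.pushList Stk.update_cnt
  obtain ⟨v, h6⟩ := runs_power (a := Γ'.blank :: r) (b := w.reverse) (l := ones (k + w.length))
    (m := n + 2) (d := d) (by omega) (some Γ'.blank)
  have h7 := runs_emits (nm := nm) (a := Γ'.blank :: r) (b := w.reverse) (j := k + w.length)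
    (m := n + 2) (N := (n + 2) ^ d) v
  set a := factsFrom nm (k + w.length) ((n + 2) ^ d) ++ Γ'.blank :: r
  set l := ones (k + w.length + (n + 2) ^ d)
  have h8 : Runs (pushList .io fixed) none (Stk.mk a w.reverse l [] (ones (n + 2)) [] []) none
      (Stk.mk (fixed ++ a) w.reverse l [] (ones (n + 2)) [] []) (fixed.length + 1) :=
    Runs.pushList Stk.update_io
  have h9 := runs_restore (w := w) (a := fixed ++ a) (l := l) (n := ones (n + 2)) none
  have h10 := runs_clear (k := .len) 
    (S := Stk.mk (w ++ (fixed ++ a)) [] l [] (ones (n + 2)) [] []) rfl Stk.update_len none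
  have h11 := runs_clear (k := .num) 
    (S := Stk.mk (w ++ (fixed ++ a)) [] [] [] (ones (n + 2)) [] []) rfl Stk.update_num none
  refine (h1.seq (h2.seq (h3.seq (h4.seq (h5.seq (h6.seq (h7.seq (h8.seq (h9.seq
    (h10.seq h11)))))))))).mono ?_
  simp only [time, List.length_replicate]
  omega

end FreshFacts

/-! ### The reduction at the level of listings -/

/-- The unary fact over the relation with the given name. -/
def unaryFact (nm : List Bool) (c : Const) : Atom Rel Const := ⟨⟨nm, 1⟩, fun _ => c⟩

theorem unaryFact_injective (nm : List Bool) : Function.Injective (unaryFact nm) := by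
  intro c c' h
  have : ∀ i : Fin 1, c = c' := fun i => by
    have h2 := eq_of_heq (Atom.mk.inj h).2
    exact congrFun h2 i
  exact this 0

/-- The constants `1…1` of lengths `j, …, j + N - 1`. -/
def freshFrom (j N : ℕ) : List Const :=
  (List.range N).reverse.map fun i => List.replicate (j + i) true

theorem length_of_mem_freshFrom {j N : ℕ} {c : Const} (hc : c ∈ freshFrom j N) :
    j ≤ c.length := by
  obtain ⟨i, -, rfl⟩ := List.mem_map.1 hc
  simp

theorem freshFrom_nodup (j N : ℕ) : (freshFrom j N).Nodup := by
  refine List.Nodup.map (fun a b h => ?_) (List.nodup_reverse.2 List.nodup_range)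
  have := congrArg List.length h
  simpa using this

theorem length_freshFrom (j N : ℕ) : (freshFrom j N).length = N := by simp [freshFrom]

/-- The total length of the encodings of the facts. -/
def encodedSize (I : Database) : ℕ := ∑ a ∈ I, (encodeFact a).length

/-- The fresh constants for a database `I`, exceeding in length `k` and the encoding of `I`. -/
def freshConsts (k d : ℕ) (I : Database) : List Const :=
  freshFrom (k + encodedSize I) ((I.card + 2) ^ d)

theorem encodeFact_unaryFact (nm : List Bool) (c : Const) :
    encodeFact (unaryFact nm c) = (nm.map Γ'.bit ++ [Γ'.bra]) ++ (c.map Γ'.bit ++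
      [Γ'.comma, Γ'.ket]) := by
  simp [encodeFact, encodeConst, unaryFact]

theorem flatMap_encode_freshFrom (nm : List Bool) (j N : ℕ) :
    ((freshFrom j N).map (unaryFact nm)).flatMap encodeFact =
      FreshFacts.factsFrom (nm.map Γ'.bit ++ [Γ'.bra]) j N := by
  rw [freshFrom, FreshFacts.factsFrom, List.flatMap_map, List.flatMap_map]
  congr 1
  funext i
  rw [encodeFact_unaryFact, List.map_replicate]

theorem blank_notMem_encodeConst (c : Const) : Γ'.blank ∉ encodeConst c := by simp [encodeConst]

theorem ket_notMem_encodeConst (c : Const) : Γ'.ket ∉ encodeConst c := by simp [encodeConst]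

theorem blank_notMem_encodeFact (a : Atom Rel Const) : Γ'.blank ∉ encodeFact a := by
  simp [encodeFact, blank_notMem_encodeConst]

theorem count_ket_encodeFact (a : Atom Rel Const) : (encodeFact a).count Γ'.ket = 1 := by
  have h1 : (a.rel.name.map Γ'.bit).count Γ'.ket = 0 := List.count_eq_zero.2 (by simp)
  have h2 : ((List.ofFn a.args).flatMap encodeConst).count Γ'.ket = 0 :=
    List.count_eq_zero.2 (by simp [ket_notMem_encodeConst])
  simp only [encodeFact, List.count_append, h1, h2]
  rfl

theorem count_ket_flatMap (l : List (Atom Rel Const)) :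
    (l.flatMap encodeFact).count Γ'.ket = l.length := by
  induction l with
  | nil => rfl
  | cons a l ih => rw [List.flatMap_cons, List.count_append, count_ket_encodeFact, ih,
      List.length_cons, add_comm]

theorem length_flatMap_encodeFact {l : List (Atom Rel Const)} (hl : l.Nodup) :
    (l.flatMap encodeFact).length = encodedSize l.toFinset := by
  rw [encodedSize, List.sum_toFinset _ hl, List.length_flatMap]

/-- Each occurrence of a constant is written out in full, followed by a comma. -/
theorem length_le_encodedSize {I : Database} {c : Const} (hc : c ∈ I.consts) :
    c.length < encodedSize I := by
  obtain ⟨a, ha, i, rfl⟩ := hc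
  have h1 : (encodeFact a).length ≤ encodedSize I :=
    Finset.single_le_sum (f := fun a => (encodeFact a).length) (fun _ _ => Nat.zero_le _) ha
  have h2 : (encodeConst (a.args i)).length ≤ ((List.ofFn a.args).flatMap encodeConst).length := by
    rw [List.length_flatMap]
    exact List.single_le_sum (fun _ _ => Nat.zero_le _) _
      (List.mem_map_of_mem (f := fun c => (encodeConst c).length) (List.mem_ofFn.2 ⟨i, rfl⟩))
  have h3 : (encodeConst (a.args i)).length = (a.args i).length + 1 := by simp [encodeConst]
  have h4 : (encodeFact a).length = a.rel.name.length + 1 +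
    ((List.ofFn a.args).flatMap encodeConst).length + 1 := by simp [encodeFact]; omega
  omega

/-- The database `I` together with facts listing the fixed constants and the fresh ones. -/
def extendDatabase (nm : List Bool) (fixed : List Const) (k d : ℕ) (I : Database) : Database :=
  I ∪ ((fixed ++ freshConsts k d I).map (unaryFact nm)).toFinset

/-- Brings the encoding into the shape that `FreshFacts.runs_program` produces. What the machine
reads off the word, its length and its number of `ket`, equals the encoded size and the number of
facts because the listing has no repetitions. -/
theorem encode_extend {nm : List Bool} {fixed : List Const} {k d : ℕ} {n : ℕ} (x : Listing n)
    (hnd : (x.facts ++ (fixed ++ freshConsts k d x.facts.toFinset).map (unaryFact nm)).Nodup) :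
    Listing.encode ⟨_, hnd, x.tuple⟩ = x.facts.flatMap encodeFact ++
      ((fixed.map (unaryFact nm)).flatMap encodeFact ++
      (FreshFacts.factsFrom (nm.map Γ'.bit ++ [Γ'.bra]) (k + (x.facts.flatMap encodeFact).length)
        (((x.facts.flatMap encodeFact).count Γ'.ket + 2) ^ d) ++
        Γ'.blank :: (List.ofFn x.tuple).flatMap encodeConst)) := by
  rw [count_ket_flatMap, length_flatMap_encodeFact x.nodup, ← flatMap_encode_freshFrom,
    ← List.toFinset_card_of_nodup x.nodup]
  simp [Listing.encode, freshConsts, List.append_assoc]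

theorem polyTimeOn_extendDatabase {nm : List Bool} {fixed : List Const} {k d n : ℕ}
    {D : Database → Prop} (hD : ∀ I, D I → ∀ a ∈ I, a.rel ≠ ⟨nm, 1⟩) (hnd : fixed.Nodup)
    (hk : ∀ c ∈ fixed, c.length < k) :
    PolyTimeOn (n := n) D (fun x => (extendDatabase nm fixed k d x.1, x.2)) := by
  have hnodup : ∀ x : {x : Listing n // D x.toPair.1},
      (x.1.facts ++ (fixed ++ freshConsts k d x.1.facts.toFinset).map (unaryFact nm)).Nodup := by
    intro x
    -- Fixed constants are shorter than `k` and fresh ones are not, so the two lists are disjoint;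
    -- by `hD` none of the added facts is already present.
    refine x.1.nodup.append (List.Nodup.map (unaryFact_injective nm)
      (hnd.append (freshFrom_nodup _ _) fun c h1 h2 => ?_)) fun a h1 h2 => ?_
    · have h3 := length_of_mem_freshFrom h2
      have h4 := hk c h1
      omega
    · obtain ⟨c, -, rfl⟩ := List.mem_map.1 h2
      exact hD _ x.2 _ (List.mem_toFinset.2 h1) rfl
  refine ⟨fun x => ⟨_, hnodup x, x.1.tuple⟩, ?_, fun x => ?_⟩
  · set fx := (fixed.map (unaryFact nm)).flatMap encodeFact
    set nm' := nm.map Γ'.bit ++ [Γ'.bra]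
    -- The polynomial is the running time with both parameters replaced by the input length, which
    -- bounds the length of the facts and also their number.
    open Polynomial in
    let p : Polynomial ℕ :=
      (X * 5 + 1) + 2 + (C k + 1) + 3 + 2 + (C d * ((X + 2) ^ d * (5 * (X + 2) + 5) + 2) + 1) +
      ((X + 2) ^ d * (5 * (C k + X + (X + 2) ^ d) + C nm'.length + 8) + 1) + (C fx.length + 1) +
      (X * 2 + 1) + ((C k + X + (X + 2) ^ d) * 2 + 1) + ((X + 2) * 2 + 1)
    have hp : ∀ l, p.eval l = FreshFacts.time nm'.length fx.length k d l l := by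
      intro l
      simp [p, FreshFacts.time]
    have hmono : ∀ l n m, l ≤ m → n ≤ m → FreshFacts.time nm'.length fx.length k d l n ≤
        FreshFacts.time nm'.length fx.length k d m m := by
      intro l n m h1 h2
      unfold FreshFacts.time
      gcongr
    -- The words are kept as variables because the machine receives them through alphabet
    -- equivalences, which are identities here only up to `List.map_id`.
    have hrun : ∀ (x : {x : Listing n // D x.toPair.1}) (l l' : List Γ'), l = x.1.encode →
        l' = Listing.encode ⟨_, hnodup x, x.1.tuple⟩ →
        Nonempty (TM2OutputsInTime ((FreshFacts.program nm' fx k d).machine .io) l (some l')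
          (p.eval x.1.encode.length)) := by
      rintro x _ _ rfl rfl
      refine Cmd.Runs.outputs (Γ := Γ') ?_
      have hst : ∀ l : List Γ', Function.update (fun _ : Stk => ([] : List Γ')) .io l =
          Stk.mk l [] [] [] [] [] [] := by
        intro l
        funext k
        cases k <;> rfl
      set w := x.1.facts.flatMap encodeFact with hw
      have hxe : x.1.encode = w ++ Γ'.blank :: (List.ofFn x.1.tuple).flatMap encodeConst := by
        simp [Listing.encode, hw]
      rw [hst, hst, encode_extend, hp, hxe]
      refine (FreshFacts.runs_program ?_).mono (hmono _ _ _ ?_ ?_)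
      · simp [hw, blank_notMem_encodeFact]
      · simp
      · exact List.count_le_length.trans (by simp)
    exact ⟨⟨⟨(FreshFacts.program nm' fx k d).machine .io, Equiv.refl Γ', Equiv.refl Γ'⟩, p,
      fun x => (hrun x _ _ (List.map_id _) (List.map_id _)).some⟩⟩
  · simp [Listing.toPair, extendDatabase]


/-! ### Stable models without grounding -/

section

variable {R : Type} [Vocabulary R]

/-- The ground version of `r` via `h` holds in `N`, negated literals being evaluated in `M`. -/
def Rule.HoldsAt (M N : Finset (Atom R Val)) (h : Var → Const) (r : Rule R Term) : Prop :=
  (∀ L ∈ r.pos, (L.map (Term.ground h)).Sat N) → (∀ L ∈ r.neg, ¬ (L.map (Term.ground h)).Sat M) →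
    ∃ H, r.head = some H ∧ (H.map (Term.ground h)).Sat N

/-- `N` is closed under the rules, negated literals being evaluated in `M`. -/
def ClosedUnder (G : Set (Rule R Term)) (M N : Finset (Atom R Val)) : Prop :=
  ∀ r ∈ G, ∀ h, r.HoldsAt M N h

/-- Every variable of the rule occurs in a positive body atom. -/
def Rule.AtomSafe (r : Rule R Term) : Prop :=
  ∀ v, r.Has (.var v) → ∃ a, Lit.atom a ∈ r.pos ∧ a.HasVar v

/-- All terms in the facts of `M` are constants in `U`. -/
def ConstsIn (U : Set Const) (M : Finset (Atom R Val)) : Prop :=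
  ∀ f ∈ M, ∀ i, ∃ c ∈ U, f.args i = .const c

theorem ConstsIn.mono {U : Set Const} {M N : Finset (Atom R Val)} (h : ConstsIn U N) (hM : M ⊆ N) :
    ConstsIn U M := fun f hf => h f (hM hf)

theorem Lit.Sat.mono {M N : Finset (Atom R Val)} (hM : M ⊆ N) {L : Lit R Const} (h : L.Sat M) :
    L.Sat N := by
  cases L with
  | atom a => exact hM h
  | eq c d => exact h

theorem Lit.Has.exists_of_map {τ σ : Type} {f : τ → σ} {L : Lit R τ} {s : σ}
    (h : (L.map f).Has s) : ∃ t, L.Has t ∧ f t = s := by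
  cases L with
  | atom a =>
    obtain ⟨i, rfl⟩ := h
    exact ⟨_, ⟨i, rfl⟩, rfl⟩
  | eq t u => rcases h with rfl | rfl; exacts [⟨t, Or.inl rfl, rfl⟩, ⟨u, Or.inr rfl, rfl⟩]

theorem Rule.Has.exists_of_map {τ σ : Type} {f : τ → σ} {r : Rule R τ} {s : σ}
    (h : (r.map f).Has s) : ∃ t, r.Has t ∧ f t = s := by
  obtain ⟨L, hL, hs⟩ := h
  have : ∃ L', r.HasLit L' ∧ L'.map f = L := by
    rcases hL with h | h | h
    · obtain ⟨L', h1, h2⟩ := Option.map_eq_some_iff.1 h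
      exact ⟨L', Or.inl h1, h2⟩
    · obtain ⟨L', h1, h2⟩ := List.mem_map.1 h
      exact ⟨L', Or.inr (Or.inl h1), h2⟩
    · obtain ⟨L', h1, h2⟩ := List.mem_map.1 h
      exact ⟨L', Or.inr (Or.inr h1), h2⟩
  obtain ⟨L', h1, rfl⟩ := this
  obtain ⟨t, h2, h3⟩ := hs.exists_of_map
  exact ⟨t, ⟨L', h1, h2⟩, h3⟩

theorem mem_herbrandUniverse_of_reduct {G : Set (Rule R Term)} {M : Finset (Atom R Val)}
    {g : Rule R Const} (hg : g ∈ reduct (grounding G) M) {c : Const} (hc : g.Has c) :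
    c ∈ herbrandUniverse G := by
  obtain ⟨g', ⟨r, hr, h, hh, rfl⟩, -, rfl⟩ := hg
  have : (r.map (Term.ground h)).Has c := by
    obtain ⟨L, hL, hc⟩ := hc
    refine ⟨L, ?_, hc⟩
    rcases hL with h | h | h
    · exact Or.inl h
    · exact Or.inr (Or.inl h)
    · simp at h
  obtain ⟨t, ht, rfl⟩ := this.exists_of_map
  cases t with
  | const c => exact ⟨r, hr, ht⟩
  | var v => exact hh v ht

/-- Grounding restricts valuations to the Herbrand universe. This is no restriction here: when the
positive body holds in `N`, each variable takes the value of an argument of a fact of `N`, because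
it occurs in a positive atom. -/
theorem forall_reduct_sat_iff {G : Set (Rule R Term)} (hG : ∀ r ∈ G, r.AtomSafe)
    {M N : Finset (Atom R Val)} (hN : ConstsIn (herbrandUniverse G) N) :
    (∀ r ∈ reduct (grounding G) M, r.Sat N) ↔ ClosedUnder G M N := by
  constructor
  · intro H r hr h hpos hneg
    have hU : ∀ v, r.Has (.var v) → h v ∈ herbrandUniverse G := by
      intro v hv
      obtain ⟨a, ha, i, hi⟩ := hG r hr v hv
      obtain ⟨c, hc, e⟩ := hN _ (hpos _ ha) i
      have e' : Val.const ((a.args i).ground h) = .const c := e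
      rw [hi] at e'
      have e2 : h v = c := Val.const.inj e'
      rwa [e2]
    have key := H ⟨r.head.map (Lit.map (Term.ground h)), r.pos.map (Lit.map (Term.ground h)), []⟩
      ⟨r.map (Term.ground h), ⟨r, hr, h, hU, rfl⟩, ?_, rfl⟩ ?_ (by simp)
    · obtain ⟨H', h1, h2⟩ := key
      obtain ⟨H₀, h3, rfl⟩ := Option.map_eq_some_iff.1 h1
      exact ⟨H₀, h3, h2⟩
    · intro L hL
      obtain ⟨L', h1, rfl⟩ := List.mem_map.1 hL
      exact hneg L' h1
    · intro L hL
      obtain ⟨L', h1, rfl⟩ := List.mem_map.1 hL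
      exact hpos L' h1
  · rintro H _ ⟨_, ⟨r, hr, h, -, rfl⟩, hneg, rfl⟩ hpos -
    obtain ⟨H', h1, h2⟩ := H r hr h (fun L hL => hpos _ (List.mem_map_of_mem hL))
      (fun L hL => hneg _ (List.mem_map_of_mem hL))
    exact ⟨_, by simp [Rule.map, h1], h2⟩

/-- The Herbrand base can be dropped from the definition, since minimality already discards facts
outside it. -/
theorem isStable_iff {G : Set (Rule R Term)} (hG : ∀ r ∈ G, r.AtomSafe)
    {M : Finset (Atom R Val)} : IsStable G M ↔ ConstsIn (herbrandUniverse G) M ∧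
      ClosedUnder G M M ∧ ∀ M' ⊂ M, ¬ ClosedUnder G M M' := by
  classical
  have hmod : ∀ N, IsModel (reduct (grounding G) M) N → ConstsIn (herbrandUniverse G) N := by
    intro N hN f hf i
    obtain ⟨a, ha, rfl⟩ := hN.1 f hf
    obtain ⟨r, hr, hc⟩ := ha.2 i
    exact ⟨_, mem_herbrandUniverse_of_reduct hr hc, rfl⟩
  constructor
  · rintro ⟨hM, hmin⟩
    have hU := hmod M hM
    refine ⟨hU, (forall_reduct_sat_iff hG hU).1 hM.2, fun M' hss hM' => hmin M' hss
      ⟨fun f hf => hM.1 f (hss.1 hf), (forall_reduct_sat_iff hG (hU.mono hss.1)).2 hM'⟩⟩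
  · rintro ⟨hU, hcl, hmin⟩
    have hsat := (forall_reduct_sat_iff hG hU).2 hcl
    -- Atoms in heads of reduct rules lie in the Herbrand base, so the part of `M` inside the base
    -- is still closed and must be all of `M`.
    set M₀ := M.filter fun f => ∃ a ∈ herbrandBase (reduct (grounding G) M), f = a.map Val.const
    have hsub : M₀ ⊆ M := Finset.filter_subset _ _
    have hM₀ : M₀ = M := by
      by_contra hne
      refine hmin M₀ (Finset.ssubset_iff_subset_ne.2 ⟨hsub, hne⟩)
        ((forall_reduct_sat_iff hG (hU.mono hsub)).1 fun r hr hpos hneg => ?_)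
      have hnil : r.neg = [] := by
        obtain ⟨_, -, -, rfl⟩ := hr
        rfl
      obtain ⟨H, h1, h2⟩ := hsat r hr (fun L hL => (hpos L hL).mono hsub) (by simp [hnil])
      refine ⟨H, h1, ?_⟩
      cases H with
      | eq c d => exact h2
      | atom a =>
        exact Finset.mem_filter.2 ⟨h2, a, ⟨⟨r, hr, _, Or.inl h1, rfl⟩,
          fun i => ⟨r, hr, _, Or.inl h1, i, rfl⟩⟩, rfl⟩
    refine ⟨⟨fun f hf => ?_, hsat⟩, fun M' hss hM' =>
      hmin M' hss ((forall_reduct_sat_iff hG (hmod M' hM')).1 hM'.2)⟩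
    rw [← hM₀] at hf
    exact (Finset.mem_filter.1 hf).2

end


/-! ### The program of a setting -/

/-- The frontier, listed. -/
noncomputable def TGD.frontierList (ρ : TGD) : List Var := ρ.finite_frontier.toFinset.toList

/-- The existential variables, listed. -/
noncomputable def TGD.exvarList (ρ : TGD) : List Var := ρ.finite_exvar.toFinset.toList

theorem TGD.mem_frontierList {ρ : TGD} {v : Var} : v ∈ ρ.frontierList ↔ v ∈ ρ.frontier := by
  simp [frontierList]

theorem TGD.mem_exvarList {ρ : TGD} {v : Var} : v ∈ ρ.exvarList ↔ v ∈ ρ.exvar := by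
  simp [exvarList]

namespace Setting

variable (𝒮 : Setting)

/-- A number exceeding the lengths of all relation names of the setting. -/
def nameBound : ℕ := (∑ R ∈ 𝒮.source ∪ 𝒮.target, R.name.length) + 1

/-- The name of the unary relation that collects the available constants. -/
def domName : List Bool := List.replicate 𝒮.nameBound true

/-- The name of the relation that records the choices made for a TGD. -/
noncomputable def auxName (ρ : TGD) : List Bool :=
  List.replicate (𝒮.nameBound + 1 + 𝒮.tgds.toList.idxOf ρ) true

/-- Auxiliary relations are kept apart from the schemas by length alone: their names have length at
least `nameBound`. -/
theorem name_length_lt {R : Rel} (hR : R ∈ 𝒮.source ∪ 𝒮.target) :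
    R.name.length < 𝒮.nameBound :=
  Nat.lt_succ_of_le (Finset.single_le_sum (f := fun R : Rel => R.name.length)
    (fun _ _ => Nat.zero_le _) hR)

theorem auxName_inj {ρ ρ' : TGD} (hρ : ρ ∈ 𝒮.tgds) (h : 𝒮.auxName ρ = 𝒮.auxName ρ') :
    ρ = ρ' := by
  have h1 := congrArg List.length h
  simp only [auxName, List.length_replicate] at h1
  exact (List.idxOf_inj (Finset.mem_toList.2 hρ)).1 (by omega)

/-- `Dom(t)`. -/
def domAtom (t : Term) : Atom Rel Term := ⟨⟨𝒮.domName, 1⟩, fun _ => t⟩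

/-- `Aux_ρ(x,z)` with the frontier `x` and the existential variables `z`. -/
noncomputable def auxAtom (ρ : TGD) : Atom Rel Term :=
  ⟨⟨𝒮.auxName ρ, (ρ.frontierList ++ ρ.exvarList).length⟩,
    fun i => .var ((ρ.frontierList ++ ρ.exvarList).get i)⟩

/-- The fact `Dom(c)`. -/
def domFact (c : Const) : Atom Rel Val := (unaryFact 𝒮.domName c).map Val.const

theorem auxAtom_hasVar {ρ : TGD} {v : Var} :
    (𝒮.auxAtom ρ).HasVar v ↔ v ∈ ρ.frontier ∨ v ∈ ρ.exvar := by
  rw [← TGD.mem_frontierList, ← TGD.mem_exvarList, ← List.mem_append, List.mem_iff_get]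
  exact exists_congr fun i => ⟨fun h => Term.var.inj h, fun h => congrArg _ h⟩

/-- `Aux_ρ(x,z) :- body, Dom(z₁), …, choice((x),(z)).` -/
noncomputable def choiceRule (ρ : TGD) : ChoiceRule where
  rule := ⟨some (.atom (𝒮.auxAtom ρ)),
    ρ.body.map .atom ++ ρ.exvarList.map (fun z => .atom (𝒮.domAtom (.var z))), []⟩
  X := ρ.frontierList
  Y := ρ.exvarList
  X_nodup := Finset.nodup_toList _
  Y_nodup := Finset.nodup_toList _
  disjoint v h1 h2 := (TGD.mem_exvarList.1 h2).1 (TGD.mem_frontierList.1 h1).1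
  X_body v hv := by
    obtain ⟨⟨a, ha, h⟩, -⟩ := TGD.mem_frontierList.1 hv
    exact ⟨.atom a, Or.inl (List.mem_append_left _ (List.mem_map_of_mem ha)), h⟩
  Y_body v hv := ⟨.atom (𝒮.domAtom (.var v)), Or.inl (List.mem_append_right _
    (List.mem_map_of_mem (f := fun z => Lit.atom (𝒮.domAtom (.var z))) hv)), (0 : Fin 1), rfl⟩

/-- `H :- body, Aux_ρ(x,z).` -/
noncomputable def headRule (ρ : TGD) (a : Atom Rel Term) : Rule Rel Term :=
  ⟨some (.atom a), ρ.body.map .atom ++ [.atom (𝒮.auxAtom ρ)], []⟩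

/-- `x = y :- body.` -/
def _root_.DataExchange.EGD.toRule (η : EGD) : Rule Rel Term :=
  ⟨some (.eq (.var η.x) (.var η.y)), η.body.map .atom, []⟩

/-- `R(x₁,…,xₙ)` with pairwise distinct variables. -/
def _root_.DataExchange.Rel.atom (R : Rel) : Atom Rel Term := ⟨R, fun j => .var j⟩

/-- `Dom(xᵢ) :- R(x₁,…,xₙ).` -/
def domRule (R : Rel) (i : ℕ) : Rule Rel Term :=
  ⟨some (.atom (𝒮.domAtom (.var i))), [.atom R.atom], []⟩

end Setting

theorem Rule.AtomSafe.safe {r : Rule Rel Term} (h : r.AtomSafe) : r.Safe := fun v hv =>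
  let ⟨a, ha, hv⟩ := h v hv
  ⟨.atom a, ha, hv⟩

theorem Rule.AtomSafe.of_head {r : Rule Rel Term} {L : Lit Rel Term} (hh : r.head = some L)
    {l : List (Atom Rel Term)} (hp : r.pos = l.map .atom) (hn : r.neg = [])
    (h : ∀ v, L.Has (.var v) → ∃ a ∈ l, a.HasVar v) : r.AtomSafe := by
  rintro v ⟨L', h1 | h1 | h1, h2⟩
  · rw [hh] at h1
    obtain rfl := Option.some.inj h1
    obtain ⟨a, ha, hv⟩ := h v h2
    exact ⟨a, hp ▸ List.mem_map_of_mem ha, hv⟩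
  · rw [hp] at h1
    obtain ⟨a, ha, rfl⟩ := List.mem_map.1 h1
    exact ⟨a, hp ▸ List.mem_map_of_mem ha, h2⟩
  · rw [hn] at h1
    simp at h1

namespace Setting

variable (𝒮 : Setting)

theorem choiceRule_atomSafe (ρ : TGD) : (𝒮.choiceRule ρ).rule.AtomSafe := by
  refine Rule.AtomSafe.of_head rfl
    (l := ρ.body ++ ρ.exvarList.map fun z => 𝒮.domAtom (.var z)) ?_ rfl fun v hv => ?_
  · simp [choiceRule]
  · rcases 𝒮.auxAtom_hasVar.1 hv with h | h
    · obtain ⟨⟨a, ha, h⟩, -⟩ := h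
      exact ⟨a, List.mem_append_left _ ha, h⟩
    · exact ⟨𝒮.domAtom (.var v), List.mem_append_right _ (List.mem_map_of_mem
        (f := fun z => 𝒮.domAtom (.var z)) (TGD.mem_exvarList.2 h)), (0 : Fin 1), rfl⟩

theorem headRule_atomSafe {ρ : TGD} {a : Atom Rel Term} (ha : a ∈ ρ.head) :
    (𝒮.headRule ρ a).AtomSafe := by
  refine Rule.AtomSafe.of_head rfl (l := ρ.body ++ [𝒮.auxAtom ρ]) ?_ rfl fun v hv => ?_
  · simp [headRule]
  · refine ⟨𝒮.auxAtom ρ, by simp, 𝒮.auxAtom_hasVar.2 ?_⟩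
    by_cases hb : ∃ b ∈ ρ.body, b.HasVar v
    · exact Or.inl ⟨hb, a, ha, hv⟩
    · exact Or.inr ⟨hb, a, ha, hv⟩

theorem _root_.DataExchange.EGD.toRule_atomSafe (η : EGD) : η.toRule.AtomSafe := by
  refine Rule.AtomSafe.of_head rfl rfl rfl fun v hv => ?_
  rcases hv with h | h
  · exact Term.var.inj h ▸ η.x_mem
  · exact Term.var.inj h ▸ η.y_mem

theorem domRule_atomSafe {R : Rel} (i : Fin R.arity) : (𝒮.domRule R i).AtomSafe := by
  refine Rule.AtomSafe.of_head rfl (l := [R.atom]) rfl rfl fun v hv => ?_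
  obtain ⟨_, hv⟩ := hv
  exact ⟨R.atom, by simp, i, hv⟩

/-- The program of a setting: for each TGD, the values of the existential variables are chosen, for
each tuple of values of the frontier, from the constants in `Dom`. -/
noncomputable def program : Program where
  rules := 𝒮.tgds.biUnion (fun ρ => ρ.head.toFinset.image (𝒮.headRule ρ)) ∪
    𝒮.tEGDs.image EGD.toRule ∪
    𝒮.source.biUnion fun R => Finset.univ.image fun i : Fin R.arity => 𝒮.domRule R i
  choiceRules := 𝒮.tgds.image 𝒮.choiceRule
  rules_safe r hr := by
    simp only [Finset.mem_union, Finset.mem_biUnion, Finset.mem_image, List.mem_toFinset,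
      Finset.mem_univ, true_and] at hr
    rcases hr with (⟨ρ, -, a, ha, rfl⟩ | ⟨η, -, rfl⟩) | ⟨R, -, i, rfl⟩
    · exact (𝒮.headRule_atomSafe ha).safe
    · exact η.toRule_atomSafe.safe
    · exact (𝒮.domRule_atomSafe i).safe
  rules_not_fact r hr := by
    simp only [Finset.mem_union, Finset.mem_biUnion, Finset.mem_image, List.mem_toFinset,
      Finset.mem_univ, true_and] at hr
    rintro ⟨-, h, -⟩
    rcases hr with (⟨ρ, -, a, ha, rfl⟩ | ⟨η, -, rfl⟩) | ⟨R, -, i, rfl⟩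
    · simp [headRule] at h
    · obtain ⟨a, ha, -⟩ := η.x_mem
      have : η.body = [] := List.map_eq_nil_iff.1 h
      simp [this] at ha
    · simp [domRule] at h
  choice_safe r hr := by
    obtain ⟨ρ, -, rfl⟩ := Finset.mem_image.1 hr
    exact (𝒮.choiceRule_atomSafe ρ).safe

theorem mem_program_rules {r : Rule Rel Term} : r ∈ 𝒮.program.rules ↔
    (∃ ρ ∈ 𝒮.tgds, ∃ a ∈ ρ.head, r = 𝒮.headRule ρ a) ∨ (∃ η ∈ 𝒮.tEGDs, r = η.toRule) ∨
      ∃ R ∈ 𝒮.source, ∃ i : Fin R.arity, r = 𝒮.domRule R i := by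
  simp only [program, Finset.mem_union, Finset.mem_biUnion, Finset.mem_image, List.mem_toFinset,
    Finset.mem_univ, true_and, or_assoc, eq_comm]

/-! ### Facts over the auxiliary relations -/

/-- The fact `Aux_ρ(x,z)`. -/
noncomputable def auxFact (ρ : TGD) (h : Var → Const) : Atom XRel Val := ((𝒮.auxAtom ρ).inst h).lift

/-- The fact `Range_ρ(z)`. -/
noncomputable def rangeFact (ρ : TGD) (h : Var → Const) : Atom XRel Val :=
  ((𝒮.choiceRule ρ).rangeAtom (𝒮.choiceRule ρ).y).inst h

/-- The fact `Chosen_ρ(x,z)`. -/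
noncomputable def chosenFact (ρ : TGD) (h : Var → Const) : Atom XRel Val :=
  ((𝒮.choiceRule ρ).chosenAtom (𝒮.choiceRule ρ).y).inst h

/-- The fact `DiffChoice_ρ(x,z)`. -/
noncomputable def diffFact (ρ : TGD) (h : Var → Const) : Atom XRel Val :=
  ((𝒮.choiceRule ρ).diffAtom (𝒮.choiceRule ρ).y).inst h

end Setting

/-! ### Auxiliary facts and the valuations they determine -/

theorem Atom.lift_injective {τ : Type} : Function.Injective (Atom.lift : Atom Rel τ → Atom XRel τ) := by
  rintro ⟨R, u⟩ ⟨R', u'⟩ h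
  have h1 : R = R' := XRel.base.inj (congrArg Atom.rel h)
  subst h1
  have h2 := eq_of_heq (Atom.mk.inj h).2
  exact congrArg _ h2

theorem Atom.mk_inj {R : Type} [Vocabulary R] {τ : Type} {r : R} {u u' : Fin (Vocabulary.ar r) → τ}
    (h : (⟨r, u⟩ : Atom R τ) = ⟨r, u'⟩) : u = u' := eq_of_heq (Atom.mk.inj h).2

theorem Atom.inst_congr_ground {R : Type} [Vocabulary R] {h h' : Var → Const} {a : Atom R Term}
    (H : ∀ i, (a.args i).ground h = (a.args i).ground h') : a.inst h = a.inst h' :=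
  Atom.map_congr (a := a) fun i => congrArg Val.const (H i)

theorem ChoiceRule.exists_x {r : ChoiceRule} {v : Var} (hv : v ∈ r.X) : ∃ i, r.x i = .var v := by
  obtain ⟨i, hi⟩ := List.mem_iff_get.1 hv
  exact ⟨i, congrArg _ hi⟩

theorem ChoiceRule.exists_y {r : ChoiceRule} {v : Var} (hv : v ∈ r.Y) : ∃ i, r.y i = .var v := by
  obtain ⟨i, hi⟩ := List.mem_iff_get.1 hv
  exact ⟨i, congrArg _ hi⟩

/-- The values of a tuple of the form `(x,u)`. -/
theorem ChoiceRule.append_ground_congr {r : ChoiceRule} {u u' : Fin r.Y.length → Term}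
    {h h' : Var → Const} (hx : Set.EqOn h h' {v | v ∈ r.X})
    (hu : ∀ i, (u i).ground h = (u' i).ground h') (i : Fin (r.X.length + r.Y.length)) :
    (Fin.append r.x u i).ground h = (Fin.append r.x u' i).ground h' := by
  refine Fin.addCases (fun i => ?_) (fun i => ?_) i
  · rw [Fin.append_left, Fin.append_left]
    exact hx (List.get_mem _ _)
  · rw [Fin.append_right, Fin.append_right]
    exact hu i

theorem ChoiceRule.eqOn_of_append {r : ChoiceRule} {h h' : Var → Const}
    (H : ∀ i, Val.const ((Fin.append r.x r.y i).ground h) =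
      Val.const ((Fin.append r.x r.y i).ground h')) :
    Set.EqOn h h' {v | v ∈ r.X} ∧ Set.EqOn h h' {v | v ∈ r.Y} := by
  constructor
  · intro v hv
    obtain ⟨i, hi⟩ := r.exists_x hv
    have := Val.const.inj (H (Fin.castAdd _ i))
    rwa [Fin.append_left, hi] at this
  · intro v hv
    obtain ⟨i, hi⟩ := r.exists_y hv
    have := Val.const.inj (H (Fin.natAdd _ i))
    rwa [Fin.append_right, hi] at this

theorem ChoiceRule.ground_y_congr {r : ChoiceRule} {h h' : Var → Const}
    (hy : Set.EqOn h h' {v | v ∈ r.Y}) (i : Fin r.Y.length) :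
    (r.y i).ground h = (r.y i).ground h' := hy (List.get_mem _ _)

namespace Setting

variable {𝒮 : Setting} {ρ ρ' : TGD} {h h' : Var → Const}

theorem setOf_mem_X : {v | v ∈ (𝒮.choiceRule ρ).X} = ρ.frontier :=
  Set.ext fun _ => TGD.mem_frontierList

theorem setOf_mem_Y : {v | v ∈ (𝒮.choiceRule ρ).Y} = ρ.exvar :=
  Set.ext fun _ => TGD.mem_exvarList

/-- The head carries the name of `Aux_ρ`, and with it the index of `ρ` among the TGDs. -/
theorem choiceRule_inj (hρ : ρ ∈ 𝒮.tgds) (e : 𝒮.choiceRule ρ = 𝒮.choiceRule ρ') : ρ = ρ' := by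
  have h1 := congrArg (fun r : ChoiceRule => r.rule.head) e
  have h2 := congrArg Atom.rel (Lit.atom.inj (Option.some.inj h1))
  exact 𝒮.auxName_inj hρ (congrArg Rel.name h2)

theorem rangeFact_congr (hz : Set.EqOn h h' ρ.exvar) : 𝒮.rangeFact ρ h = 𝒮.rangeFact ρ h' := by
  rw [← setOf_mem_Y (𝒮 := 𝒮)] at hz
  exact Atom.inst_congr_ground fun i => ChoiceRule.ground_y_congr hz i

theorem chosenFact_congr (hx : Set.EqOn h h' ρ.frontier) (hz : Set.EqOn h h' ρ.exvar) :
    𝒮.chosenFact ρ h = 𝒮.chosenFact ρ h' := by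
  rw [← setOf_mem_Y (𝒮 := 𝒮)] at hz
  rw [← setOf_mem_X (𝒮 := 𝒮)] at hx
  exact Atom.inst_congr_ground fun i =>
    ChoiceRule.append_ground_congr hx (ChoiceRule.ground_y_congr hz) i

theorem diffFact_congr (hx : Set.EqOn h h' ρ.frontier) (hz : Set.EqOn h h' ρ.exvar) :
    𝒮.diffFact ρ h = 𝒮.diffFact ρ h' := by
  rw [← setOf_mem_Y (𝒮 := 𝒮)] at hz
  rw [← setOf_mem_X (𝒮 := 𝒮)] at hx
  exact Atom.inst_congr_ground fun i =>
    ChoiceRule.append_ground_congr hx (ChoiceRule.ground_y_congr hz) i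

theorem rangeFact_inj (hρ : ρ ∈ 𝒮.tgds) (e : 𝒮.rangeFact ρ h = 𝒮.rangeFact ρ' h') :
    ρ = ρ' ∧ Set.EqOn h h' ρ.exvar := by
  obtain rfl := choiceRule_inj hρ (XRel.range.inj (congrArg Atom.rel e))
  refine ⟨rfl, ?_⟩
  rw [← setOf_mem_Y (𝒮 := 𝒮)]
  intro v hv
  obtain ⟨i, hi⟩ := ChoiceRule.exists_y hv
  have : ((𝒮.choiceRule ρ).y i).ground h = ((𝒮.choiceRule ρ).y i).ground h' :=
    Val.const.inj (congrFun (Atom.mk_inj e) i)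
  rwa [hi] at this

theorem chosenFact_inj (hρ : ρ ∈ 𝒮.tgds) (e : 𝒮.chosenFact ρ h = 𝒮.chosenFact ρ' h') :
    ρ = ρ' ∧ Set.EqOn h h' ρ.frontier ∧ Set.EqOn h h' ρ.exvar := by
  obtain rfl := choiceRule_inj hρ (XRel.chosen.inj (congrArg Atom.rel e))
  rw [← setOf_mem_Y (𝒮 := 𝒮), ← setOf_mem_X (𝒮 := 𝒮)]
  exact ⟨rfl, ChoiceRule.eqOn_of_append fun i => congrFun (Atom.mk_inj e) i⟩

theorem diffFact_inj (hρ : ρ ∈ 𝒮.tgds) (e : 𝒮.diffFact ρ h = 𝒮.diffFact ρ' h') :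
    ρ = ρ' ∧ Set.EqOn h h' ρ.frontier ∧ Set.EqOn h h' ρ.exvar := by
  obtain rfl := choiceRule_inj hρ (XRel.diffChoice.inj (congrArg Atom.rel e))
  rw [← setOf_mem_Y (𝒮 := 𝒮), ← setOf_mem_X (𝒮 := 𝒮)]
  exact ⟨rfl, ChoiceRule.eqOn_of_append fun i => congrFun (Atom.mk_inj e) i⟩

theorem auxFact_inj (hρ : ρ ∈ 𝒮.tgds) (e : 𝒮.auxFact ρ h = 𝒮.auxFact ρ' h') :
    ρ = ρ' ∧ Set.EqOn h h' ρ.frontier ∧ Set.EqOn h h' ρ.exvar := by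
  have e' := Atom.lift_injective e
  obtain rfl := 𝒮.auxName_inj hρ (congrArg Rel.name (congrArg Atom.rel e'))
  have key : ∀ v, (𝒮.auxAtom ρ).HasVar v → h v = h' v := by
    rintro v ⟨i, hi⟩
    have := Val.const.inj (congrFun (Atom.mk_inj e') i)
    rwa [hi] at this
  exact ⟨rfl, fun v hv => key v (𝒮.auxAtom_hasVar.2 (Or.inl hv)),
    fun v hv => key v (𝒮.auxAtom_hasVar.2 (Or.inr hv))⟩

end Setting


/-! ### Safety of the rules that the program stands for -/

theorem Rule.Has.of_lift {r : Rule Rel Term} {t : Term} (ht : r.lift.Has t) : r.Has t := by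
  have hL : ∀ L : Lit Rel Term, L.lift.Has t → L.Has t := by
    intro L h
    cases L <;> exact h
  obtain ⟨L, h1 | h1 | h1, h2⟩ := ht
  · obtain ⟨L', h3, rfl⟩ := Option.map_eq_some_iff.1 h1
    exact ⟨L', Or.inl h3, hL _ h2⟩
  · obtain ⟨L', h3, rfl⟩ := List.mem_map.1 h1
    exact ⟨L', Or.inr (Or.inl h3), hL _ h2⟩
  · obtain ⟨L', h3, rfl⟩ := List.mem_map.1 h1
    exact ⟨L', Or.inr (Or.inr h3), hL _ h2⟩

theorem Rule.AtomSafe.lift {r : Rule Rel Term} (hr : r.AtomSafe) : r.lift.AtomSafe := by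
  intro v hv
  obtain ⟨a, ha, i, hi⟩ := hr v hv.of_lift
  exact ⟨a.lift, List.mem_map.2 ⟨.atom a, ha, rfl⟩, i, hi⟩

theorem ChoiceRule.var_of_append {r : ChoiceRule} {u : Fin r.Y.length → Term} {v : Var}
    {i : Fin (r.X.length + r.Y.length)} (h : Fin.append r.x u i = .var v) :
    v ∈ r.X ∨ ∃ j, u j = .var v := by
  refine Fin.addCases (motive := fun i => Fin.append r.x u i = .var v → _) (fun i hi => ?_)
    (fun i hi => ?_) i h
  · rw [Fin.append_left] at hi
    exact Or.inl (Term.var.inj hi ▸ List.get_mem _ _)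
  · rw [Fin.append_right] at hi
    exact Or.inr ⟨i, hi⟩

theorem ChoiceRule.mem_Y_of_y {r : ChoiceRule} {v : Var} {i : Fin r.Y.length}
    (h : r.y i = .var v) : v ∈ r.Y := Term.var.inj h ▸ List.get_mem _ _

/-- The variables in `X` and `Y` are body variables, hence covered by body atoms. In the difference
rules `x` and `w` are covered by the `Chosen` atom and `y` by the `Range` atom. -/
theorem ChoiceRule.expand_atomSafe {r : ChoiceRule} (hr : r.rule.AtomSafe)
    {s : Rule XRel Term} (hs : s ∈ r.expand) : s.AtomSafe := by
  have hb := hr.lift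
  have hbody : ∀ v, r.rule.BodyHasVar v → ∃ a, Lit.atom a ∈ r.rule.lift.pos ∧ a.HasVar v := by
    rintro v ⟨L, h1, h2⟩
    obtain ⟨a, ha, i, hi⟩ := hr v ⟨L, Or.inr h1, h2⟩
    exact ⟨a.lift, List.mem_map.2 ⟨.atom a, ha, rfl⟩, i, hi⟩
  have hXY : ∀ (v : Var) (i : Fin (r.X.length + r.Y.length)), Fin.append r.x r.y i = .var v →
      ∃ a, Lit.atom a ∈ r.rule.lift.pos ∧ a.HasVar v := by
    intro v i h
    rcases ChoiceRule.var_of_append h with h | ⟨j, h⟩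
    · exact hbody v (r.X_body v h)
    · exact hbody v (r.Y_body v (ChoiceRule.mem_Y_of_y h))
  rcases hs with (rfl | rfl | rfl) | ⟨j, rfl⟩
  · rintro v ⟨L, h1 | h1 | h1, h2⟩
    · obtain rfl := Option.some.inj h1
      obtain ⟨i, hi⟩ := h2
      exact hbody v (r.Y_body v (ChoiceRule.mem_Y_of_y hi))
    · exact hb v ⟨L, Or.inr (Or.inl h1), h2⟩
    · exact hb v ⟨L, Or.inr (Or.inr h1), h2⟩
  · rintro v ⟨L, h1 | h1 | h1, h2⟩
    · obtain ⟨a, ha, hv⟩ := hb v ⟨L, Or.inl h1, h2⟩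
      exact ⟨a, List.mem_append_left _ ha, hv⟩
    · rcases List.mem_append.1 h1 with h1 | h1
      · obtain ⟨a, ha, hv⟩ := hb v ⟨L, Or.inr (Or.inl h1), h2⟩
        exact ⟨a, List.mem_append_left _ ha, hv⟩
      · obtain rfl := List.mem_singleton.1 h1
        exact ⟨_, List.mem_append_right _ (List.mem_singleton_self _), h2⟩
    · obtain ⟨a, ha, hv⟩ := hb v ⟨L, Or.inr (Or.inr h1), h2⟩
      exact ⟨a, List.mem_append_left _ ha, hv⟩
  · rintro v ⟨L, h1 | h1 | h1, h2⟩
    · obtain rfl := Option.some.inj h1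
      obtain ⟨i, hi⟩ := h2
      exact hXY v i hi
    · exact hb v ⟨L, Or.inr (Or.inl h1), h2⟩
    · rcases List.mem_append.1 h1 with h1 | h1
      · exact hb v ⟨L, Or.inr (Or.inr h1), h2⟩
      · obtain rfl := List.mem_singleton.1 h1
        obtain ⟨i, hi⟩ := h2
        exact hXY v i hi
  · have hy : ∀ v, v ∈ r.Y → ∃ a, Lit.atom a ∈ [Lit.atom (r.chosenAtom r.w),
        Lit.atom (r.rangeAtom r.y)] ∧ a.HasVar v := by
      intro v hv
      obtain ⟨i, hi⟩ := r.exists_y hv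
      exact ⟨r.rangeAtom r.y, by simp, i, hi⟩
    have hx : ∀ v, v ∈ r.X → ∃ a, Lit.atom a ∈ [Lit.atom (r.chosenAtom r.w),
        Lit.atom (r.rangeAtom r.y)] ∧ a.HasVar v := by
      intro v hv
      obtain ⟨i, hi⟩ := r.exists_x hv
      exact ⟨r.chosenAtom r.w, by simp, Fin.castAdd _ i, (Fin.append_left _ _ _).trans hi⟩
    rintro v ⟨L, h1 | h1 | h1, h2⟩
    · obtain rfl := Option.some.inj h1
      obtain ⟨i, hi⟩ := h2
      rcases ChoiceRule.var_of_append hi with h | ⟨j, h⟩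
      · exact hx v h
      · exact hy v (ChoiceRule.mem_Y_of_y h)
    · simp only [List.mem_cons, List.not_mem_nil, or_false] at h1
      rcases h1 with rfl | rfl
      · exact ⟨_, by simp, h2⟩
      · exact ⟨_, by simp, h2⟩
    · obtain rfl := List.mem_singleton.1 h1
      rcases h2 with h | h
      · exact hy v (ChoiceRule.mem_Y_of_y h)
      · exact ⟨r.chosenAtom r.w, by simp, Fin.natAdd _ j, (Fin.append_right _ _ _).trans h⟩

/-! ### Closed sets of facts -/

/-- The body of the ground version of `ρ` via `h` is contained in `N`. -/
def BodyIn (N : Finset (Atom XRel Val)) (ρ : TGD) (h : Var → Const) : Prop :=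
  ∀ a ∈ ρ.body, (a.inst h).lift ∈ N

namespace Setting

variable (𝒮 : Setting)

/-- The body of the choice rule of `ρ` holds. -/
def ChoiceBodyIn (N : Finset (Atom XRel Val)) (ρ : TGD) (h : Var → Const) : Prop :=
  BodyIn N ρ h ∧ ∀ z ∈ ρ.exvar, (𝒮.domFact (h z)).lift ∈ N

/-- The facts that the program derives in one step from `N`, negation being evaluated in `M`. -/
inductive Step (ED : Database) (M N : Finset (Atom XRel Val)) : Atom XRel Val → Prop
  | ed {a : Atom Rel Const} : a ∈ ED → Step ED M N (a.map Val.const).lift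
  | dom {R : Rel} {i : Fin R.arity} {h : Var → Const} : R ∈ 𝒮.source →
      (R.atom.inst h).lift ∈ N → Step ED M N (𝒮.domFact (h i)).lift
  | head {ρ : TGD} {h : Var → Const} {a : Atom Rel Term} : ρ ∈ 𝒮.tgds → BodyIn N ρ h →
      𝒮.auxFact ρ h ∈ N → a ∈ ρ.head → Step ED M N (a.inst h).lift
  | range {ρ : TGD} {h : Var → Const} : ρ ∈ 𝒮.tgds → 𝒮.ChoiceBodyIn N ρ h →
      Step ED M N (𝒮.rangeFact ρ h)
  | aux {ρ : TGD} {h : Var → Const} : ρ ∈ 𝒮.tgds → 𝒮.ChoiceBodyIn N ρ h →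
      𝒮.chosenFact ρ h ∈ N → Step ED M N (𝒮.auxFact ρ h)
  | chosen {ρ : TGD} {h : Var → Const} : ρ ∈ 𝒮.tgds → 𝒮.ChoiceBodyIn N ρ h →
      𝒮.diffFact ρ h ∉ M → Step ED M N (𝒮.chosenFact ρ h)
  | diff {ρ : TGD} {h h' : Var → Const} : ρ ∈ 𝒮.tgds → Set.EqOn h h' ρ.frontier →
      𝒮.chosenFact ρ h' ∈ N → 𝒮.rangeFact ρ h ∈ N → ¬ Set.EqOn h h' ρ.exvar →
      Step ED M N (𝒮.diffFact ρ h)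

variable {𝒮}

theorem Step.mono {ED : Database} {M N N' : Finset (Atom XRel Val)} (hN : N ⊆ N')
    {f : Atom XRel Val} (hf : 𝒮.Step ED M N f) : 𝒮.Step ED M N' f := by
  have hB : ∀ {ρ h}, BodyIn N ρ h → BodyIn N' ρ h := fun hb a ha => hN (hb a ha)
  have hC : ∀ {ρ h}, 𝒮.ChoiceBodyIn N ρ h → 𝒮.ChoiceBodyIn N' ρ h := fun hb =>
    ⟨hB hb.1, fun z hz => hN (hb.2 z hz)⟩
  cases hf with
  | ed h => exact .ed h
  | dom h1 h2 => exact .dom h1 (hN h2)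
  | head h1 h2 h3 h4 => exact .head h1 (hB h2) (hN h3) h4
  | range h1 h2 => exact .range h1 (hC h2)
  | aux h1 h2 h3 => exact .aux h1 (hC h2) (hN h3)
  | chosen h1 h2 h3 => exact .chosen h1 (hC h2) h3
  | diff h1 h2 h3 h4 h5 => exact .diff h1 h2 (hN h3) (hN h4) h5

theorem withED_atomSafe {ED : Database} {r : Rule XRel Term} (hr : r ∈ 𝒮.program.withED ED) :
    r.AtomSafe := by
  rcases hr with (⟨r, hr, rfl⟩ | ⟨r, hr, hs⟩) | ⟨a, -, rfl⟩
  · rcases 𝒮.mem_program_rules.1 hr with ⟨ρ, -, a, ha, rfl⟩ | ⟨η, -, rfl⟩ | ⟨R, -, i, rfl⟩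
    · exact (𝒮.headRule_atomSafe ha).lift
    · exact η.toRule_atomSafe.lift
    · exact (𝒮.domRule_atomSafe i).lift
  · obtain ⟨ρ, -, rfl⟩ := Finset.mem_image.1 hr
    exact ChoiceRule.expand_atomSafe (𝒮.choiceRule_atomSafe ρ) hs
  · rintro v ⟨L, h1 | h1 | h1, h2⟩
    · obtain rfl := Option.some.inj h1
      obtain ⟨i, hi⟩ := h2
      cases hi
    · cases h1
    · cases h1

theorem forall_pos_lift {r : Rule Rel Term} {N : Finset (Atom XRel Val)} {h : Var → Const}
    {l : List (Atom Rel Term)} (hl : r.pos = l.map .atom) :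
    (∀ L ∈ r.lift.pos, (L.map (Term.ground h)).Sat N) ↔ ∀ a ∈ l, (a.inst h).lift ∈ N := by
  simp only [Rule.lift, hl, List.map_map, List.forall_mem_map]
  rfl

theorem choiceBodyIn_iff {N : Finset (Atom XRel Val)} {ρ : TGD} {h : Var → Const} :
    𝒮.ChoiceBodyIn N ρ h ↔
      ∀ L ∈ (𝒮.choiceRule ρ).rule.lift.pos, (L.map (Term.ground h)).Sat N := by
  rw [forall_pos_lift (l := ρ.body ++ ρ.exvarList.map fun z => 𝒮.domAtom (.var z))
    (by simp [choiceRule])]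
  simp only [List.forall_mem_append, List.forall_mem_map, TGD.mem_exvarList]
  rfl

theorem _root_.DataExchange.ChoiceRule.chosenAtom_inst_congr {r : ChoiceRule}
    {u u' : Fin r.Y.length → Term} {h h' : Var → Const} (hx : Set.EqOn h h' {v | v ∈ r.X})
    (hu : ∀ i, (u i).ground h = (u' i).ground h') :
    (r.chosenAtom u).inst h = (r.chosenAtom u').inst h' :=
  congrArg (Atom.mk (XRel.chosen r)) (funext fun i =>
    congrArg Val.const (ChoiceRule.append_ground_congr hx hu i))

theorem _root_.DataExchange.ChoiceRule.lt_of_mem {r : ChoiceRule} {v : Var}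
    (hv : v ∈ r.X ∨ v ∈ r.Y) : v < (r.X ++ r.Y).sum + 1 :=
  Nat.lt_succ_of_le (List.single_le_sum (fun _ _ => Nat.zero_le _) _ (List.mem_append.2 hv))

/-- Rules and constructors of `Step` correspond one to one, except for the difference rules. There a
single valuation of `x`, `y`, `w` together with an index at which `y` and `w` differ must be
exchanged for two valuations that agree on the frontier but not on the existential variables. -/
theorem closedUnder_iff {ED : Database} {M N : Finset (Atom XRel Val)} :
    ClosedUnder (𝒮.program.withED ED) M N ↔ (∀ f, 𝒮.Step ED M N f → f ∈ N) ∧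
      ∀ η ∈ 𝒮.tEGDs, ∀ h : Var → Const, (∀ a ∈ η.body, (a.inst h).lift ∈ N) → h η.x = h η.y := by
  classical
  have hhead : ∀ ρ a, (𝒮.headRule ρ a).pos = (ρ.body ++ [𝒮.auxAtom ρ]).map .atom := by
    simp [headRule]
  constructor
  · intro H
    have hexp : ∀ ρ ∈ 𝒮.tgds, ∀ r ∈ (𝒮.choiceRule ρ).expand, ∀ h, r.HoldsAt M N h :=
      fun ρ hρ r hr => H r (Or.inl (Or.inr ⟨_, Finset.mem_image_of_mem _ hρ, hr⟩))
    refine ⟨fun f hf => ?_, fun η hη h hb => ?_⟩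
    · cases hf with
      | @ed a ha =>
        obtain ⟨L, h1, h2⟩ := H _ (Or.inr ⟨a, ha, rfl⟩) (fun _ => [])
          (by simp [factRule]) (by simp [factRule])
        obtain rfl := Option.some.inj h1
        exact h2
      | @dom R i h hR hN =>
        obtain ⟨L, h1, h2⟩ := H (𝒮.domRule R i).lift (Or.inl (Or.inl ⟨_, 𝒮.mem_program_rules.2
          (Or.inr (Or.inr ⟨R, hR, i, rfl⟩)), rfl⟩)) h
          ((forall_pos_lift (l := [R.atom]) rfl).2 (by simpa using hN))
          (by simp [domRule, Rule.lift])
        obtain rfl := Option.some.inj h1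
        exact h2
      | @head ρ h a hρ hb hx ha =>
        obtain ⟨L, h1, h2⟩ := H (𝒮.headRule ρ a).lift (Or.inl (Or.inl ⟨_, 𝒮.mem_program_rules.2
          (Or.inl ⟨ρ, hρ, a, ha, rfl⟩), rfl⟩)) h
          ((forall_pos_lift (hhead ρ a)).2 (List.forall_mem_append.2 ⟨hb, List.forall_mem_singleton.2 hx⟩))
          (by simp [headRule, Rule.lift])
        obtain rfl := Option.some.inj h1
        exact h2
      | @range ρ h hρ hb =>
        obtain ⟨L, h1, h2⟩ := hexp ρ hρ _ (Or.inl (Or.inl rfl)) h (choiceBodyIn_iff.1 hb)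
          (by simp [choiceRule, Rule.lift])
        obtain rfl := Option.some.inj h1
        exact h2
      | @aux ρ h hρ hb hc =>
        obtain ⟨L, h1, h2⟩ := hexp ρ hρ _ (Or.inl (Or.inr (Or.inl rfl))) h
          (List.forall_mem_append.2 ⟨choiceBodyIn_iff.1 hb, List.forall_mem_singleton.2 hc⟩)
          (by simp [choiceRule, Rule.lift])
        obtain rfl := Option.some.inj h1
        exact h2
      | @chosen ρ h hρ hb hd =>
        obtain ⟨L, h1, h2⟩ := hexp ρ hρ _ (Or.inl (Or.inr (Or.inr rfl))) h
          (choiceBodyIn_iff.1 hb) (List.forall_mem_append.2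
            ⟨by simp [choiceRule, Rule.lift], List.forall_mem_singleton.2 hd⟩)
        obtain rfl := Option.some.inj h1
        exact h2
      | @diff ρ h h' hρ hx hc hr hz =>
        rw [← setOf_mem_X (𝒮 := 𝒮)] at hx
        rw [← setOf_mem_Y (𝒮 := 𝒮)] at hz
        set r := 𝒮.choiceRule ρ with hrdef
        set m := (r.X ++ r.Y).sum + 1
        -- The shift `m` exceeds every variable of `X` and `Y`, so the variables `w` are fresh and
        -- `k` can follow `h` on `x`, `y` and `h'` on `w`.
        let k : Var → Const := fun v => if v ∈ r.X ∨ v ∈ r.Y then h v else h' (v - m)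
        have hk : ∀ v, v ∈ r.X ∨ v ∈ r.Y → k v = h v := fun v hv => if_pos hv
        have hkx : Set.EqOn h k {v | v ∈ r.X} := fun v hv => (hk v (Or.inl hv)).symm
        have hky : Set.EqOn h k {v | v ∈ r.Y} := fun v hv => (hk v (Or.inr hv)).symm
        have hkw : ∀ i, (r.w i).ground k = (r.y i).ground h' := by
          intro i
          have : ¬ (r.Y.get i + m ∈ r.X ∨ r.Y.get i + m ∈ r.Y) := fun hv =>
            absurd (ChoiceRule.lt_of_mem hv) (not_lt.2 (Nat.le_add_left _ _))
          change k (r.Y.get i + m) = h' (r.Y.get i)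
          simp only [k, if_neg this, Nat.add_sub_cancel]
        have hex : ∃ i, (r.y i).ground h ≠ (r.y i).ground h' := by
          by_contra hcon
          push Not at hcon
          refine hz fun v hv => ?_
          obtain ⟨i, hi⟩ := r.exists_y hv
          have := hcon i
          rwa [hi] at this
        obtain ⟨i, hi⟩ := hex
        have e1 : (r.chosenAtom r.w).inst k = 𝒮.chosenFact ρ h' :=
          ChoiceRule.chosenAtom_inst_congr (fun v hv => (hkx hv).symm.trans (hx hv)) hkw
        have e2 : (r.rangeAtom r.y).inst k = 𝒮.rangeFact ρ h :=
          (Atom.inst_congr_ground fun i => ChoiceRule.ground_y_congr hky i).symm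
        have e3 : (r.diffAtom r.y).inst k = 𝒮.diffFact ρ h :=
          (Atom.inst_congr_ground fun i => ChoiceRule.append_ground_congr hkx
            (ChoiceRule.ground_y_congr hky) i).symm
        obtain ⟨L, h1, h2⟩ := hexp ρ hρ _ (Or.inr ⟨i, rfl⟩) k (by
            intro L hL
            simp only [List.mem_cons, List.not_mem_nil, or_false] at hL
            rcases hL with rfl | rfl
            · change (r.chosenAtom r.w).inst k ∈ N
              rwa [e1]
            · change (r.rangeAtom r.y).inst k ∈ N
              rwa [e2]) (by
            intro L hL
            obtain rfl := List.mem_singleton.1 hL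
            intro e
            change (r.y i).ground k = (r.w i).ground k at e
            rw [hkw, ← ChoiceRule.ground_y_congr hky] at e
            exact hi e)
        obtain rfl := Option.some.inj h1
        rw [← e3]
        exact h2
    · obtain ⟨L, h1, h2⟩ := H η.toRule.lift (Or.inl (Or.inl ⟨_, 𝒮.mem_program_rules.2
        (Or.inr (Or.inl ⟨η, hη, rfl⟩)), rfl⟩)) h ((forall_pos_lift rfl).2 hb)
        (by simp [EGD.toRule, Rule.lift])
      obtain rfl := Option.some.inj h1
      exact h2
  · rintro ⟨hstep, hegd⟩ r hr h hpos hneg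
    rcases hr with (⟨r, hr, rfl⟩ | ⟨r, hr, hs⟩) | ⟨a, ha, rfl⟩
    · rcases 𝒮.mem_program_rules.1 hr with ⟨ρ, hρ, a, ha, rfl⟩ | ⟨η, hη, rfl⟩ | ⟨R, hR, i, rfl⟩
      · have hb := List.forall_mem_append.1 ((forall_pos_lift (hhead ρ a)).1 hpos)
        exact ⟨_, rfl, hstep _ (.head hρ hb.1 (hb.2 _ (List.mem_singleton_self _)) ha)⟩
      · exact ⟨_, rfl, hegd η hη h ((forall_pos_lift rfl).1 hpos)⟩
      · have hb := (forall_pos_lift (l := [R.atom]) rfl).1 hpos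
        exact ⟨_, rfl, hstep _ (.dom (i := i) hR (by simpa using hb))⟩
    · obtain ⟨ρ, hρ, rfl⟩ := Finset.mem_image.1 hr
      rcases hs with (rfl | rfl | rfl) | ⟨i, rfl⟩
      · exact ⟨_, rfl, hstep _ (.range hρ (choiceBodyIn_iff.2 hpos))⟩
      · have hb := List.forall_mem_append.1 hpos
        exact ⟨_, rfl, hstep _ (.aux hρ (choiceBodyIn_iff.2 hb.1) (hb.2 _ (List.mem_singleton_self _)))⟩
      · have hd := (List.forall_mem_append.1 hneg).2
        exact ⟨_, rfl, hstep _ (.chosen hρ (choiceBodyIn_iff.2 hpos) (hd _ (List.mem_singleton_self _)))⟩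
      · have hi : ((𝒮.choiceRule ρ).y i).ground h ≠ ((𝒮.choiceRule ρ).w i).ground h :=
          hneg _ (List.mem_singleton_self _)
        set r := 𝒮.choiceRule ρ with hrdef
        set m := (r.X ++ r.Y).sum + 1
        -- Conversely, the second valuation reads the values of `w` at the variables of `Y`.
        let h' : Var → Const := fun v => if v ∈ r.Y then h (v + m) else h v
        have hx : Set.EqOn h h' {v | v ∈ r.X} := fun v hv =>
          (if_neg fun hy => r.disjoint hv hy).symm
        have hw : ∀ i, (r.w i).ground h = (r.y i).ground h' := fun i =>
          (if_pos (List.get_mem r.Y i)).symm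
        have e1 : (r.chosenAtom r.w).inst h = 𝒮.chosenFact ρ h' :=
          ChoiceRule.chosenAtom_inst_congr hx hw
        have hc : (r.chosenAtom r.w).inst h ∈ N := hpos _ List.mem_cons_self
        refine ⟨_, rfl, hstep _ (.diff (h' := h') hρ (setOf_mem_X (𝒮 := 𝒮) ▸ hx) (e1 ▸ hc)
          (hpos _ (List.mem_cons_of_mem _ List.mem_cons_self)) fun hz => ?_)⟩
        rw [← setOf_mem_Y (𝒮 := 𝒮)] at hz
        rw [hw] at hi
        exact hi (ChoiceRule.ground_y_congr hz _)
    · exact ⟨_, rfl, hstep _ (.ed ha)⟩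

/-- Every fact of a stable model is derived in one step. -/
theorem step_of_mem {ED : Database} {M : Finset (Atom XRel Val)}
    (hcl : ClosedUnder (𝒮.program.withED ED) M M)
    (hmin : ∀ M' ⊂ M, ¬ ClosedUnder (𝒮.program.withED ED) M M') {f : Atom XRel Val}
    (hf : f ∈ M) : 𝒮.Step ED M M f := by
  by_contra hcon
  rw [closedUnder_iff] at hcl
  -- If `f` had no derivation from `M`, erasing it would leave a closed set, because derivations are
  -- monotone and EGDs pass to subsets.
  have hsub := Finset.erase_subset f M
  refine hmin _ (Finset.erase_ssubset hf) (closedUnder_iff.2 ⟨fun g hg => ?_, fun η hη h hb =>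
    hcl.2 η hη h fun a ha => hsub (hb a ha)⟩)
  have hg' := hg.mono hsub
  exact Finset.mem_erase.2 ⟨fun e => hcon (e ▸ hg'), hcl.1 g hg'⟩

end Setting


/-! ### Constants and relations of the program -/

theorem mem_part {M : Finset (Atom XRel Val)} {T : Finset Rel} {a : Atom Rel Val} :
    a ∈ part M T ↔ a.lift ∈ M ∧ a.rel ∈ T := by
  have hun : ∀ f : Atom XRel Val, f.unlift = some a ↔ f = a.lift := by
    rintro ⟨r | r | r | r, u⟩
    · refine ⟨fun h => ?_, fun h => ?_⟩
      · rw [← Option.some.inj h]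
        rfl
      · rw [h]
        rfl
    all_goals exact ⟨fun h => (nomatch h), fun h => XRel.noConfusion (congrArg Atom.rel h)⟩
  simp only [part, Instance.restrict, Finset.mem_filter, Finset.mem_biUnion, Option.mem_toFinset,
    Option.mem_def, hun]
  exact and_congr_left fun _ => ⟨fun ⟨f, hf, e⟩ => e ▸ hf, fun h => ⟨_, h, rfl⟩⟩

theorem Rule.Has.of_head {r : Rule Rel Term} {L : Lit Rel Term} (hh : r.head = some L)
    {l : List (Atom Rel Term)} (hp : r.pos = l.map .atom) (hn : r.neg = []) {t : Term}
    (ht : r.Has t) : L.Has t ∨ ∃ a ∈ l, ∃ i, a.args i = t := by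
  obtain ⟨L', h1 | h1 | h1, h2⟩ := ht
  · rw [hh] at h1
    obtain rfl := Option.some.inj h1
    exact Or.inl h2
  · rw [hp] at h1
    obtain ⟨a, ha, rfl⟩ := List.mem_map.1 h1
    exact Or.inr ⟨a, ha, h2⟩
  · rw [hn] at h1
    simp at h1

/-- The atoms added by the expansion have only variables as arguments. -/
theorem ChoiceRule.has_of_expand {r : ChoiceRule} {s : Rule XRel Term} (hs : s ∈ r.expand)
    {c : Const} (hc : s.Has (.const c)) : r.rule.lift.Has (.const c) := by
  have happ : ∀ (u : Fin r.Y.length → Var) (i : Fin (r.X.length + r.Y.length)),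
      Fin.append r.x (fun j => .var (u j)) i ≠ .const c := by
    intro u i
    refine Fin.addCases (fun i => ?_) (fun i => ?_) i
    · rw [Fin.append_left]
      exact nofun
    · rw [Fin.append_right]
      exact nofun
  obtain ⟨L, hL, h2⟩ := hc
  rcases hs with (rfl | rfl | rfl) | ⟨j, rfl⟩
  · rcases hL with h1 | h1 | h1
    · obtain rfl := Option.some.inj h1
      obtain ⟨i, hi⟩ := h2
      cases hi
    · exact ⟨L, Or.inr (Or.inl h1), h2⟩
    · exact ⟨L, Or.inr (Or.inr h1), h2⟩
  · rcases hL with h1 | h1 | h1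
    · exact ⟨L, Or.inl h1, h2⟩
    · rcases List.mem_append.1 h1 with h1 | h1
      · exact ⟨L, Or.inr (Or.inl h1), h2⟩
      · obtain rfl := List.mem_singleton.1 h1
        obtain ⟨i, hi⟩ := h2
        exact absurd hi (happ _ i)
    · exact ⟨L, Or.inr (Or.inr h1), h2⟩
  · rcases hL with h1 | h1 | h1
    · obtain rfl := Option.some.inj h1
      obtain ⟨i, hi⟩ := h2
      exact absurd hi (happ _ i)
    · exact ⟨L, Or.inr (Or.inl h1), h2⟩
    · rcases List.mem_append.1 h1 with h1 | h1
      · exact ⟨L, Or.inr (Or.inr h1), h2⟩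
      · obtain rfl := List.mem_singleton.1 h1
        obtain ⟨i, hi⟩ := h2
        exact absurd hi (happ _ i)
  · rcases hL with h1 | h1 | h1
    · obtain rfl := Option.some.inj h1
      obtain ⟨i, hi⟩ := h2
      exact absurd hi (happ _ i)
    · simp only [List.mem_cons, List.not_mem_nil, or_false] at h1
      rcases h1 with rfl | rfl
      · obtain ⟨i, hi⟩ := h2
        exact absurd hi (happ (fun j => r.Y.get j + ((r.X ++ r.Y).sum + 1)) i)
      · obtain ⟨i, hi⟩ := h2
        cases hi
    · obtain rfl := List.mem_singleton.1 h1
      rcases h2 with h | h <;> cases h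

namespace Setting

variable {𝒮 : Setting}

theorem domFact_rel_notMem (c : Const) : (𝒮.domFact c).rel ∉ 𝒮.source ∪ 𝒮.target := fun h => by
  have h1 := 𝒮.name_length_lt h
  have h2 : (𝒮.domFact c).rel.name.length = 𝒮.nameBound := List.length_replicate
  omega

theorem auxAtom_rel_notMem (ρ : TGD) : (𝒮.auxAtom ρ).rel ∉ 𝒮.source ∪ 𝒮.target := fun h => by
  have h1 := 𝒮.name_length_lt h
  have h2 : (𝒮.auxAtom ρ).rel.name.length = 𝒮.nameBound + 1 + 𝒮.tgds.toList.idxOf ρ :=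
    List.length_replicate
  omega

theorem auxAtom_rel_ne_dom (ρ : TGD) (c : Const) : (𝒮.auxAtom ρ).rel ≠ (𝒮.domFact c).rel :=
  fun h => by
    have h1 : (𝒮.domFact c).rel.name.length = 𝒮.nameBound := List.length_replicate
    have h2 : (𝒮.auxAtom ρ).rel.name.length = 𝒮.nameBound + 1 + 𝒮.tgds.toList.idxOf ρ :=
      List.length_replicate
    rw [h] at h2
    omega

theorem body_rel {ρ : TGD} (hρ : ρ ∈ 𝒮.tgds) {a : Atom Rel Term} (ha : a ∈ ρ.body) :
    a.rel ∈ 𝒮.source ∨ a.rel ∈ 𝒮.target := by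
  rcases Finset.mem_union.1 hρ with h | h
  · exact Or.inl (𝒮.st_body ρ h a ha)
  · exact Or.inr (𝒮.t_body ρ h a ha)

/-! ### Databases representing a source instance -/

/-- The database `ED` extends the source instance `I` by facts `Dom(c)`, and its constants, together
with those of `𝒮`, are those in `S`. -/
structure Represents (𝒮 : Setting) (I : Database) (S : Set Const) (ED : Database) : Prop where
  isSource : 𝒮.IsSource I
  nonempty : S.Nonempty
  mem : ∀ a ∈ ED, a ∈ I ∨ ∃ c ∈ S, a = unaryFact 𝒮.domName c
  subset : I ⊆ ED
  dom : ∀ c ∈ S, c ∈ I.consts ∨ unaryFact 𝒮.domName c ∈ ED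
  consts_subset : 𝒮.consts ∪ I.consts ⊆ S

namespace Represents

variable {I ED : Database} {S : Set Const} {M N : Finset (Atom XRel Val)}

/-- Together with `subset_herbrandUniverse`, this identifies the constants that can occur in stable
models with those in `S`. The atoms over `Dom` and `Aux_ρ` in rules of the program contribute none.
-/
theorem herbrandUniverse_subset (hR : 𝒮.Represents I S ED) :
    herbrandUniverse (𝒮.program.withED ED) ⊆ S := by
  rintro c ⟨r, hr, hc⟩
  rcases hr with (⟨r, hr, rfl⟩ | ⟨r, hr, hs⟩) | ⟨a, ha, rfl⟩
  · have hc' := hc.of_lift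
    rcases 𝒮.mem_program_rules.1 hr with ⟨ρ, hρ, a, ha, rfl⟩ | ⟨η, hη, rfl⟩ | ⟨R, -, i, rfl⟩
    · refine hR.consts_subset (Or.inl ?_)
      rcases hc'.of_head rfl (l := ρ.body ++ [𝒮.auxAtom ρ]) (by simp [headRule]) rfl with h | ⟨b, hb, h⟩
      · exact TGD.mem_consts_tgds hρ (Or.inr ⟨a, ha, h⟩)
      · rcases List.mem_append.1 hb with hb | hb
        · exact TGD.mem_consts_tgds hρ (Or.inl ⟨b, hb, h⟩)
        · obtain rfl := List.mem_singleton.1 hb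
          obtain ⟨i, hi⟩ := h
          cases hi
    · refine hR.consts_subset (Or.inl ?_)
      rcases hc'.of_head rfl (l := η.body) rfl rfl with h | ⟨b, hb, h⟩
      · rcases h with h | h <;> cases h
      · exact Or.inr (Or.inr ⟨η, hη, b, hb, h⟩)
    · rcases hc'.of_head rfl (l := [R.atom]) rfl rfl with ⟨_, h⟩ | ⟨b, hb, h⟩
      · cases h
      · obtain rfl := List.mem_singleton.1 hb
        obtain ⟨i, hi⟩ := h
        cases hi
  · obtain ⟨ρ, hρ, rfl⟩ := Finset.mem_image.1 hr
    have hc' := (ChoiceRule.has_of_expand hs hc).of_lift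
    refine hR.consts_subset (Or.inl ?_)
    rcases hc'.of_head rfl (l := ρ.body ++ ρ.exvarList.map fun z => 𝒮.domAtom (.var z))
      (by simp [choiceRule]) rfl with h | ⟨b, hb, h⟩
    · obtain ⟨i, hi⟩ := h
      cases hi
    · rcases List.mem_append.1 hb with hb | hb
      · exact TGD.mem_consts_tgds hρ (Or.inl ⟨b, hb, h⟩)
      · obtain ⟨z, -, rfl⟩ := List.mem_map.1 hb
        obtain ⟨i, hi⟩ := h
        cases hi
  · obtain ⟨L, h1 | h1 | h1, h2⟩ := hc
    · obtain rfl := Option.some.inj h1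
      obtain ⟨i, hi⟩ := h2
      have hi' : a.args i = c := Term.const.inj hi
      rcases hR.mem a ha with h | ⟨d, hd, rfl⟩
      · exact hR.consts_subset (Or.inr ⟨a, h, i, hi'⟩)
      · exact hi' ▸ hd
    · cases h1
    · cases h1

theorem subset_herbrandUniverse (hR : 𝒮.Represents I S ED) :
    S ⊆ herbrandUniverse (𝒮.program.withED ED) := by
  intro c hc
  have key : ∀ a ∈ ED, ∀ i, a.args i = c → c ∈ herbrandUniverse (𝒮.program.withED ED) :=
    fun a ha i hi => ⟨_, Or.inr ⟨a, ha, rfl⟩, _, Or.inl rfl, i, congrArg Term.const hi⟩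
  rcases hR.dom c hc with ⟨a, ha, i, hi⟩ | h
  · exact key a (hR.subset ha) i hi
  · exact key _ h (0 : Fin 1) rfl

/-- All constants in `S` are available for choices. -/
theorem domFact_mem (hR : 𝒮.Represents I S ED) (hN : ∀ f, 𝒮.Step ED M N f → f ∈ N) {c : Const}
    (hc : c ∈ S) : (𝒮.domFact c).lift ∈ N := by
  rcases hR.dom c hc with ⟨a, ha, i, rfl⟩ | h
  · have h1 := hN _ (.ed (hR.subset ha))
    -- A valuation of the variables of `R.atom`, namely the indices below the arity; the value `[]`
    -- elsewhere is irrelevant.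
    let g : Var → Const := fun v => if hv : v < a.rel.arity then a.args ⟨v, hv⟩ else []
    have hg : ∀ j : Fin a.rel.arity, g j = a.args j := fun j => dif_pos j.2
    have h2 : a.map Val.const = a.rel.atom.inst g :=
      congrArg (Atom.mk a.rel) (funext fun j => congrArg Val.const (hg j).symm)
    rw [h2] at h1
    have := hN _ (.dom (i := i) (hR.isSource a ha) h1)
    rwa [hg] at this
  · exact hN _ (.ed h)

theorem rel_of_ed (hR : 𝒮.Represents I S ED) {a : Atom Rel Const} (ha : a ∈ ED) {b : Atom Rel Val}
    (e : b.lift = (a.map Val.const).lift) :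
    b ∈ I.toInstance ∨ ∃ c ∈ S, b = 𝒮.domFact c := by
  have hb := Atom.lift_injective e
  rcases hR.mem a ha with h | ⟨c, hc, rfl⟩
  · exact Or.inl (hb ▸ Finset.mem_image_of_mem _ h)
  · exact Or.inr ⟨c, hc, hb⟩

end Represents

/-! ### Inversion of derivations -/

section

variable {ED : Database} {M N : Finset (Atom XRel Val)} {ρ : TGD} {h : Var → Const}

/-- The relation symbol singles out the constructor and the TGD. The fact determines the valuation
only on the frontier and the existential variables, so the valuation that satisfied the body may be
another one. -/
theorem Step.chosen_inv (hρ : ρ ∈ 𝒮.tgds) (H : 𝒮.Step ED M N (𝒮.chosenFact ρ h)) :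
    𝒮.diffFact ρ h ∉ M ∧
      ∃ h', Set.EqOn h h' ρ.frontier ∧ Set.EqOn h h' ρ.exvar ∧ 𝒮.ChoiceBodyIn N ρ h' := by
  generalize e : 𝒮.chosenFact ρ h = f at H
  cases H with
  | chosen _ h2 h3 =>
    obtain ⟨rfl, hx, hz⟩ := chosenFact_inj hρ e
    exact ⟨diffFact_congr hx hz ▸ h3, _, hx, hz, h2⟩
  | _ => exact XRel.noConfusion (congrArg Atom.rel e)

theorem Step.diff_inv (hρ : ρ ∈ 𝒮.tgds) (H : 𝒮.Step ED M N (𝒮.diffFact ρ h)) :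
    ∃ h', Set.EqOn h h' ρ.frontier ∧ 𝒮.chosenFact ρ h' ∈ N := by
  generalize e : 𝒮.diffFact ρ h = f at H
  cases H with
  | diff _ h2 h3 =>
    obtain ⟨rfl, hx, hz⟩ := diffFact_inj hρ e
    exact ⟨_, hx.trans h2, h3⟩
  | _ => exact XRel.noConfusion (congrArg Atom.rel e)

/-- The name of `Aux_ρ` excludes the schemas, `Dom` and the auxiliary relations of other TGDs, so
only the rule for `ρ` can have produced the fact. -/
theorem Step.aux_inv {I : Database} {S : Set Const} (hR : 𝒮.Represents I S ED) (hρ : ρ ∈ 𝒮.tgds)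
    (H : 𝒮.Step ED M N (𝒮.auxFact ρ h)) : 𝒮.chosenFact ρ h ∈ N := by
  generalize e : 𝒮.auxFact ρ h = f at H
  have hrel : ∀ {b : Atom Rel Val}, 𝒮.auxFact ρ h = b.lift → (𝒮.auxAtom ρ).rel = b.rel :=
    fun {b} e => congrArg Atom.rel
      (Atom.lift_injective (show ((𝒮.auxAtom ρ).inst h).lift = _ from e))
  cases H with
  | ed h1 =>
    rcases hR.rel_of_ed h1 e with h2 | ⟨c, -, h2⟩
    · obtain ⟨b, hb, e'⟩ := Finset.mem_image.1 h2
      have h3 : b.rel = (𝒮.auxAtom ρ).rel := congrArg Atom.rel e'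
      exact absurd (Finset.mem_union_left _ (h3 ▸ hR.isSource b hb)) (auxAtom_rel_notMem ρ)
    · exact absurd (congrArg Atom.rel h2) (auxAtom_rel_ne_dom ρ c)
  | dom => exact absurd (congrArg Atom.rel (Atom.lift_injective e)) (auxAtom_rel_ne_dom ρ _)
  | head h1 _ _ h4 =>
    exact absurd (Finset.mem_union_right _ (hrel e ▸ head_target h1 _ h4)) (auxAtom_rel_notMem ρ)
  | aux _ h2 h3 =>
    obtain ⟨rfl, hx, hz⟩ := auxFact_inj hρ e
    exact chosenFact_congr hx hz ▸ h3
  | _ => exact XRel.noConfusion (congrArg Atom.rel e)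

theorem Step.source_inv {I : Database} {S : Set Const} (hR : 𝒮.Represents I S ED)
    {a : Atom Rel Val} (ha : a.rel ∈ 𝒮.source) (H : 𝒮.Step ED M N a.lift) :
    a ∈ I.toInstance := by
  generalize e : a.lift = f at H
  cases H with
  | ed h1 =>
    rcases hR.rel_of_ed h1 e with h2 | ⟨c, -, rfl⟩
    · exact h2
    · exact absurd (Finset.mem_union_left _ ha) (domFact_rel_notMem c)
  | dom =>
    obtain rfl := Atom.lift_injective e
    exact absurd (Finset.mem_union_left _ ha) (domFact_rel_notMem _)
  | head h1 _ _ h4 =>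
    obtain rfl := Atom.lift_injective e
    exact absurd (head_target h1 _ h4) (Finset.disjoint_left.1 𝒮.disjoint ha)
  | aux =>
    obtain rfl := Atom.lift_injective e
    exact absurd (Finset.mem_union_left _ ha) (auxAtom_rel_notMem _)
  | _ => exact XRel.noConfusion (congrArg Atom.rel e)

theorem Step.target_inv {I : Database} {S : Set Const} (hR : 𝒮.Represents I S ED)
    {a : Atom Rel Val} (ha : a.rel ∈ 𝒮.target) (H : 𝒮.Step ED M N a.lift) :
    ∃ ρ ∈ 𝒮.tgds, ∃ h, ∃ b ∈ ρ.head, BodyIn N ρ h ∧ 𝒮.auxFact ρ h ∈ N ∧ a = b.inst h := by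
  generalize e : a.lift = f at H
  cases H with
  | ed h1 =>
    rcases hR.rel_of_ed h1 e with h2 | ⟨c, -, rfl⟩
    · exact absurd ha (IsSource.not_target hR.isSource h2)
    · exact absurd (Finset.mem_union_right _ ha) (domFact_rel_notMem c)
  | dom =>
    obtain rfl := Atom.lift_injective e
    exact absurd (Finset.mem_union_right _ ha) (domFact_rel_notMem _)
  | head h1 h2 h3 h4 => exact ⟨_, h1, _, _, h4, h2, h3, Atom.lift_injective e⟩
  | aux =>
    obtain rfl := Atom.lift_injective e
    exact absurd (Finset.mem_union_right _ ha) (auxAtom_rel_notMem _)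
  | _ => exact XRel.noConfusion (congrArg Atom.rel e)

end

/-! ### From stable models to supported solutions -/

open Classical in
/-- The ex-choice recorded in a set of facts. -/
noncomputable def recordedChoice (𝒮 : Setting) (M : Finset (Atom XRel Val)) : ExChoice :=
  fun ρ u z => if H : ∃ h : Var → Const, 𝒮.chosenFact ρ h ∈ M ∧ ∀ y : ρ.frontier, h y = u y
    then H.choose z else []

/-- Choices are unique (`huniq`) and made whenever a body holds (`hchosen`), so a stable model
determines an ex-choice wherever one is needed. A smaller solution under that ex-choice would give a
smaller set closed under the reduct. -/
theorem part_mem_ssolOver {I ED : Database} {S : Set Const} (hR : 𝒮.Represents I S ED)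
    {M : Finset (Atom XRel Val)} (hM : M ∈ 𝒮.program.stableModels ED) :
    part M 𝒮.target ∈ 𝒮.ssolOver I S := by
  classical
  obtain ⟨hU, hcl, hmin⟩ := (isStable_iff fun r hr => withED_atomSafe hr).1 hM
  have hinv : ∀ {f}, f ∈ M → 𝒮.Step ED M M f := fun hf => step_of_mem hcl hmin hf
  obtain ⟨hstep, hegd⟩ := closedUnder_iff.1 hcl
  set γ := 𝒮.recordedChoice M with hγ
  -- Of two different choices for one frontier tuple, the second would derive `DiffChoice` for the
  -- first, whose own derivation needs the absence of that fact.
  have huniq : ∀ ρ ∈ 𝒮.tgds, ∀ h h', 𝒮.chosenFact ρ h ∈ M → 𝒮.chosenFact ρ h' ∈ M →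
      Set.EqOn h h' ρ.frontier → Set.EqOn h h' ρ.exvar := by
    intro ρ hρ h h' hh hh' hx
    by_contra hz
    obtain ⟨h1, h2, -, h3, h4⟩ := (hinv hh).chosen_inv hρ
    exact h1 (hstep _ (.diff hρ hx hh' (rangeFact_congr h3 ▸ hstep _ (.range hρ h4)) hz))
  have hcoh : ∀ ρ ∈ 𝒮.tgds, ∀ h, 𝒮.chosenFact ρ h ∈ M → ρ.Coherent γ h := by
    intro ρ hρ h hh z
    have H : ∃ h' : Var → Const, 𝒮.chosenFact ρ h' ∈ M ∧ ∀ y : ρ.frontier, h' y = h y :=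
      ⟨h, hh, fun _ => rfl⟩
    have e : γ ρ (fun y => h y) z = H.choose z := dif_pos H
    rw [e]
    exact (huniq ρ hρ _ _ H.choose_spec.1 hh (fun y hy => H.choose_spec.2 ⟨y, hy⟩) z.2).symm
  -- In particular, the default value of the recorded choice is never used when the body holds.
  have hchosen : ∀ ρ ∈ 𝒮.tgds, ∀ h, ρ.Coherent γ h → BodyIn M ρ h → 𝒮.chosenFact ρ h ∈ M := by
    intro ρ hρ h hc hb
    obtain ⟨h', hx, hh'⟩ : ∃ h', Set.EqOn h h' ρ.frontier ∧ 𝒮.chosenFact ρ h' ∈ M := by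
      obtain ⟨c, hcS⟩ := hR.nonempty
      -- Any available constant serves as a candidate for all existential variables. Either the
      -- candidate is chosen, or it is marked as different, and then another choice for the same
      -- frontier tuple must exist.
      set h₀ : Var → Const := fun v => if v ∈ ρ.exvar then c else h v
      have hx : Set.EqOn h h₀ ρ.frontier := fun v hv => (if_neg fun hz => hz.1 hv.1).symm
      have hb₀ : 𝒮.ChoiceBodyIn M ρ h₀ := by
        refine ⟨fun a ha => ?_, fun z hz => ?_⟩
        · have : a.inst h₀ = a.inst h := Atom.inst_congr fun v hv => if_neg fun hz => hz.1 ⟨a, ha, hv⟩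
          rw [this]
          exact hb a ha
        · rw [show h₀ z = c from if_pos hz]
          exact hR.domFact_mem hstep hcS
      by_cases hd : 𝒮.diffFact ρ h₀ ∈ M
      · obtain ⟨h', hx', hh'⟩ := (hinv hd).diff_inv hρ
        exact ⟨h', hx.trans hx', hh'⟩
      · exact ⟨h₀, hx, hstep _ (.chosen hρ hb₀ hd)⟩
    refine chosenFact_congr hx (fun z hz => ?_) ▸ hh'
    have e1 := hc ⟨z, hz⟩
    have e2 := hcoh ρ hρ h' hh' ⟨z, hz⟩
    have e3 : (fun y : ρ.frontier => h y) = fun y : ρ.frontier => h' y :=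
      funext fun y => hx y.2
    rw [e3] at e1
    exact e1.trans e2.symm
  have hbase : ∀ J' ⊆ part M 𝒮.target, ∀ a : Atom Rel Val, a ∈ I.toInstance ∪ J' → a.lift ∈ M := by
    intro J' hJ' a ha
    rcases Finset.mem_union.1 ha with h | h
    · obtain ⟨b, hb, rfl⟩ := Finset.mem_image.1 h
      exact hstep _ (.ed (hR.subset hb))
    · exact (mem_part.1 (hJ' h)).1
  refine ⟨⟨fun a ha => (mem_part.1 ha).2, γ, (satUnder_iff hR.isSource).2 ⟨?_, ?_⟩, ?_⟩, ?_⟩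
  · intro ρ hρ h hc hb a ha
    have hbM : BodyIn M ρ h := fun b hb' => hbase _ subset_rfl _ (hb b hb')
    have hch := hchosen ρ hρ h hc hbM
    obtain ⟨-, h', -, hz, hb'⟩ := (hinv hch).chosen_inv hρ
    -- The `Dom` facts come from the valuation `h'` that derived the `Chosen` fact and agrees with
    -- `h` on the existential variables.
    have hax := hstep _ (.aux hρ ⟨hbM, fun z hz' => by rw [hz hz']; exact hb'.2 z hz'⟩ hch)
    exact mem_part.2 ⟨hstep _ (.head hρ hbM hax ha), head_target hρ a ha⟩
  · intro η hη s hs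
    have hconst : ∀ v, (∃ a ∈ η.body, a.HasVar v) → ∃ c, s v = .const c := by
      rintro v ⟨a, ha, i, hi⟩
      obtain ⟨c, -, e⟩ := hU _ (mem_part.1 (hs a ha)).1 i
      have e' : (a.args i).eval s = .const c := e
      rw [hi] at e'
      exact ⟨c, e'⟩
    -- EGDs are tested on arbitrary values while rules use constants. No nulls occur in `M`, so the
    -- default is not used on body variables.
    let h : Var → Const := fun v => match s v with | .const c => c | .null _ => []
    have hh : ∀ v, (∃ a ∈ η.body, a.HasVar v) → s v = .const (h v) := by
      intro v hv
      obtain ⟨c, hc⟩ := hconst v hv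
      simp only [h, hc]
    rw [hh _ η.x_mem, hh _ η.y_mem]
    refine congrArg _ (hegd η hη h fun a ha => ?_)
    have e : a.inst h = a.map (Term.eval s) := by
      refine Atom.map_congr (a := a) fun i => ?_
      cases hi : a.args i with
      | const c => rfl
      | var v => exact (hh v ⟨a, ha, i, hi⟩).symm
    rw [e]
    exact (mem_part.1 (hs a ha)).1
  · intro J' _ hss hsat
    rw [satUnder_iff hR.isSource] at hsat
    -- Only the target facts outside `J'` are removed and all bookkeeping is kept. A target fact
    -- derived from `M'` rests on a recorded and hence coherent choice, so it belongs to `J'`.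
    set M' := M.filter fun f => ∀ a : Atom Rel Val, f = a.lift → a.rel ∈ 𝒮.target → a ∈ J'
    have hsub : M' ⊆ M := Finset.filter_subset _ _
    refine hmin M' (Finset.ssubset_iff_subset_ne.2 ⟨hsub, fun e => ?_⟩)
      (closedUnder_iff.2 ⟨fun f hf => ?_, fun η hη h hb => hegd η hη h fun a ha => hsub (hb a ha)⟩)
    · obtain ⟨a, ha, ha'⟩ := Finset.exists_of_ssubset hss
      have ha2 := mem_part.1 ha
      rw [← e] at ha2
      exact ha' ((Finset.mem_filter.1 ha2.1).2 a rfl ha2.2)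
    · refine Finset.mem_filter.2 ⟨hstep _ (hf.mono hsub), ?_⟩
      rintro a rfl haT
      obtain ⟨ρ, hρ, h, b, hb, hbody, hax, rfl⟩ := hf.target_inv hR haT
      have hch := (hinv (hsub hax)).aux_inv hR hρ
      refine hsat.1 ρ hρ h (hcoh ρ hρ h hch) (fun b' hb' => ?_) b hb
      have hm := Finset.mem_filter.1 (hbody b' hb')
      rcases body_rel hρ hb' with h1 | h1
      · exact Finset.mem_union_left _ ((hinv hm.1).source_inv hR h1)
      · exact Finset.mem_union_right _ (hm.2 _ rfl h1)
  · rintro x ⟨a, ha, i, rfl⟩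
    obtain ⟨c, hc, e⟩ := hU _ (mem_part.1 ha).1 i
    exact ⟨c, hR.herbrandUniverse_subset hc, e.symm⟩

end Setting


/-! ### From supported solutions to stable models -/

theorem finite_setOf_atom {R : Type} [Vocabulary R] {τ : Type} {F : Set R} (hF : F.Finite)
    {V : Set τ} (hV : V.Finite) : {f : Atom R τ | f.rel ∈ F ∧ ∀ i, f.args i ∈ V}.Finite := by
  have : {f : Atom R τ | f.rel ∈ F ∧ ∀ i, f.args i ∈ V} ⊆
      ⋃ r ∈ F, Atom.mk r '' {u | ∀ i, u i ∈ V} := by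
    rintro ⟨r, u⟩ ⟨h1, h2⟩
    exact Set.mem_biUnion h1 ⟨u, h2, rfl⟩
  exact (hF.biUnion fun r _ => (Set.Finite.pi' fun _ => hV).image _).subset this

namespace Setting

variable (𝒮 : Setting)

/-- The body of the choice rule of `ρ` holds in `I ∪ J`, the constants in `S` being available. -/
def Enabled (I : Database) (J : Instance) (S : Set Const) (ρ : TGD) (h : Var → Const) : Prop :=
  (∀ a ∈ ρ.body, a.inst h ∈ I.toInstance ∪ J) ∧ ∀ z ∈ ρ.exvar, h z ∈ S

/-- The facts of the stable model that corresponds to a supported solution `J` under the ex-choice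
`γ`. -/
inductive Model (I ED : Database) (J : Instance) (S : Set Const) (γ : ExChoice) :
    Atom XRel Val → Prop
  | ed {a : Atom Rel Const} : a ∈ ED → Model I ED J S γ (a.map Val.const).lift
  | dom {c : Const} : c ∈ S → Model I ED J S γ (𝒮.domFact c).lift
  | sol {a : Atom Rel Val} : a ∈ J → Model I ED J S γ a.lift
  | range {ρ : TGD} {h : Var → Const} : ρ ∈ 𝒮.tgds → Enabled I J S ρ h →
      Model I ED J S γ (𝒮.rangeFact ρ h)
  | aux {ρ : TGD} {h : Var → Const} : ρ ∈ 𝒮.tgds → Enabled I J S ρ h → ρ.Coherent γ h →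
      Model I ED J S γ (𝒮.auxFact ρ h)
  | chosen {ρ : TGD} {h : Var → Const} : ρ ∈ 𝒮.tgds → Enabled I J S ρ h → ρ.Coherent γ h →
      Model I ED J S γ (𝒮.chosenFact ρ h)
  | diff {ρ : TGD} {h h' h'' : Var → Const} : ρ ∈ 𝒮.tgds → Set.EqOn h h' ρ.frontier →
      Enabled I J S ρ h' → ρ.Coherent γ h' → Set.EqOn h h'' ρ.exvar → Enabled I J S ρ h'' →
      ¬ Set.EqOn h h' ρ.exvar → Model I ED J S γ (𝒮.diffFact ρ h)

variable {𝒮} {I ED : Database} {J : Instance} {S : Set Const} {γ : ExChoice} {ρ : TGD}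
  {h h' : Var → Const}

theorem coherent_congr (hx : Set.EqOn h h' ρ.frontier) (hz : Set.EqOn h h' ρ.exvar)
    (H : ρ.Coherent γ h') : ρ.Coherent γ h := by
  intro z
  have e3 : (fun y : ρ.frontier => h y) = fun y : ρ.frontier => h' y := funext fun y => hx y.2
  rw [e3, hz z.2]
  exact H z

/-- An ex-choice is a function of the frontier tuple. -/
theorem eqOn_of_coherent (hx : Set.EqOn h h' ρ.frontier) (H : ρ.Coherent γ h)
    (H' : ρ.Coherent γ h') : Set.EqOn h h' ρ.exvar := by
  intro z hz
  have e3 : (fun y : ρ.frontier => h y) = fun y : ρ.frontier => h' y := funext fun y => hx y.2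
  have e1 := H ⟨z, hz⟩
  rw [e3] at e1
  exact e1.trans (H' ⟨z, hz⟩).symm

theorem Model.chosen_inv (hρ : ρ ∈ 𝒮.tgds) (H : 𝒮.Model I ED J S γ (𝒮.chosenFact ρ h)) :
    ∃ h', Set.EqOn h h' ρ.frontier ∧ Set.EqOn h h' ρ.exvar ∧ Enabled I J S ρ h' ∧
      ρ.Coherent γ h' := by
  generalize e : 𝒮.chosenFact ρ h = f at H
  cases H with
  | chosen _ h2 h3 =>
    obtain ⟨rfl, hx, hz⟩ := chosenFact_inj hρ e
    exact ⟨_, hx, hz, h2, h3⟩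
  | _ => exact XRel.noConfusion (congrArg Atom.rel e)

theorem Model.range_inv (hρ : ρ ∈ 𝒮.tgds) (H : 𝒮.Model I ED J S γ (𝒮.rangeFact ρ h)) :
    ∃ h', Set.EqOn h h' ρ.exvar ∧ Enabled I J S ρ h' := by
  generalize e : 𝒮.rangeFact ρ h = f at H
  cases H with
  | range _ h2 =>
    obtain ⟨rfl, hz⟩ := rangeFact_inj hρ e
    exact ⟨_, hz, h2⟩
  | _ => exact XRel.noConfusion (congrArg Atom.rel e)

/-- What is marked as different disagrees with the unique coherent choice for its frontier tuple.
This keeps the choices of `γ` derivable in the reduct. -/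
theorem Model.diff_inv (hρ : ρ ∈ 𝒮.tgds) (H : 𝒮.Model I ED J S γ (𝒮.diffFact ρ h)) :
    ¬ ρ.Coherent γ h := by
  generalize e : 𝒮.diffFact ρ h = f at H
  cases H with
  | diff _ h2 _ h4 _ _ h7 =>
    obtain ⟨rfl, hx, hz⟩ := diffFact_inj hρ e
    exact fun hc => h7 (hz.symm.trans (eqOn_of_coherent (hx.trans h2) hc h4))
  | _ => exact XRel.noConfusion (congrArg Atom.rel e)

theorem Model.aux_inv (hR : 𝒮.Represents I S ED) (hJ : J.IsOver 𝒮.target) (hρ : ρ ∈ 𝒮.tgds)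
    (H : 𝒮.Model I ED J S γ (𝒮.auxFact ρ h)) : ρ.Coherent γ h := by
  generalize e : 𝒮.auxFact ρ h = f at H
  have hrel : ∀ {b : Atom Rel Val}, 𝒮.auxFact ρ h = b.lift → (𝒮.auxAtom ρ).rel = b.rel :=
    fun {b} e => congrArg Atom.rel
      (Atom.lift_injective (show ((𝒮.auxAtom ρ).inst h).lift = _ from e))
  cases H with
  | ed h1 =>
    rcases hR.rel_of_ed h1 e with h2 | ⟨c, -, h2⟩
    · obtain ⟨b, hb, e'⟩ := Finset.mem_image.1 h2
      have h3 : b.rel = (𝒮.auxAtom ρ).rel := congrArg Atom.rel e'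
      exact absurd (Finset.mem_union_left _ (h3 ▸ hR.isSource b hb)) (auxAtom_rel_notMem ρ)
    · exact absurd (congrArg Atom.rel h2) (auxAtom_rel_ne_dom ρ c)
  | dom => exact absurd (hrel e) (auxAtom_rel_ne_dom ρ _)
  | sol h1 => exact absurd (Finset.mem_union_right _ (hrel e ▸ hJ _ h1)) (auxAtom_rel_notMem ρ)
  | aux _ h2 h3 =>
    obtain ⟨rfl, hx, hz⟩ := auxFact_inj hρ e
    exact coherent_congr hx hz h3
  | _ => exact XRel.noConfusion (congrArg Atom.rel e)

/-- The bookkeeping adds nothing over the two schemas, so bodies of dependencies mean the same in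
the model and in `I ∪ J`. -/
theorem Model.base_inv (hR : 𝒮.Represents I S ED) {a : Atom Rel Val}
    (ha : a.rel ∈ 𝒮.source ∨ a.rel ∈ 𝒮.target)
    (H : 𝒮.Model I ED J S γ a.lift) : a ∈ I.toInstance ∪ J := by
  generalize e : a.lift = f at H
  cases H with
  | ed h1 =>
    rcases hR.rel_of_ed h1 e with h2 | ⟨c, -, rfl⟩
    · exact Finset.mem_union_left _ h2
    · exact absurd (Finset.mem_union.2 ha) (domFact_rel_notMem c)
  | dom =>
    obtain rfl := Atom.lift_injective e
    exact absurd (Finset.mem_union.2 ha) (domFact_rel_notMem _)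
  | sol h1 => exact Finset.mem_union_right _ (Atom.lift_injective e ▸ h1)
  | aux =>
    obtain rfl := Atom.lift_injective e
    exact absurd (Finset.mem_union.2 ha) (auxAtom_rel_notMem _)
  | _ => exact XRel.noConfusion (congrArg Atom.rel e)

theorem Model.dom_inv (hR : 𝒮.Represents I S ED) (hJ : J.IsOver 𝒮.target) {c : Const}
    (H : 𝒮.Model I ED J S γ (𝒮.domFact c).lift) : c ∈ S := by
  have hinj : ∀ {d}, 𝒮.domFact c = 𝒮.domFact d → c = d := fun e =>
    Val.const.inj (congrFun (Atom.mk_inj e) (0 : Fin 1))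
  generalize e : (𝒮.domFact c).lift = f at H
  cases H with
  | ed h1 =>
    rcases hR.rel_of_ed h1 e with h2 | ⟨d, hd, h2⟩
    · obtain ⟨b, hb, e'⟩ := Finset.mem_image.1 h2
      have h3 : (b.map Val.const).rel ∈ 𝒮.source := hR.isSource b hb
      exact absurd (Finset.mem_union_left _ (e' ▸ h3)) (domFact_rel_notMem c)
    · exact hinj h2 ▸ hd
  | dom hd => exact hinj (Atom.lift_injective e) ▸ hd
  | sol h1 =>
    obtain rfl := Atom.lift_injective e
    exact absurd (Finset.mem_union_right _ (hJ _ h1)) (domFact_rel_notMem c)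
  | @aux ρ h =>
    exact absurd (congrArg Atom.rel (Atom.lift_injective
      (show _ = ((𝒮.auxAtom ρ).inst h).lift from e))).symm (auxAtom_rel_ne_dom ρ c)
  | _ => exact XRel.noConfusion (congrArg Atom.rel e)

/-- The constants of enabled ground versions. -/
theorem Enabled.mem (hR : 𝒮.Represents I S ED) (hJS : J.adom ⊆ Val.const '' S)
    (H : Enabled I J S ρ h) {v : Var} (hv : v ∈ ρ.frontier ∨ v ∈ ρ.exvar) : h v ∈ S := by
  rcases hv with hv | hv
  · obtain ⟨⟨a, ha, i, hi⟩, -⟩ := hv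
    have e : (a.inst h).args i = Val.const (h v) := by
      change Val.const ((a.args i).ground h) = _
      rw [hi]
      rfl
    rcases Finset.mem_union.1 (H.1 a ha) with h1 | h1
    · obtain ⟨b, hb, e'⟩ := Finset.mem_image.1 h1
      obtain ⟨j, hj⟩ : ∃ j, (b.map Val.const).args j = Val.const (h v) := by
        rw [e']
        exact ⟨i, e⟩
      exact hR.consts_subset (Or.inr ⟨b, hb, j, Val.const.inj hj⟩)
    · obtain ⟨c, hc, e'⟩ := hJS ⟨_, h1, i, rfl⟩
      rw [e] at e'
      exact Val.const.inj e' ▸ hc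
  · exact H.2 v hv

theorem ground_append_mem {V : Set Const} {r : ChoiceRule}
    (H : ∀ v, v ∈ r.X ∨ v ∈ r.Y → h v ∈ V) (i : Fin (r.X.length + r.Y.length)) :
    (Fin.append r.x r.y i).ground h ∈ V := by
  refine Fin.addCases (fun i => ?_) (fun i => ?_) i
  · rw [Fin.append_left]
    exact H _ (Or.inl (List.get_mem _ _))
  · rw [Fin.append_right]
    exact H _ (Or.inr (List.get_mem _ _))

theorem Model.args_mem (hR : 𝒮.Represents I S ED) (hJS : J.adom ⊆ Val.const '' S)
    {f : Atom XRel Val} (H : 𝒮.Model I ED J S γ f) (i) : f.args i ∈ Val.const '' S := by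
  have hmem : ∀ {ρ : TGD} {h : Var → Const}, Enabled I J S ρ h → ∀ v,
      v ∈ (𝒮.choiceRule ρ).X ∨ v ∈ (𝒮.choiceRule ρ).Y → h v ∈ S := fun he v hv =>
    he.mem hR hJS (hv.imp TGD.mem_frontierList.1 TGD.mem_exvarList.1)
  cases H with
  | @ed a ha =>
    rcases hR.mem a ha with h1 | ⟨c, hc, rfl⟩
    · exact ⟨_, hR.consts_subset (Or.inr ⟨a, h1, i, rfl⟩), rfl⟩
    · exact ⟨c, hc, rfl⟩
  | dom hc => exact ⟨_, hc, rfl⟩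
  | sol ha => exact hJS ⟨_, ha, i, rfl⟩
  | @range ρ h hρ he =>
    exact ⟨_, he.mem hR hJS (Or.inr (TGD.mem_exvarList.1 (List.get_mem _ i))), rfl⟩
  | @aux ρ h hρ he =>
    exact ⟨_, he.mem hR hJS ((List.mem_append.1 (List.get_mem (ρ.frontierList ++ ρ.exvarList) i)).imp
      TGD.mem_frontierList.1 TGD.mem_exvarList.1), rfl⟩
  | @chosen ρ h hρ he => exact ⟨_, ground_append_mem (hmem he) i, rfl⟩
  | @diff ρ h h' h'' hρ hx he _ hz he' =>
    refine ⟨_, ground_append_mem (r := 𝒮.choiceRule ρ) (h := h) (fun v hv => ?_) i, rfl⟩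
    rcases hv with hv | hv
    · rw [hx (TGD.mem_frontierList.1 hv)]
      exact hmem he v (Or.inl hv)
    · rw [hz (TGD.mem_exvarList.1 hv)]
      exact hmem he' v (Or.inr hv)

/-- Stable models are finite sets here. The arguments come from the finite set `S`, and only
finitely many relation symbols occur. -/
theorem Model.finite (hR : 𝒮.Represents I S ED) (hS : S.Finite) (hJS : J.adom ⊆ Val.const '' S) :
    {f | 𝒮.Model I ED J S γ f}.Finite := by
  let F : Set XRel := (fun a : Atom Rel Const => XRel.base a.rel) '' ED ∪
    {XRel.base ⟨𝒮.domName, 1⟩} ∪ (fun a : Atom Rel Val => XRel.base a.rel) '' J ∪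
    (fun ρ => XRel.range (𝒮.choiceRule ρ)) '' 𝒮.tgds ∪
    (fun ρ => XRel.base (𝒮.auxAtom ρ).rel) '' 𝒮.tgds ∪
    (fun ρ => XRel.chosen (𝒮.choiceRule ρ)) '' 𝒮.tgds ∪
    (fun ρ => XRel.diffChoice (𝒮.choiceRule ρ)) '' 𝒮.tgds
  have hF : F.Finite := by
    refine (((((Set.Finite.union ?_ ?_).union ?_).union ?_).union ?_).union ?_).union ?_
    · exact (Finset.finite_toSet _).image _
    · exact Set.finite_singleton _
    all_goals exact (Finset.finite_toSet _).image _
  refine (finite_setOf_atom hF (hS.image Val.const)).subset fun f hf => ⟨?_, hf.args_mem hR hJS⟩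
  cases hf with
  | ed h => exact Or.inl (Or.inl (Or.inl (Or.inl (Or.inl (Or.inl ⟨_, h, rfl⟩)))))
  | dom h => exact Or.inl (Or.inl (Or.inl (Or.inl (Or.inl (Or.inr rfl)))))
  | sol h => exact Or.inl (Or.inl (Or.inl (Or.inl (Or.inr ⟨_, h, rfl⟩))))
  | range h => exact Or.inl (Or.inl (Or.inl (Or.inr ⟨_, h, rfl⟩)))
  | aux h => exact Or.inl (Or.inl (Or.inr ⟨_, h, rfl⟩))
  | chosen h => exact Or.inl (Or.inr ⟨_, h, rfl⟩)
  | diff h => exact Or.inr ⟨_, h, rfl⟩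

/-- The witness consists of `ED`, `Dom`, `J` and the bookkeeping prescribed by `γ`. For stability, a
closed subset is forced to make the choices of `γ`, then to contain `J` by minimality of `J`, and
then everything else. -/
theorem exists_stableModel (hR : 𝒮.Represents I S ED) (hS : S.Finite) (hJ : J ∈ 𝒮.ssolOver I S) :
    ∃ M ∈ 𝒮.program.stableModels ED, part M 𝒮.target = J := by
  classical
  obtain ⟨⟨hover, γ, hsat, hmin⟩, hJS⟩ := hJ
  have hfin := Model.finite (γ := γ) hR hS hJS
  set M := hfin.toFinset
  have hM : ∀ {f}, f ∈ M ↔ 𝒮.Model I ED J S γ f := hfin.mem_toFinset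
  obtain ⟨hsat1, hsat2⟩ := (satUnder_iff hR.isSource).1 hsat
  have hbody : ∀ {ρ h}, ρ ∈ 𝒮.tgds → BodyIn M ρ h → ∀ a ∈ ρ.body, a.inst h ∈ I.toInstance ∪ J :=
    fun hρ hb a ha => (hM.1 (hb a ha)).base_inv hR (body_rel hρ ha)
  have hen : ∀ {ρ h}, ρ ∈ 𝒮.tgds → 𝒮.ChoiceBodyIn M ρ h → Enabled I J S ρ h :=
    fun hρ hb => ⟨hbody hρ hb.1, fun z hz => (hM.1 (hb.2 z hz)).dom_inv hR hover⟩
  -- An existential variable occurs in the head, whose ground version lies in `J` once the body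
  -- holds. So the value prescribed by `γ` is a constant in `S`.
  have hexS : ∀ ρ ∈ 𝒮.tgds, ∀ h, ρ.Coherent γ h →
      (∀ a ∈ ρ.body, a.inst h ∈ I.toInstance ∪ J) → Enabled I J S ρ h := by
    refine fun ρ hρ h hc hb => ⟨hb, fun z hz => ?_⟩
    obtain ⟨a, ha, i, hi⟩ := hz.2
    obtain ⟨c, hcS, e⟩ := hJS ⟨_, hsat1 ρ hρ h hc hb a ha, i, rfl⟩
    have e' : Val.const c = Val.const ((a.args i).ground h) := e
    rw [hi] at e'
    have e2 : c = h z := Val.const.inj e'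
    exact e2 ▸ hcS
  have hegd : ∀ η ∈ 𝒮.tEGDs, ∀ h : Var → Const, (∀ a ∈ η.body, (a.inst h).lift ∈ M) →
      h η.x = h η.y := by
    intro η hη h hb
    refine Val.const.inj (hsat2 η hη (fun v => .const (h v)) fun a ha => ?_)
    have e : a.map (Term.eval fun v => .const (h v)) = a.inst h := by
      refine Atom.map_congr (a := a) fun i => ?_
      cases a.args i <;> rfl
    rw [e]
    have haT := 𝒮.t_egd η hη a ha
    rcases Finset.mem_union.1 ((hM.1 (hb a ha)).base_inv hR (Or.inr haT)) with h1 | h1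
    · exact absurd haT (IsSource.not_target hR.isSource h1)
    · exact h1
  have hcl : ClosedUnder (𝒮.program.withED ED) M M := by
    refine closedUnder_iff.2 ⟨fun f hf => hM.2 ?_, hegd⟩
    cases hf with
    | ed h => exact .ed h
    | @dom R i h hRs hN =>
      refine .dom ?_
      rcases Finset.mem_union.1 ((hM.1 hN).base_inv hR (Or.inl hRs)) with h1 | h1
      · obtain ⟨b, hb, e⟩ := Finset.mem_image.1 h1
        obtain ⟨j, hj⟩ : ∃ j, (b.map Val.const).args j = Val.const (h i) := by
          rw [e]
          exact ⟨i, rfl⟩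
        exact hR.consts_subset (Or.inr ⟨b, hb, j, Val.const.inj hj⟩)
      · exact absurd (hover _ h1) (Finset.disjoint_left.1 𝒮.disjoint hRs)
    | head h1 h2 h3 h4 =>
      exact .sol (hsat1 _ h1 _ ((hM.1 h3).aux_inv hR hover h1) (hbody h1 h2) _ h4)
    | range h1 h2 => exact .range h1 (hen h1 h2)
    | aux h1 h2 h3 =>
      obtain ⟨h', hx, hz, -, hc⟩ := (hM.1 h3).chosen_inv h1
      exact .aux h1 (hen h1 h2) (coherent_congr hx hz hc)
    | @chosen ρ h h1 h2 h3 =>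
      refine .chosen h1 (hen h1 h2) ?_
      -- If `h` were not coherent, correcting it on the existential variables would give an enabled
      -- coherent `h'` that differs from it, and `h` would be marked as different, against `h3`.
      by_contra hc
      let h' : Var → Const := fun v =>
        if hv : v ∈ ρ.exvar then γ ρ (fun y => h y) ⟨v, hv⟩ else h v
      have hh' : ∀ v, v ∉ ρ.exvar → h' v = h v := fun v hv => dif_neg hv
      have hx : Set.EqOn h h' ρ.frontier := fun v hv => (hh' v fun hz => hz.1 hv.1).symm
      have hc' : ρ.Coherent γ h' := by
        intro z
        have e3 : (fun y : ρ.frontier => h' y) = fun y : ρ.frontier => h y :=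
          funext fun y => (hx y.2).symm
        rw [e3]
        exact dif_pos z.2
      have hb' : ∀ a ∈ ρ.body, a.inst h' ∈ I.toInstance ∪ J := by
        intro a ha
        have : a.inst h' = a.inst h :=
          Atom.inst_congr fun v hv => hh' v fun hz => hz.1 ⟨a, ha, hv⟩
        rw [this]
        exact hbody h1 h2.1 a ha
      exact h3 (hM.2 (.diff h1 hx (hexS ρ h1 h' hc' hb') hc' (Set.eqOn_refl _ _) (hen h1 h2)
        fun hz => hc (coherent_congr hx hz hc')))
    | diff h1 h2 h3 h4 h5 =>
      obtain ⟨g, hx, hz, he, hc⟩ := (hM.1 h3).chosen_inv h1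
      obtain ⟨g', hz', he'⟩ := (hM.1 h4).range_inv h1
      exact .diff h1 (h2.trans hx) he hc hz' he' fun hz2 => h5 (hz2.trans hz.symm)
  refine ⟨M, (isStable_iff fun r hr => withED_atomSafe hr).2 ⟨fun f hf i => ?_, hcl,
    fun M' hss hM' => ?_⟩, ?_⟩
  · obtain ⟨c, hc, e⟩ := (hM.1 hf).args_mem hR hJS i
    exact ⟨c, hR.subset_herbrandUniverse hc, e.symm⟩
  · have hstep := (closedUnder_iff.1 hM').1
    -- Negation is evaluated in the full set `M`, which marks no coherent choice as different.
    have hchosen : ∀ ρ ∈ 𝒮.tgds, ∀ h, ρ.Coherent γ h → 𝒮.ChoiceBodyIn M' ρ h →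
        𝒮.chosenFact ρ h ∈ M' := fun ρ hρ h hc hb =>
      hstep _ (.chosen hρ hb fun hd => (hM.1 hd).diff_inv hρ hc)
    have hIM : ∀ a ∈ I.toInstance, a.lift ∈ M' := by
      intro a ha
      obtain ⟨b, hb, rfl⟩ := Finset.mem_image.1 ha
      exact hstep _ (.ed (hR.subset hb))
    -- Induction along the chase replays inside `M'` the choice, the auxiliary fact and the head
    -- rule for each coherent ground version.
    have hJM : ∀ a ∈ J, a.lift ∈ M' := by
      refine forall_mem_of_closed hR.isSource hover hsat hmin _ fun ρ hρ h hc hb a ha => ?_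
      have hb1 : BodyIn M' ρ h := fun b hb' => (hb b hb').elim (hIM _) fun h => h.2
      have hb2 : ∀ b ∈ ρ.body, b.inst h ∈ I.toInstance ∪ J := fun b hb' =>
        Finset.mem_union.2 ((hb b hb').imp id fun h => h.1)
      have hb3 : 𝒮.ChoiceBodyIn M' ρ h :=
        ⟨hb1, fun z hz => hR.domFact_mem hstep ((hexS ρ hρ h hc hb2).2 z hz)⟩
      exact hstep _ (.head hρ hb1 (hstep _ (.aux hρ hb3 (hchosen ρ hρ h hc hb3))) ha)
    have hb : ∀ {ρ h}, Enabled I J S ρ h → 𝒮.ChoiceBodyIn M' ρ h := fun he =>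
      ⟨fun b hb => (Finset.mem_union.1 (he.1 b hb)).elim (hIM _) (hJM _),
        fun z hz => hR.domFact_mem hstep (he.2 z hz)⟩
    refine hss.2 fun f hf => ?_
    cases hM.1 hf with
    | ed h => exact hstep _ (.ed h)
    | dom h => exact hR.domFact_mem hstep h
    | sol h => exact hJM _ h
    | range h1 h2 => exact hstep _ (.range h1 (hb h2))
    | aux h1 h2 h3 => exact hstep _ (.aux h1 (hb h2) (hchosen _ h1 _ h3 (hb h2)))
    | chosen h1 h2 h3 => exact hchosen _ h1 _ h3 (hb h2)
    | diff h1 h2 h3 h4 h5 h6 h7 =>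
      exact hstep _ (.diff h1 h2 (hchosen _ h1 _ h4 (hb h3))
        (rangeFact_congr h5 ▸ hstep _ (.range h1 (hb h6))) h7)
  · ext a
    rw [mem_part, hM]
    refine ⟨fun ⟨h1, h2⟩ => ?_, fun h => ⟨.sol h, hover a h⟩⟩
    exact (Finset.mem_union.1 (h1.base_inv hR (Or.inr h2))).resolve_left fun h =>
      IsSource.not_target hR.isSource h h2

/-- The stable models over a representation of `I` correspond to the supported solutions over the
available constants. -/
theorem image_part_stableModels (hR : 𝒮.Represents I S ED) (hS : S.Finite) :
    (fun M => part M 𝒮.target) '' 𝒮.program.stableModels ED = 𝒮.ssolOver I S := by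
  ext J
  constructor
  · rintro ⟨M, hM, rfl⟩
    exact part_mem_ssolOver hR hM
  · exact exists_stableModel hR hS

end Setting


/-! ### The database of the reduction and the main theorem -/

theorem Database.finite_consts (I : Database) : I.consts.Finite := by
  have : I.consts ⊆ ⋃ a ∈ I, Set.range a.args := fun c ⟨a, ha, i, hi⟩ =>
    Set.mem_biUnion ha ⟨i, hi⟩
  exact (I.finite_toSet.biUnion fun a _ => Set.finite_range a.args).subset this

section

variable {𝒮 : Setting} {Q : Query} {fixed : List Const} {k : ℕ}

/-- Freshness is a matter of length: constants of the setting and the query are shorter than `k`,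
those of `I` shorter than its encoding, and the new ones at least as long as the sum of the two. -/
theorem isFreshSet_freshConsts (hf : ∀ c, c ∈ fixed ↔ c ∈ 𝒮.consts ∪ Q.formula.consts)
    (hk : ∀ c ∈ fixed, c.length < k) (d : ℕ) (I : Database) :
    IsFreshSet 𝒮 Q I ((I.card + 2) ^ d) (freshConsts k d I).toFinset := by
  refine ⟨?_, fun c hc ho => ?_⟩
  · exact (List.toFinset_card_of_nodup (freshFrom_nodup _ _)).trans (length_freshFrom _ _)
  · have hl := length_of_mem_freshFrom (List.mem_toFinset.1 hc)
    rcases ho with (h | h) | h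
    · have := hk c ((hf c).2 (Or.inl h))
      omega
    · have := length_le_encodedSize h
      omega
    · have := hk c ((hf c).2 (Or.inr h))
      omega

theorem represents_extendDatabase (hf : ∀ c, c ∈ fixed ↔ c ∈ 𝒮.consts ∪ Q.formula.consts)
    {I : Database} (hI : 𝒮.IsSource I) (d : ℕ) :
    𝒮.Represents I (occurringConsts 𝒮 Q I ∪ ((freshConsts k d I).toFinset : Set Const))
      (extendDatabase 𝒮.domName fixed k d I) where
  isSource := hI
  nonempty := by
    have hpos : 0 < (freshConsts k d I).length := by
      rw [freshConsts, length_freshFrom]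
      positivity
    exact ⟨_, Or.inr (List.mem_toFinset.2 (List.getElem_mem hpos))⟩
  mem a ha := by
    rcases Finset.mem_union.1 ha with h | h
    · exact Or.inl h
    · obtain ⟨c, hc, rfl⟩ := List.mem_map.1 (List.mem_toFinset.1 h)
      refine Or.inr ⟨c, ?_, rfl⟩
      rcases List.mem_append.1 hc with h | h
      · exact Or.inl (((hf c).1 h).imp Or.inl id)
      · exact Or.inr (List.mem_toFinset.2 h)
  subset := Finset.subset_union_left
  dom c hc := by
    have hmem : c ∈ fixed ++ freshConsts k d I →
        unaryFact 𝒮.domName c ∈ extendDatabase 𝒮.domName fixed k d I := fun h =>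
      Finset.mem_union_right _ (List.mem_toFinset.2 (List.mem_map_of_mem h))
    rcases hc with ((h | h) | h) | h
    · exact Or.inr (hmem (List.mem_append_left _ ((hf c).2 (Or.inl h))))
    · exact Or.inl h
    · exact Or.inr (hmem (List.mem_append_left _ ((hf c).2 (Or.inr h))))
    · exact Or.inr (hmem (List.mem_append_right _ (List.mem_toFinset.1 h)))
  consts_subset := fun _ h => Or.inl (Or.inl h)

theorem finite_occurringConsts (𝒮 : Setting) (Q : Query) (I : Database) :
    (occurringConsts 𝒮 Q I).Finite :=
  (𝒮.finite_consts.union I.finite_consts).union Q.formula.finite_consts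

end

end DataExchange

theorem mainTheorem8 (𝒮 : Setting) (h𝒮 : 𝒮.WeaklyAcyclic) :
    ∃ (P : Program) (pol : Polynomial ℕ), ∀ Q : Query, Q.formula.IsOver 𝒮.target →
      (∀ (I : Database) (C : Finset Const), 𝒮.IsSource I →
        IsFreshSet 𝒮 Q I (pol.eval I.card) C →
        𝒮.scert Q I =
          ⋂ J ∈ 𝒮.ssolOver I (occurringConsts 𝒮 Q I ∪ (C : Set Const)), Q.output J) ∧
      ∃ (fresh : Database → Finset Const) (ED : Database → Database),
        PolyTimeReduction 𝒮.IsSource (SCERT 𝒮 Q) (CANS P 𝒮.target Q)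
          (fun x => (ED x.1, x.2)) ∧
        ∀ I : Database, 𝒮.IsSource I →
          IsFreshSet 𝒮 Q I (pol.eval I.card) (fresh I) ∧
          (fun M => part M 𝒮.target) '' P.stableModels (ED I) =
            𝒮.ssolOver I (occurringConsts 𝒮 Q I ∪ (fresh I : Set Const)) ∧
          P.cautious 𝒮.target Q (ED I) = 𝒮.scert Q I := by
  obtain ⟨d, hd⟩ := h𝒮.exists_bound
  -- The exponent comes from the bound on supported solutions and is independent of the query. Only
  -- the database of the reduction depends on `Q`, through the constants in `fixed`.
  refine ⟨𝒮.program, (Polynomial.X + 2) ^ d, fun Q _ => ?_⟩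
  have hpol : ∀ n : ℕ, ((Polynomial.X + 2 : Polynomial ℕ) ^ d).eval n = (n + 2) ^ d := by
    intro n
    simp
  simp only [hpol]
  have hscert := fun (I : Database) (C : Finset Const) (hI : 𝒮.IsSource I)
    (hC : IsFreshSet 𝒮 Q I ((I.card + 2) ^ d) C) => Setting.scert_eq_of_bound hI (hd I hI) hC
  set fixed := (𝒮.finite_consts.union Q.formula.finite_consts).toFinset.toList
  have hf : ∀ c, c ∈ fixed ↔ c ∈ 𝒮.consts ∪ Q.formula.consts := fun c =>
    Finset.mem_toList.trans (Set.Finite.mem_toFinset _)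
  obtain ⟨k, hk⟩ : ∃ k, ∀ c ∈ fixed, c.length < k :=
    ⟨(fixed.map List.length).sum + 1, fun c hc =>
      Nat.lt_succ_of_le (List.le_sum_of_mem (List.mem_map_of_mem hc))⟩
  have himage : ∀ I, 𝒮.IsSource I →
      (fun M => part M 𝒮.target) ''
        𝒮.program.stableModels (extendDatabase 𝒮.domName fixed k d I) =
      𝒮.ssolOver I (occurringConsts 𝒮 Q I ∪ ((freshConsts k d I).toFinset : Set Const)) :=
    fun I hI => Setting.image_part_stableModels (represents_extendDatabase hf hI d)
      ((finite_occurringConsts 𝒮 Q I).union (Finset.finite_toSet _))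
  have hcautious : ∀ I, 𝒮.IsSource I →
      𝒮.program.cautious 𝒮.target Q (extendDatabase 𝒮.domName fixed k d I) = 𝒮.scert Q I := by
    intro I hI
    -- Cautious answers intersect over the target parts of stable models, which are exactly the
    -- bounded supported solutions; by the first claim these determine the certain answers.
    rw [hscert I _ hI (isFreshSet_freshConsts hf hk d I), ← himage I hI, Set.biInter_image]
    rfl
  refine ⟨hscert, fun I => (freshConsts k d I).toFinset, extendDatabase 𝒮.domName fixed k d,
    ⟨polyTimeOn_extendDatabase (fun I hI a ha e => ?_) (Finset.nodup_toList _) hk,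
      fun x hx => ?_⟩,
    fun I hI => ⟨isFreshSet_freshConsts hf hk d I, himage I hI, hcautious I hI⟩⟩
  · exact Setting.domFact_rel_notMem [] (Finset.mem_union_left _ (e ▸ hI a ha))
  · rw [SCERT, CANS, hcautious x.1 hx]
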